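/- Let $\mathcal R$ be a commutative ring with identity and $n\ge 1$. For a polynomial $g$ over $\mathcal R$ let $\#g$ be its number of terms and $\deg g$ its total degree; for $\mathbf s\in\mathbb N^n$ let $g(x^{\mathbf s})=g(x^{s_1},\dots,x^{s_n})$, and let $\mathbf I_k$ be the $k$-th unit vector. The algorithm HalfPoly takes as input a black box for $f\in\mathcal R[x_1,\dots,x_n]$ (which may be evaluated in commutative $\mathcal R$-algebras, e.g. in extensions of a finite field), a polynomial $f^*\in\mathcal R[x_1,\dots,x_n]$ given by the list of its terms, integers $T,T_1$ with $T\ge\max(\#f,\#f^*)$, $T_1\ge\#(f-f^*)$, $T\ge T_1\ge1$, an integer $D\ge\max(\deg f,\deg f^*)$ and a real $\nu\in(0,1)$. A univariate interpolation algorithm is given, which from a black box for $g$, a degree bound and a term bound for $g$ finds the terms of a univariate polynomial $g$ over $\mathcal R$. HalfPoly works as follows. 1. Let $l=\lceil 32\ln(T_1/\nu)\rceil$ and $N=\max\{31\lfloor(T_1-1)\log_2D\rfloor,1\}$ (with $N=1$ if $D=0$). Find, by the sieve of Eratosthenes, the first $N$ primes that are $\ge 32(T_1-1)$. 2. For $i=1,\dots,l$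 choose, independently and uniformly at random, one of these primes, $p_i$, and then $\mathbf s_i\in\{0,\dots,p_i-1\}^n$. Delete repeated pairs $(p_i,\mathbf s_i)$. 3. For each pair, find $f(x^{\mathbf s_i})$ by univariate interpolation with degree bound $\|\mathbf s_i\|_\infty D$ and term bound $T$; compute $f_i=f(x^{\mathbf s_i})-f^*(x^{\mathbf s_i})$ and $f_i^{\bmod}=f_i \bmod (x^{p_i}-1)$. 4. Choose $j$ such that $\#f_j^{\bmod}$ is maximal; let $p=p_j$, $\mathbf s=\mathbf s_j$. If $\#f_j^{\bmod}>T_1$, return failure. 5. For $k=1,\dots,n$ find $f(x^{\mathbf s+p\mathbf I_k})$ by univariate interpolation with degree bound $\|\mathbf s+p\mathbf I_k\|_\infty D$ and term bound $T$, and compute $g_k=f(x^{\mathbf s+p\mathbf I_k})-f^*(x^{\mathbf s+p\mathbf I_k})$. 6. For each term $ax^d$ of $f_j^{\bmod}$ such that $f_j$ has exactly one monomial $x^u$ with $u\equiv d \pmod p$ and every $g_k$ has exactly one monomial $x^{b_k}$ with $b_k\equiv d\pmod p$: let $e_k=(b_k-u)/p$; if all $e_k\in\mathbb N$, $u=\sum_k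 e_ks_k$ and $\sum_k e_k\le D$, select the term $a\,x_1^{e_1}\cdots x_n^{e_n}$. 7. Return the sum $h$ of the selected terms. Costs are counted as follows: the interpolations; the operations in $\mathcal R$ (addition, negation, test for zero); and the bit operations, where adding, subtracting or comparing integers costs the sum of their bit lengths, a multiplication or division with remainder the product of the bit lengths, an array access the bit length of the index, a uniform random integer below $m$ the bit length of $m$, and each step along a list a constant. Lists are sorted by merge sort. The evaluation of the two expressions for $l$ and $N$ is not counted. Write $\log^+x=\max\{1,\log x\}$, and let $O^\sim(\varphi)$ stand for a bound $C\varphi(1+\log\varphi)^k$. Claim. There are absolute constants $C,k$ such that for all inputs as above: (a) With probability $\ge1-\nu$, HalfPoly returns a polynomial $h$ with $\#(f-f^*-h)\le\lfloor T_1/2\rfloor$. And, whatever the random choices are: (b) HalfPoly makes at most $C\,(n+\log T+\log\frac1\nu)$ univariate interpolations; the polynomials interpolated have at most $T$ terms, respect the degree bounds and term bounds that are passed to the interpolation algorithm, and these degree bounds are $O^\sim(TD)$. (c) It needs in addition $O^\sim(nT\log^+\frac1\nu)$ ring operations and $O^\sim(nT\,\log^+D\,\log^+\frac1\nu)$ bit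 operations. -/

import Mathlib

namespace SparseInterp

/-! ### Sparse representations and the substitution `f ↦ f(x^s)` -/

/-- The univariate polynomial with the given list of terms `(exponent, coefficient)`. -/
noncomputable def toPoly {R : Type*} [CommRing R] (L : List (ℕ × R)) : Polynomial R :=
  (L.map fun t => Polynomial.monomial t.1 t.2).sum

/-- The polynomial in `n` indeterminates with the given list of terms
`(exponent vector, coefficient)`. -/
noncomputable def toMvPoly (n : ℕ) {R : Type*} [CommRing R] (L : List (List ℕ × R)) :
    MvPolynomial (Fin n) R :=
  (L.map fun t =>
    MvPolynomial.monomial (Finsupp.equivFunOnFinite.symm fun i : Fin n => t.1.getD i 0) t.2).sum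

/-- `L` lists the terms of `g`: distinct exponents, nonzero coefficients, in any order. -/
def IsSparseRep {R : Type*} [CommRing R] (L : List (ℕ × R)) (g : Polynomial R) : Prop :=
  (L.map Prod.fst).Nodup ∧ (∀ t ∈ L, t.2 ≠ 0) ∧ toPoly L = g

/-- `L` lists the terms of `g`: distinct exponent vectors of length `n`, nonzero coefficients,
in any order. -/
def IsMvSparseRep (n : ℕ) {R : Type*} [CommRing R] (L : List (List ℕ × R))
    (g : MvPolynomial (Fin n) R) : Prop :=
  (L.map Prod.fst).Nodup ∧ (∀ t ∈ L, t.1.length = n ∧ t.2 ≠ 0) ∧ toMvPoly n L = g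

/-- `f(x^s) = f(x^{s_1}, …, x^{s_n})`. -/
noncomputable def kron {n : ℕ} {R : Type*} [CommRing R] (f : MvPolynomial (Fin n) R)
    (s : List ℕ) : Polynomial R :=
  MvPolynomial.aeval (fun i : Fin n => (Polynomial.X : Polynomial R) ^ s.getD i 0) f

/-! ### Black boxes and univariate interpolation

For a degree bound `d`, black boxes are evaluated in a commutative `R`-algebra `S d` (for
instance `R` itself, or an extension of a finite field that has more than `d` elements). -/

/-- `B` is a black box that computes `f`. -/
def IsBlackBox {n : ℕ} {R : Type*} [CommRing R] {S : ℕ → Type*} [∀ d, CommRing (S d)]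
    [∀ d, Algebra R (S d)] (B : ∀ d, (Fin n → S d) → S d) (f : MvPolynomial (Fin n) R) : Prop :=
  ∀ d a, B d a = MvPolynomial.aeval a f

/-- `A` is a univariate interpolation algorithm: from a degree bound `d`, a black box for a
univariate polynomial `g` and a term bound `t` it finds the terms of `g`. -/
def IsInterpolator {R : Type*} [CommRing R] {S : ℕ → Type*} [∀ d, CommRing (S d)]
    [∀ d, Algebra R (S d)] (A : ∀ d, (S d → S d) → ℕ → List (ℕ × R)) : Prop :=
  ∀ (d t : ℕ) (g : Polynomial R), g.natDegree ≤ d → g.support.card ≤ t →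
    IsSparseRep (A d (fun a => Polynomial.aeval a g) t) g

/-! ### Cost model

A computation carries the list of univariate interpolations it asked for, the number of
operations in `R` (addition, negation, test for zero), and the number of bit operations: adding,
subtracting or comparing integers costs the sum of their bit lengths, multiplication and division
with remainder the product of the bit lengths (schoolbook), an access to an array the bit length of
the index, a random integer below `m` the bit length of `m`, and every step along a list at
least one bit operation. -/

/-- One call of the univariate interpolation algorithm: it asks for `f(x^s)`. -/
structure Query where
  exps : List ℕ
  degBound : ℕ
  termBound : ℕ

structure Cost where
  queries : List Query
  ringOps : ℕ
  bitOps : ℕ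

def Cost.add (c c' : Cost) : Cost :=
  ⟨c.queries ++ c'.queries, c.ringOps + c'.ringOps, c.bitOps + c'.bitOps⟩

/-- A value together with the cost of computing it. -/
structure Timed (α : Type*) where
  val : α
  cost : Cost

namespace Timed

def ret {α : Type*} (a : α) : Timed α := ⟨a, ⟨[], 0, 0⟩⟩

/-- Sequential composition: the costs add up. -/
def bind {α : Type*} {β : Type*} (x : Timed α) (f : α → Timed β) : Timed β :=
  ⟨(f x.val).val, x.cost.add (f x.val).cost⟩

end Timed

open Timed

/-! Primitive operations. -/

/-- `b` bit operations of bookkeeping. -/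
def tick (b : ℕ) : Timed Unit := ⟨(), ⟨[], 0, b⟩⟩

def addN (a b : ℕ) : Timed ℕ := ⟨a + b, ⟨[], 0, 1 + a.size + b.size⟩⟩
def subN (a b : ℕ) : Timed ℕ := ⟨a - b, ⟨[], 0, 1 + a.size + b.size⟩⟩
def maxN (a b : ℕ) : Timed ℕ := ⟨max a b, ⟨[], 0, 1 + a.size + b.size⟩⟩
def leN (a b : ℕ) : Timed Bool := ⟨decide (a ≤ b), ⟨[], 0, 1 + a.size + b.size⟩⟩
def eqN (a b : ℕ) : Timed Bool := ⟨decide (a = b), ⟨[], 0, 1 + a.size + b.size⟩⟩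
def mulN (a b : ℕ) : Timed ℕ := ⟨a * b, ⟨[], 0, (1 + a.size) * (1 + b.size)⟩⟩
def divModN (a b : ℕ) : Timed (ℕ × ℕ) :=
  ⟨(a / b, a % b), ⟨[], 0, (1 + a.size) * (1 + b.size)⟩⟩

/-- Read entry `k` of an array of integers. -/
def readN (l : List ℕ) (k : ℕ) : Timed ℕ := ⟨l.getD k 0, ⟨[], 0, 1 + k.size⟩⟩

/-- Read entry `k` of an array of bits. -/
def readBit (a : ℕ → Bool) (k : ℕ) : Timed Bool := ⟨a k, ⟨[], 0, 1 + k.size⟩⟩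

/-- Write entry `k` of an array of bits. -/
def writeBit (a : ℕ → Bool) (k : ℕ) (b : Bool) : Timed (ℕ → Bool) :=
  ⟨Function.update a k b, ⟨[], 0, 1 + k.size⟩⟩

def addR {R : Type*} [CommRing R] (a b : R) : Timed R := ⟨a + b, ⟨[], 1, 0⟩⟩
def negR {R : Type*} [CommRing R] (a : R) : Timed R := ⟨-a, ⟨[], 1, 0⟩⟩
def isZeroR {R : Type*} [CommRing R] [DecidableEq R] (a : R) : Timed Bool :=
  ⟨decide (a = 0), ⟨[], 1, 0⟩⟩

/-- Find `f(x^s)` from the black box `B` for `f`, by the interpolation algorithm `A` with degree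
bound `d` and term bound `t`. -/
def query {n : ℕ} {R : Type*} {S : ℕ → Type*} [∀ d, CommRing (S d)]
    (B : ∀ d, (Fin n → S d) → S d) (A : ∀ d, (S d → S d) → ℕ → List (ℕ × R))
    (s : List ℕ) (d t : ℕ) : Timed (List (ℕ × R)) :=
  ⟨A d (fun a => B d fun i : Fin n => a ^ s.getD i 0) t, ⟨[⟨s, d, t⟩], 0, 0⟩⟩

/-! ### List routines -/

def mapT {α : Type*} {β : Type*} (g : α → Timed β) : List α → Timed (List β)
  | [] => ret []
  | a :: l =>
      (tick 1).bind fun _ =>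
      (g a).bind fun b =>
      (mapT g l).bind fun bs => ret (b :: bs)

def filterMapT {α : Type*} {β : Type*} (g : α → Timed (Option β)) : List α → Timed (List β)
  | [] => ret []
  | a :: l =>
      (tick 1).bind fun _ =>
      (g a).bind fun b =>
      (filterMapT g l).bind fun bs => ret (b.toList ++ bs)

def lengthT {α : Type*} : List α → Timed ℕ
  | [] => ret 0
  | _ :: l => (lengthT l).bind fun c => addN c 1

def appendT {α : Type*} (l m : List α) : Timed (List α) :=
  (tick l.length).bind fun _ => ret (l ++ m)

def mergeT {α : Type*} (le : α → α → Timed Bool) : List α → List α → Timed (List α)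
  | [], ys => ret ys
  | xs, [] => ret xs
  | x :: xs, y :: ys =>
      (tick 1).bind fun _ =>
      (le x y).bind fun b =>
      if b then (mergeT le xs (y :: ys)).bind fun r => ret (x :: r)
      else (mergeT le (x :: xs) ys).bind fun r => ret (y :: r)
  termination_by xs ys => xs.length + ys.length

/-- Merge sort. -/
def sortT {α : Type*} (le : α → α → Timed Bool) : List α → Timed (List α)
  | [] => ret []
  | [a] => ret [a]
  | a :: b :: l =>
      (tick (2 * (l.length + 2))).bind fun _ =>
      (sortT le ((a :: b :: l).take ((l.length + 2) / 2))).bind fun xs =>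
      (sortT le ((a :: b :: l).drop ((l.length + 2) / 2))).bind fun ys =>
      mergeT le xs ys
  termination_by l => l.length
  decreasing_by
    all_goals simp only [List.length_take, List.length_drop, List.length_cons]; omega

/-- Comparison by the first component. -/
def keyLe {α : Type*} (x y : ℕ × α) : Timed Bool := leN x.1 y.1

/-- Lexicographic comparison. -/
def lexLe : List ℕ → List ℕ → Timed Bool
  | [], _ => (tick 1).bind fun _ => ret true
  | _ :: _, [] => (tick 1).bind fun _ => ret false
  | x :: xs, y :: ys =>
      (eqN x y).bind fun b => if b then lexLe xs ys else leN x y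

/-- Delete repetitions from a list that is sorted with respect to `le`. -/
def dedupSortedT {α : Type*} (le : α → α → Timed Bool) : List α → Timed (List α)
  | [] => ret []
  | [a] => ret [a]
  | a :: b :: l =>
      (tick 1).bind fun _ =>
      (le b a).bind fun c =>
      (dedupSortedT le (b :: l)).bind fun r => ret (if c then r else a :: r)

/-- `acc + ∑ e_k s_k`. -/
def dotT : ℕ → List ℕ → List ℕ → Timed ℕ
  | acc, e :: es, s :: ss =>
      (mulN e s).bind fun x =>
      (addN acc x).bind fun acc' => dotT acc' es ss
  | acc, _, _ => ret acc

def sumT : ℕ → List ℕ → Timed ℕ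
  | acc, [] => ret acc
  | acc, e :: es => (addN acc e).bind fun acc' => sumT acc' es

def maxT : ℕ → List ℕ → Timed ℕ
  | acc, [] => ret acc
  | acc, s :: ss => (maxN acc s).bind fun acc' => maxT acc' ss

/-! ### Arithmetic of sparse univariate polynomials -/

/-- Add up the terms of equal exponent in `(e, c) :: l`, which is sorted by exponents, and delete
the zero terms. -/
def collectT {R : Type*} [CommRing R] [DecidableEq R] (e : ℕ) (c : R) :
    List (ℕ × R) → Timed (List (ℕ × R))
  | [] => (isZeroR c).bind fun z => ret (if z then [] else [(e, c)])
  | t :: l =>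
      (eqN e t.1).bind fun b =>
      if b then (addR c t.2).bind fun c' => collectT e c' l
      else
        (isZeroR c).bind fun z =>
        (collectT t.1 t.2 l).bind fun r => ret (if z then r else (e, c) :: r)

/-- The sparse representation, sorted by exponents, of the sum of a list of terms. -/
def normalizeT {R : Type*} [CommRing R] [DecidableEq R] (L : List (ℕ × R)) :
    Timed (List (ℕ × R)) :=
  (sortT keyLe L).bind fun M =>
  match M with
  | [] => ret []
  | t :: l => collectT t.1 t.2 l

/-- Subtraction. -/
def subPolyT {R : Type*} [CommRing R] [DecidableEq R] (P Q : List (ℕ × R)) :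
    Timed (List (ℕ × R)) :=
  (mapT (fun t : ℕ × R => (negR t.2).bind fun c => ret (t.1, c)) Q).bind fun Q' =>
  (appendT P Q').bind fun L => normalizeT L

/-- Reduction modulo `x^p - 1`. -/
def modPolyT {R : Type*} [CommRing R] [DecidableEq R] (p : ℕ) (P : List (ℕ × R)) :
    Timed (List (ℕ × R)) :=
  (mapT (fun t : ℕ × R => (divModN t.1 p).bind fun qr => ret (qr.2, t.2)) P).bind fun L =>
  normalizeT L

/-- The terms of `g(x^s)`, from the terms of `g`; each comes with its term of `g`. -/
def substT {R : Type*} (G : List (List ℕ × R)) (s : List ℕ) :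
    Timed (List (ℕ × (List ℕ × R))) :=
  mapT (fun t : List ℕ × R => (dotT 0 t.1 s).bind fun d => ret (d, t)) G

/-! ### The sieve of Eratosthenes -/

/-- Delete `c` numbers, from `j` on in steps of `q`. -/
def markT (q : ℕ) : ℕ → ℕ → (ℕ → Bool) → Timed (ℕ → Bool)
  | 0, _, a => ret a
  | c + 1, j, a =>
      (writeBit a j false).bind fun a' =>
      (addN j q).bind fun j' => markT q c j' a'

/-- For `r` consecutive values of `q`: if `q` is not deleted, delete `2q, 3q, … ≤ b`. -/
def sieveLoopT (b : ℕ) : ℕ → ℕ → (ℕ → Bool) → Timed (ℕ → Bool)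
  | 0, _, a => ret a
  | r + 1, q, a =>
      (readBit a q).bind fun isPrime =>
      (if isPrime then
        (divModN b q).bind fun qr =>
        (subN qr.1 1).bind fun c =>
        (addN q q).bind fun j => markT q c j a
      else ret a).bind fun a' =>
      (addN q 1).bind fun q' => sieveLoopT b r q' a'

/-- The numbers that are not deleted among `r` consecutive numbers from `i` on. -/
def survivorsT (a : ℕ → Bool) : ℕ → ℕ → Timed (List ℕ)
  | 0, _ => ret []
  | r + 1, i =>
      (readBit a i).bind fun b =>
      (addN i 1).bind fun i' =>
      (survivorsT a r i').bind fun l => ret (if b then i :: l else l)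

/-- The primes in `[lo, b]`, in increasing order. -/
def sieveT (lo b : ℕ) : Timed (List ℕ) :=
  (tick (b + 1)).bind fun _ =>
  (subN b 1).bind fun r =>
  (sieveLoopT b r 2 fun i => decide (2 ≤ i)).bind fun a =>
  (subN (b + 1) lo).bind fun m => survivorsT a m lo

/-- Sieve up to `b`, and double `b` until `N` primes in `[lo, b]` are found. -/
def searchPrimesT (lo N : ℕ) : ℕ → ℕ → Timed (List ℕ)
  | 0, _ => ret []
  | fuel + 1, b =>
      (sieveT lo b).bind fun ps =>
      (lengthT ps).bind fun c =>
      (leN N c).bind fun enough =>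
      if enough then (tick N).bind fun _ => ret (ps.take N)
      else (addN b b).bind fun b' => searchPrimesT lo N fuel b'

/-- The first `N` primes that are at least `lo`. (There is a prime between `b` and `2b`, so that
`N` doublings suffice.) -/
def firstPrimesT (lo N : ℕ) : Timed (List ℕ) :=
  (addN lo 2).bind fun b => searchPrimesT lo N (N + 1) b

/-! ### Randomized computations -/

/-- A random computation: the joint law of its value and its cost. -/
abbrev Rand (α : Type*) := PMF (Timed α)

noncomputable def Rand.lift {α : Type*} (x : Timed α) : Rand α := PMF.pure x

noncomputable def Rand.bind {α : Type*} {β : Type*} (x : Rand α) (f : α → Rand β) : Rand β :=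
  PMF.bind x fun t => PMF.map (fun t' => ⟨t'.val, t.cost.add t'.cost⟩) (f t.val)

/-- A uniformly distributed element of `{0, …, m - 1}`, for `m ≥ 1`. -/
noncomputable def randBelow (m : ℕ) : Rand ℕ :=
  PMF.map (fun x => ⟨x, ⟨[], 0, 1 + m.size⟩⟩)
    (PMF.uniformOfFinset (Finset.range (max m 1)) ⟨0, by simp⟩)

/-- `m` independent runs of `x`. -/
noncomputable def Rand.replicate {α : Type*} (x : Rand α) : ℕ → Rand (List α)
  | 0 => Rand.lift (ret [])
  | m + 1 =>
      Rand.bind x fun a =>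
      Rand.bind (Rand.lift (tick 1)) fun _ =>
      Rand.bind (Rand.replicate x m) fun l => Rand.lift (ret (a :: l))

/-- A random prime `p` from a list of `N` primes, and then a uniformly distributed
`s ∈ {0, …, p - 1}^n`. -/
noncomputable def randSubst (n N : ℕ) (primes : List ℕ) : Rand (ℕ × List ℕ) :=
  Rand.bind (randBelow N) fun i =>
  Rand.bind (Rand.lift (readN primes i)) fun p =>
  Rand.bind (Rand.replicate (randBelow p) n) fun s => Rand.lift (ret (p, s))

/-- Delete the repeated pairs `(p, s)`. -/
def dedupT (subs : List (ℕ × List ℕ)) : Timed (List (ℕ × List ℕ)) :=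
  (sortT (fun x y : ℕ × List ℕ => lexLe (x.1 :: x.2) (y.1 :: y.2)) subs).bind fun l =>
  dedupSortedT (fun x y : ℕ × List ℕ => lexLe (x.1 :: x.2) (y.1 :: y.2)) l

/-! ### PolySubs -/

/-- From the terms of `g`: the lists of terms of `g(x^{s + p I_k})`, `k = 1, …, n`. -/
def polySubsT {R : Type*} (n : ℕ) (G : List (List ℕ × R)) (s : List ℕ) (p : ℕ) :
    Timed (List (List (ℕ × R))) :=
  (substT G s).bind fun H =>
  mapT (fun k =>
    mapT (fun t : ℕ × (List ℕ × R) =>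
      (readN t.2.1 k).bind fun e =>
      (mulN e p).bind fun x =>
      (addN t.1 x).bind fun d => ret (d, t.2.2)) H) (List.range n)

/-! ### TSTerms -/

/-- In `(d, u) :: l`, sorted by first components, keep the pairs whose first component occurs
exactly once (`single` tells whether `d` did not occur before). -/
def uniqueT (d u : ℕ) (single : Bool) : List (ℕ × ℕ) → Timed (List (ℕ × ℕ))
  | [] => ret (if single then [(d, u)] else [])
  | t :: l =>
      (eqN d t.1).bind fun b =>
      if b then uniqueT d u false l
      else (uniqueT t.1 t.2 true l).bind fun r => ret (if single then (d, u) :: r else r)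

/-- The pairs `(d, u)` such that `x^u` is the unique monomial of `P` with `u mod p = d`, sorted
by `d`. -/
def singlesT {R : Type*} (p : ℕ) (P : List (ℕ × R)) : Timed (List (ℕ × ℕ)) :=
  (mapT (fun t : ℕ × R => (divModN t.1 p).bind fun qr => ret (qr.2, t.1)) P).bind fun L =>
  (sortT keyLe L).bind fun M =>
  match M with
  | [] => ret []
  | t :: l => uniqueT t.1 t.2 true l

/-- Match the entries of equal first component of two lists sorted by first components. -/
def joinT {α : Type*} {β : Type*} : List (ℕ × α) → List (ℕ × β) → Timed (List (ℕ × (α × β)))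
  | [], _ => ret []
  | _ :: _, [] => ret []
  | x :: l, y :: m =>
      (eqN x.1 y.1).bind fun b =>
      if b then (joinT l m).bind fun r => ret ((x.1, (x.2, y.2)) :: r)
      else
        (leN x.1 y.1).bind fun c =>
        if c then joinT l (y :: m) else joinT (x :: l) m
  termination_by l m => l.length + m.length

/-- From the list of `(d, (a, u))` and the polynomials `g_1, …, g_n`: the list of
`(d, ((a, u), [b_1, …, b_n]))`, where `x^{b_k}` is the unique monomial of `g_k` with
`b_k mod p = d`. -/
def matchT {R : Type*} (p : ℕ) (base : List (ℕ × (R × ℕ))) :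
    List (List (ℕ × R)) → Timed (List (ℕ × ((R × ℕ) × List ℕ)))
  | [] => mapT (fun t : ℕ × (R × ℕ) => ret (t.1, (t.2, ([] : List ℕ)))) base
  | g :: gs =>
      (tick 1).bind fun _ =>
      (matchT p base gs).bind fun rest =>
      (singlesT p g).bind fun sg =>
      (joinT rest sg).bind fun j =>
      mapT (fun t : ℕ × (((R × ℕ) × List ℕ) × ℕ) =>
        ret (t.1, (t.2.1.1, t.2.2 :: t.2.1.2))) j

/-- `e_k = (b_k - u) / p` for all `k`, if these are natural numbers. -/
def exponentsT (p u : ℕ) : List ℕ → Timed (Option (List ℕ))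
  | [] => ret (some [])
  | b :: bs =>
      (leN u b).bind fun ok =>
      if ok then
        (subN b u).bind fun x =>
        (divModN x p).bind fun qr =>
        (eqN qr.2 0).bind fun ok' =>
        if ok' then (exponentsT p u bs).bind fun es => ret (es.map fun l => qr.1 :: l)
        else ret none
      else ret none

/-- The term `a x_1^{e_1} ⋯ x_n^{e_n}`, if it passes the tests. -/
def testTermT {R : Type*} (p : ℕ) (s : List ℕ) (D : ℕ) (t : ℕ × ((R × ℕ) × List ℕ)) :
    Timed (Option (List ℕ × R)) :=
  (exponentsT p t.2.1.2 t.2.2).bind fun oes =>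
  match oes with
  | none => ret none
  | some es =>
      (dotT 0 es s).bind fun u =>
      (eqN t.2.1.2 u).bind fun ok =>
      if ok then
        (sumT 0 es).bind fun m =>
        (leN m D).bind fun ok' => ret (if ok' then some (es, t.2.1.1) else none)
      else ret none

/-- The terms recovered from `fmod = g(x^s) mod (x^p - 1)`, `fs = g(x^s)` and
`gs = [g(x^{s + p I_1}), …, g(x^{s + p I_n})]`. -/
def tsTermsT {R : Type*} (fmod fs : List (ℕ × R)) (gs : List (List (ℕ × R)))
    (p : ℕ) (s : List ℕ) (D : ℕ) : Timed (List (List ℕ × R)) :=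
  (singlesT p fs).bind fun sg =>
  (joinT fmod sg).bind fun base =>
  (matchT p base gs).bind fun recs =>
  filterMapT (testTermT p s D) recs

/-! ### HalfPoly -/

/-- What is kept of a substitution: `p`, `s`, `‖s‖_∞`, `f_i`, `f_i mod (x^p - 1)`, and the number
of terms of the latter. -/
structure Image (R : Type*) where
  p : ℕ
  s : List ℕ
  norm : ℕ
  poly : List (ℕ × R)
  polyMod : List (ℕ × R)
  count : ℕ

/-- For one pair `(p, s)`: interpolate `f(x^s)`, and compute `f_i = f(x^s) - f^*(x^s)` and
`f_i mod (x^p - 1)`. -/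
def imageT {n : ℕ} {R : Type*} [CommRing R] [DecidableEq R] {S : ℕ → Type*}
    [∀ d, CommRing (S d)] (B : ∀ d, (Fin n → S d) → S d)
    (A : ∀ d, (S d → S d) → ℕ → List (ℕ × R)) (F : List (List ℕ × R)) (T D : ℕ)
    (ps : ℕ × List ℕ) : Timed (Image R) :=
  (maxT 0 ps.2).bind fun m =>
  (mulN m D).bind fun d =>
  (query B A ps.2 d T).bind fun P =>
  (substT F ps.2).bind fun H =>
  (mapT (fun t : ℕ × (List ℕ × R) => ret (t.1, t.2.2)) H).bind fun Q =>
  (subPolyT P Q).bind fun fi =>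
  (modPolyT ps.1 fi).bind fun fm =>
  (lengthT fm).bind fun c =>
  ret ⟨ps.1, ps.2, m, fi, fm, c⟩

/-- An image with the maximal number of terms. -/
def bestT {R : Type*} : Image R → List (Image R) → Timed (Image R)
  | best, [] => ret best
  | best, i :: l =>
      (leN i.count best.count).bind fun b => if b then bestT best l else bestT i l

/-- `g_k = f(x^{s + p I_k}) - f^*_k`, where `Fk` lists the terms of `f^*_k`. -/
def shiftedT {n : ℕ} {R : Type*} [CommRing R] [DecidableEq R] {S : ℕ → Type*}
    [∀ d, CommRing (S d)] (B : ∀ d, (Fin n → S d) → S d)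
    (A : ∀ d, (S d → S d) → ℕ → List (ℕ × R)) (T D : ℕ) (im : Image R)
    (kF : ℕ × List (ℕ × R)) : Timed (List (ℕ × R)) :=
  (readN im.s kF.1).bind fun sk =>
  (addN sk im.p).bind fun x =>
  (maxN im.norm x).bind fun m =>
  (mulN m D).bind fun d =>
  (query B A (im.s.modify kF.1 fun y => y + im.p) d T).bind fun P =>
  subPolyT P kF.2

/-- Everything after the random choices: `subs` is the list of the chosen pairs `(p, s)`. The
value `none` means failure. -/
def recoverT {n : ℕ} {R : Type*} [CommRing R] [DecidableEq R] {S : ℕ → Type*}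
    [∀ d, CommRing (S d)] (B : ∀ d, (Fin n → S d) → S d)
    (A : ∀ d, (S d → S d) → ℕ → List (ℕ × R)) (F : List (List ℕ × R)) (T T₁ D : ℕ)
    (subs : List (ℕ × List ℕ)) : Timed (Option (List (List ℕ × R))) :=
  (dedupT subs).bind fun subs' =>
  (mapT (imageT B A F T D) subs').bind fun images =>
  match images with
  | [] => ret none
  | i :: l =>
      (bestT i l).bind fun im =>
      (leN im.count T₁).bind fun ok =>
      if ok then
        (polySubsT n F im.s im.p).bind fun Fs =>
        (mapT (shiftedT B A T D im) ((List.range n).zip Fs)).bind fun gs =>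
        (tsTermsT im.polyMod im.poly gs im.p im.s D).bind fun ts => ret (some ts)
      else ret none

/-- The number of substitutions, `⌈32 ln(T₁ / ν)⌉`. -/
noncomputable def numSubsts (T₁ : ℕ) (ν : ℝ) : ℕ := ⌈32 * Real.log (T₁ / ν)⌉₊

/-- The number of primes, `max {31 ⌊(T₁ - 1) log₂ D⌋, 1}`. -/
noncomputable def numPrimes (T₁ D : ℕ) : ℕ := max (31 * ⌊((T₁ : ℝ) - 1) * Real.logb 2 D⌋₊) 1

/-- Algorithm HalfPoly, with black box `B` for `f`, univariate interpolation algorithm `A`, list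
`F` of the terms of `f^*`, term bounds `T`, `T₁`, degree bound `D` and tolerance `ν`. The value is
the list of the terms of `h`, or `none` for failure. -/
noncomputable def halfPoly {n : ℕ} {R : Type*} [CommRing R] [DecidableEq R] {S : ℕ → Type*}
    [∀ d, CommRing (S d)] (B : ∀ d, (Fin n → S d) → S d)
    (A : ∀ d, (S d → S d) → ℕ → List (ℕ × R)) (F : List (List ℕ × R)) (T T₁ D : ℕ) (ν : ℝ) :
    Rand (Option (List (List ℕ × R))) :=
  Rand.bind (Rand.lift
    ((subN T₁ 1).bind fun x =>
     (mulN 32 x).bind fun lo => firstPrimesT lo (numPrimes T₁ D))) fun primes =>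
  Rand.bind (Rand.replicate (randSubst n (numPrimes T₁ D) primes) (numSubsts T₁ ν)) fun subs =>
  Rand.lift (recoverT B A F T T₁ D subs)

/-! ### Asymptotic bounds -/

/-- The bound `C φ (1 + log φ)^k` in `O^~(φ)`. -/
noncomputable def softO (C : ℝ) (k : ℕ) (φ : ℝ) : ℝ := C * φ * (1 + Real.log φ) ^ k

/-- `max {1, log x}`. -/
noncomputable def logp (x : ℝ) : ℝ := max 1 (Real.log x)

end SparseInterp

/-! Put `g = f - fstar` and `t = #g`. A pair `(p, s)` sends the monomial `x^e` to the residue of `∑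
e_i s_i` modulo `p`. Call a term of `g` isolated if no other term of `g` has the same residue. Let
`i` be the number of isolated terms and `c` the number of terms of `g(x^s) mod (x^p - 1)`.

Correctness. An isolated term cannot merge with or be cancelled by another one: its coefficient is
visible modulo `x^p - 1`, and its image is the only monomial in its residue class, in `g(x^s)` and
in all `g(x^(s + p I_k))`. Passing from `s` to `s + p I_k` adds `e_k p` to the exponent and keeps
the residue (`kronExp_modify`), so that the differences give all `e_k`. Hence every isolated term is
selected (`mem_tsTermsT`, `mem_singlesT_of_isolated`). Each residue yields at most one selected
term, so at most `c - i` selected terms are not isolated, and the error has at most `(t - i) + (c -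
i)` terms (`card_support_sub_toMvPoly_le`). A residue class that is hit by `g` contains two terms of
`g` or a single isolated one, so `2c ≤ t + i`. Together the error is at most `3 (t - c)`
(`sub_recovered_le`). The number `c` is observable, which is why the pair with maximal `c` is
chosen: since `c ≥ i`, it suffices that some sampled pair satisfies `6 (t - i) ≤ T₁`
(`recoverT_spec`).

Probability. Let `e ≠ e'` be exponent vectors of `g`. A coordinate in which they differ has a
difference of absolute value at most `D`, with at most `log₂ D` prime divisors. For every other `p`,
the vectors collide only if a nontrivial linear form over `ZMod p` vanishes at `s`, which has
probability at most `1 / p`. With the given `N` and lower bound for the primes, a term is not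
isolated with probability at most `1/31 + 1/32`. By Markov's inequality a pair violates `6 (t - i) ≤
T₁` with probability below `1/2` (`expect_bad_le`), and all `l` independent pairs do so with
probability at most `2^(-l) ≤ ν`.

Cost. There are `l + n` interpolations. All remaining work is sorting, merging and scanning lists of
`O(T)` terms, for `l` pairs and `n` shifts, and the sieve. Primes, lengths and indices have `K`
bits, exponents have `W` bits. In every product one factor, and in every division the divisor, is
short, so that one operation costs `opCost K W` and `log D` enters only linearly. Chebyshev's lower
bound for the number of primes (`le_primeCounting_primeBound`) shows that the primes are quasilinear
in `T log D`. It also bounds the range of the sieve. -/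

namespace SparseInterp

open Timed

/-! ### Bounds on costs -/

/-- The computation `x` makes at most `m` interpolations, all of which satisfy `P`, at most `r`
ring operations, and at most `b` bit operations. -/
structure Timed.Within {α : Type*} (P : Query → Prop) (x : Timed α) (m r b : ℕ) : Prop where
  length_le : x.cost.queries.length ≤ m
  forall_queries : ∀ q ∈ x.cost.queries, P q
  ringOps_le : x.cost.ringOps ≤ r
  bitOps_le : x.cost.bitOps ≤ b

section Timed

variable {α β : Type*} {P : Query → Prop}

theorem Timed.Within.mono {x : Timed α} {m r b m' r' b' : ℕ} (h : x.Within P m r b)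
    (hm : m ≤ m') (hr : r ≤ r') (hb : b ≤ b') : x.Within P m' r' b' :=
  ⟨h.1.trans hm, h.2, h.3.trans hr, h.4.trans hb⟩

theorem Timed.Within.monoBits {x : Timed α} {b b' : ℕ} (h : x.Within P 0 0 b)
    (hb : b ≤ b') : x.Within P 0 0 b' :=
  h.mono le_rfl le_rfl hb

/-- The continuation has to be bounded only at the actual value of `x`. Cost proofs can therefore
use what is known about intermediate results, such as lengths and sizes. -/
theorem Timed.Within.bind {x : Timed α} {f : α → Timed β} {m r b m' r' b' : ℕ}
    (hx : x.Within P m r b) (hf : (f x.val).Within P m' r' b') :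
    (x.bind f).Within P (m + m') (r + r') (b + b') := by
  refine ⟨?_, ?_, ?_, ?_⟩
  · simpa [Timed.bind, Cost.add] using add_le_add hx.1 hf.1
  · intro q hq
    simp only [Timed.bind, Cost.add, List.mem_append] at hq
    exact hq.elim (hx.2 q) (hf.2 q)
  · simpa [Timed.bind, Cost.add] using add_le_add hx.3 hf.3
  · simpa [Timed.bind, Cost.add] using add_le_add hx.4 hf.4

/-- Sequential composition of computations without interpolations and ring operations. -/
theorem Timed.Within.bindBits {x : Timed α} {f : α → Timed β} {b b' : ℕ}
    (hx : x.Within P 0 0 b) (hf : (f x.val).Within P 0 0 b') :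
    (x.bind f).Within P 0 0 (b + b') :=
  hx.bind hf

theorem Timed.within_ret (a : α) : (ret a).Within P 0 0 0 :=
  ⟨le_rfl, by simp [ret], le_rfl, le_rfl⟩

/-- Postprocessing without cost. -/
theorem Timed.Within.bindRet {x : Timed α} {g : α → β} {m r b : ℕ} (h : x.Within P m r b) :
    (x.bind fun a => ret (g a)).Within P m r b :=
  Timed.Within.bind (f := fun a => ret (g a)) h (within_ret _)

theorem within_of_bitOps (a : α) (b : ℕ) :
    (⟨a, ⟨[], 0, b⟩⟩ : Timed α).Within P 0 0 b :=
  ⟨le_rfl, by simp, le_rfl, le_rfl⟩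

@[simp] theorem Timed.bind_val (x : Timed α) (f : α → Timed β) :
    (x.bind f).val = (f x.val).val := rfl

@[simp] theorem Timed.ret_val (a : α) : (ret a).val = a := rfl

@[simp] theorem addN_val (a b : ℕ) : (addN a b).val = a + b := rfl
@[simp] theorem subN_val (a b : ℕ) : (subN a b).val = a - b := rfl
@[simp] theorem maxN_val (a b : ℕ) : (maxN a b).val = max a b := rfl
@[simp] theorem leN_val (a b : ℕ) : (leN a b).val = decide (a ≤ b) := rfl
@[simp] theorem eqN_val (a b : ℕ) : (eqN a b).val = decide (a = b) := rfl
@[simp] theorem mulN_val (a b : ℕ) : (mulN a b).val = a * b := rfl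
@[simp] theorem divModN_val (a b : ℕ) : (divModN a b).val = (a / b, a % b) := rfl
@[simp] theorem readN_val (l : List ℕ) (k : ℕ) : (readN l k).val = l.getD k 0 := rfl
@[simp] theorem readBit_val (a : ℕ → Bool) (k : ℕ) : (readBit a k).val = a k := rfl
@[simp] theorem writeBit_val (a : ℕ → Bool) (k : ℕ) (b : Bool) :
    (writeBit a k b).val = Function.update a k b := rfl
@[simp] theorem negR_val {R : Type*} [CommRing R] (a : R) : (negR a).val = -a := rfl
@[simp] theorem isZeroR_val {R : Type*} [CommRing R] [DecidableEq R] (a : R) :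
    (isZeroR a).val = decide (a = 0) := rfl

end Timed

/-! ### The cost of the primitive operations

The numbers that occur have at most `W` bits; one factor of each product, and each divisor, has at
most `K` bits. -/

/-- A bound on the cost of a primitive operation. -/
def opCost (K W : ℕ) : ℕ := (2 + K) * (2 + W)

theorem four_le_opCost (K W : ℕ) : 4 ≤ opCost K W := by
  unfold opCost; nlinarith [Nat.zero_le K, Nat.zero_le W, Nat.zero_le (K * W)]

/-- Makes the bound for a product also serve for the operations of linear cost, so that all
primitive operations are charged alike. -/
theorem linear_le_opCost (K W : ℕ) : 1 + W + W ≤ opCost K W := by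
  unfold opCost; nlinarith [Nat.zero_le K, Nat.zero_le W, Nat.zero_le (K * W)]

section Primitive

variable {P : Query → Prop} {K W a b : ℕ}

theorem within_tick (b : ℕ) : (tick b).Within P 0 0 b := within_of_bitOps _ _

theorem within_addN (ha : a.size ≤ W) (hb : b.size ≤ W) :
    (addN a b).Within P 0 0 (opCost K W) :=
  (within_of_bitOps _ _).monoBits (by have := linear_le_opCost K W; omega)

theorem within_subN (ha : a.size ≤ W) (hb : b.size ≤ W) :
    (subN a b).Within P 0 0 (opCost K W) :=
  (within_of_bitOps _ _).monoBits (by have := linear_le_opCost K W; omega)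

theorem within_maxN (ha : a.size ≤ W) (hb : b.size ≤ W) :
    (maxN a b).Within P 0 0 (opCost K W) :=
  (within_of_bitOps _ _).monoBits (by have := linear_le_opCost K W; omega)

theorem within_leN (ha : a.size ≤ W) (hb : b.size ≤ W) :
    (leN a b).Within P 0 0 (opCost K W) :=
  (within_of_bitOps _ _).monoBits (by have := linear_le_opCost K W; omega)

theorem within_eqN (ha : a.size ≤ W) (hb : b.size ≤ W) :
    (eqN a b).Within P 0 0 (opCost K W) :=
  (within_of_bitOps _ _).monoBits (by have := linear_le_opCost K W; omega)

theorem within_mulN_left (ha : a.size ≤ K) (hb : b.size ≤ W) :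
    (mulN a b).Within P 0 0 (opCost K W) :=
  (within_of_bitOps _ _).monoBits (Nat.mul_le_mul (by omega) (by omega))

theorem within_mulN_right (ha : a.size ≤ W) (hb : b.size ≤ K) :
    (mulN a b).Within P 0 0 (opCost K W) :=
  (within_of_bitOps _ _).monoBits
    ((Nat.mul_comm _ _).trans_le (Nat.mul_le_mul (by omega) (by omega)))

theorem within_divModN (ha : a.size ≤ W) (hb : b.size ≤ K) :
    (divModN a b).Within P 0 0 (opCost K W) :=
  (within_of_bitOps _ _).monoBits
    ((Nat.mul_comm _ _).trans_le (Nat.mul_le_mul (by omega) (by omega)))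

theorem within_readN (l : List ℕ) (ha : a.size ≤ W) :
    (readN l a).Within P 0 0 (opCost K W) :=
  (within_of_bitOps _ _).monoBits (by have := linear_le_opCost K W; omega)

theorem within_readBit (f : ℕ → Bool) (ha : a.size ≤ W) :
    (readBit f a).Within P 0 0 (opCost K W) :=
  (within_of_bitOps _ _).monoBits (by have := linear_le_opCost K W; omega)

theorem within_writeBit (f : ℕ → Bool) (v : Bool) (ha : a.size ≤ W) :
    (writeBit f a v).Within P 0 0 (opCost K W) :=
  (within_of_bitOps _ _).monoBits (by have := linear_le_opCost K W; omega)

variable {R : Type*} [CommRing R]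

theorem within_addR (x y : R) : (addR x y).Within P 0 1 0 :=
  ⟨le_rfl, by simp [addR], le_rfl, le_rfl⟩

theorem within_negR (x : R) : (negR x).Within P 0 1 0 :=
  ⟨le_rfl, by simp [negR], le_rfl, le_rfl⟩

theorem within_isZeroR [DecidableEq R] (x : R) : (isZeroR x).Within P 0 1 0 :=
  ⟨le_rfl, by simp [isZeroR], le_rfl, le_rfl⟩

end Primitive

/-! ### List routines -/

section Lists

variable {α β : Type*} {P : Query → Prop}

@[simp] theorem mapT_val (g : α → Timed β) (l : List α) :
    (mapT g l).val = l.map fun a => (g a).val := by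
  induction l with
  | nil => rfl
  | cons a l ih => simp [mapT, ih]

theorem within_mapT {g : α → Timed β} {l : List α} {m r b : ℕ}
    (h : ∀ a ∈ l, (g a).Within P m r b) :
    (mapT g l).Within P (l.length * m) (l.length * r) (l.length * (b + 1)) := by
  induction l with
  | nil => exact Timed.Within.mono (within_ret _) (by simp) (by simp) (by simp)
  | cons a l ih =>
    refine Timed.Within.mono ((within_tick 1).bind ((h a (by simp)).bind
      ((ih fun x hx => h x (by simp [hx])).bind (within_ret _)))) ?_ ?_ ?_ <;>
    · simp only [List.length_cons]; ring_nf; exact le_rfl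

@[simp] theorem filterMapT_val (g : α → Timed (Option β)) (l : List α) :
    (filterMapT g l).val = l.filterMap fun a => (g a).val := by
  induction l with
  | nil => rfl
  | cons a l ih =>
    simp only [filterMapT, Timed.bind_val, ih, Timed.ret_val]
    cases h : (g a).val <;> simp [h]

theorem within_filterMapT {g : α → Timed (Option β)} {l : List α} {m r b : ℕ}
    (h : ∀ a ∈ l, (g a).Within P m r b) :
    (filterMapT g l).Within P (l.length * m) (l.length * r) (l.length * (b + 1)) := by
  induction l with
  | nil => exact Timed.Within.mono (within_ret _) (by simp) (by simp) (by simp)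
  | cons a l ih =>
    refine Timed.Within.mono ((within_tick 1).bind ((h a (by simp)).bind
      ((ih fun x hx => h x (by simp [hx])).bind (within_ret _)))) ?_ ?_ ?_ <;>
    · simp only [List.length_cons]; ring_nf; exact le_rfl

@[simp] theorem lengthT_val (l : List α) : (lengthT l).val = l.length := by
  induction l with
  | nil => rfl
  | cons a l ih => simp [lengthT, ih]

theorem within_lengthT {K W : ℕ} (l : List α) (h : l.length.size ≤ W) (hW : 1 ≤ W) :
    (lengthT l).Within P 0 0 (l.length * opCost K W) := by
  induction l with
  | nil => exact Timed.Within.monoBits (within_ret _) (by simp)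
  | cons a l ih =>
    have hl : l.length.size ≤ W := (Nat.size_le_size (by simp)).trans h
    refine Timed.Within.monoBits ((ih hl).bindBits (within_addN (K := K) (W := W) ?_ ?_)) ?_
    · simpa using hl
    · simpa using hW
    · simp only [List.length_cons]; ring_nf; exact le_rfl

@[simp] theorem appendT_val (l m : List α) : (appendT l m).val = l ++ m := rfl

theorem within_appendT (l m : List α) : (appendT l m).Within P 0 0 l.length :=
  (within_tick l.length).bindBits (f := fun _ => ret (l ++ m)) (within_ret _)

/-! ### Merge sort -/

theorem mergeT_perm (le : α → α → Timed Bool) (xs ys : List α) :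
    (mergeT le xs ys).val.Perm (xs ++ ys) := by
  induction xs, ys using mergeT.induct with
  | case1 ys => simp [mergeT]
  | case2 xs h => cases xs <;> simp [mergeT]
  | case3 x xs y ys ih1 ih2 =>
    rw [mergeT]
    simp only [Timed.bind_val]
    split_ifs with h
    · simpa using ih1
    · exact (ih2.cons y).trans (List.perm_middle (l₁ := x :: xs)).symm

/-- The order `r` is separate from the Boolean test: a positive answer has to imply `r x y`, a
negative one `r y x`. This covers both the comparison of keys, where ties occur, and the
lexicographic order. -/
theorem mergeT_pairwise {r : α → α → Prop} {le : α → α → Timed Bool}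
    (htrans : ∀ x y z, r x y → r y z → r x z)
    (htrue : ∀ x y, (le x y).val = true → r x y)
    (hfalse : ∀ x y, (le x y).val = false → r y x) (xs ys : List α)
    (hx : xs.Pairwise r) (hy : ys.Pairwise r) : (mergeT le xs ys).val.Pairwise r := by
  induction xs, ys using mergeT.induct with
  | case1 ys => simpa [mergeT] using hy
  | case2 xs h => cases xs <;> simp_all [mergeT]
  | case3 x xs y ys ih1 ih2 =>
    rw [mergeT]
    simp only [Timed.bind_val]
    rw [List.pairwise_cons] at hx hy
    split_ifs with h
    · refine List.pairwise_cons.2 ⟨fun z hz => ?_, ih1 hx.2 (List.pairwise_cons.2 hy)⟩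
      have hz := (mergeT_perm le _ _).mem_iff.1 hz
      have hxy := htrue _ _ h
      simp only [List.mem_append, List.mem_cons] at hz
      rcases hz with hz | rfl | hz
      · exact hx.1 z hz
      · exact hxy
      · exact htrans _ _ _ hxy (hy.1 z hz)
    · refine List.pairwise_cons.2 ⟨fun z hz => ?_, ih2 (List.pairwise_cons.2 hx) hy.2⟩
      have hz := (mergeT_perm le _ _).mem_iff.1 hz
      have hyx := hfalse _ _ (by simpa using h)
      simp only [List.mem_append, List.mem_cons] at hz
      rcases hz with (rfl | hz) | hz
      · exact hyx
      · exact htrans _ _ _ hyx (hx.1 z hz)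
      · exact hy.1 z hz

theorem within_mergeT {le : α → α → Timed Bool} {b : ℕ} (xs ys : List α)
    (h : ∀ x ∈ xs, ∀ y ∈ ys, (le x y).Within P 0 0 b) :
    (mergeT le xs ys).Within P 0 0 ((xs.length + ys.length) * (b + 1)) := by
  induction xs, ys using mergeT.induct with
  | case1 ys => rw [mergeT]; exact Timed.Within.monoBits (within_ret _) (by simp)
  | case2 xs hx => cases xs <;> (rw [mergeT]; exact Timed.Within.monoBits (within_ret _) (by simp); try simp)
  | case3 x xs y ys ih1 ih2 =>
    rw [mergeT]
    by_cases hb : (le x y).val = true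
    · have := ih1 fun a ha c hc => h a (by simp [ha]) c hc
      refine Timed.Within.monoBits ((within_tick 1).bindBits ((h x (by simp) y (by simp)).bindBits
        (b' := (xs.length + (y :: ys).length) * (b + 1)) ?_)) ?_
      · rw [if_pos hb]; exact this.bindRet
      · simp only [List.length_cons]; ring_nf; exact le_rfl
    · have := ih2 fun a ha c hc => h a ha c (by simp [hc])
      refine Timed.Within.monoBits ((within_tick 1).bindBits ((h x (by simp) y (by simp)).bindBits
        (b' := ((x :: xs).length + ys.length) * (b + 1)) ?_)) ?_
      · rw [if_neg hb]; exact this.bindRet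
      · simp only [List.length_cons]; ring_nf; exact le_rfl

theorem sortT_perm (le : α → α → Timed Bool) (l : List α) : (sortT le l).val.Perm l := by
  induction l using sortT.induct with
  | case1 => simp [sortT]
  | case2 a => simp [sortT]
  | case3 a b l ih1 ih2 =>
    rw [sortT]
    simp only [Timed.bind_val]
    refine (mergeT_perm le _ _).trans ((ih1.append ih2).trans ?_)
    rw [List.take_append_drop]

theorem sortT_pairwise {r : α → α → Prop} {le : α → α → Timed Bool}
    (htrans : ∀ x y z, r x y → r y z → r x z)
    (htrue : ∀ x y, (le x y).val = true → r x y)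
    (hfalse : ∀ x y, (le x y).val = false → r y x) (l : List α) :
    (sortT le l).val.Pairwise r := by
  induction l using sortT.induct with
  | case1 => simp [sortT]
  | case2 a => simp [sortT]
  | case3 a b l ih1 ih2 =>
    rw [sortT]
    exact mergeT_pairwise htrans htrue hfalse _ _ ih1 ih2

/-- Both halves have at most `⌈L / 2⌉` elements, so the recursion has depth `clog 2 L`. On each
level every element is charged 2 for splitting and `b + 1` for merging. -/
theorem within_sortT_clog {le : α → α → Timed Bool} {b : ℕ} (l : List α)
    (h : ∀ x ∈ l, ∀ y ∈ l, (le x y).Within P 0 0 b) :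
    (sortT le l).Within P 0 0 (l.length * Nat.clog 2 l.length * (b + 3)) := by
  induction l using sortT.induct with
  | case1 => rw [sortT]; exact Timed.Within.monoBits (within_ret _) (by simp)
  | case2 a => rw [sortT]; exact Timed.Within.monoBits (within_ret _) (by simp)
  | case3 x y l ih1 ih2 =>
    rw [sortT]
    set L := x :: y :: l with hL
    set k := (l.length + 2) / 2 with hk
    have hlen : L.length = l.length + 2 := by simp [hL]
    have hc : Nat.clog 2 L.length = Nat.clog 2 ((L.length + 1) / 2) + 1 := by
      rw [Nat.clog_of_two_le one_lt_two (by omega)]; rfl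
    have h1 := ih1 fun a ha c hc => h a (List.mem_of_mem_take ha) c (List.mem_of_mem_take hc)
    have h2 := ih2 fun a ha c hc => h a (List.mem_of_mem_drop ha) c (List.mem_of_mem_drop hc)
    have h3 := within_mergeT (P := P) (le := le) (b := b) (sortT le (L.take k)).val
      (sortT le (L.drop k)).val fun a ha c hc =>
        h a (List.mem_of_mem_take ((sortT_perm le _).mem_iff.1 ha)) c
          (List.mem_of_mem_drop ((sortT_perm le _).mem_iff.1 hc))
    rw [(sortT_perm le _).length_eq, (sortT_perm le _).length_eq] at h3
    have hadd : (L.take k).length + (L.drop k).length = L.length := by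
      rw [← List.length_append, List.take_append_drop]
    rw [hadd] at h3
    have c1 : Nat.clog 2 (L.take k).length ≤ Nat.clog 2 ((L.length + 1) / 2) :=
      Nat.clog_mono_right _ (by rw [List.length_take]; omega)
    have c2 : Nat.clog 2 (L.drop k).length ≤ Nat.clog 2 ((L.length + 1) / 2) :=
      Nat.clog_mono_right _ (by rw [List.length_drop]; omega)
    refine Timed.Within.monoBits ((within_tick _).bindBits (h1.bindBits (h2.bindBits h3))) ?_
    rw [hc]
    have e1 := Nat.mul_le_mul_right (b + 3) (Nat.mul_le_mul_left (L.take k).length c1)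
    have e2 := Nat.mul_le_mul_right (b + 3) (Nat.mul_le_mul_left (L.drop k).length c2)
    refine (Nat.add_le_add_left (Nat.add_le_add e1 (Nat.add_le_add_right e2 _)) _).trans ?_
    rw [← hlen, ← hadd]
    ring_nf
    exact le_rfl

theorem within_sortT {le : α → α → Timed Bool} {b K : ℕ} (l : List α)
    (h : ∀ x ∈ l, ∀ y ∈ l, (le x y).Within P 0 0 b) (hK : l.length.size ≤ K) :
    (sortT le l).Within P 0 0 (l.length * K * (b + 3)) := by
  refine Timed.Within.monoBits (within_sortT_clog l h) ?_
  gcongr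
  exact Nat.clog_le_of_le_pow ((Nat.size_le.1 hK).le)

theorem sortT_keyLe_pairwise (l : List (ℕ × α)) :
    (sortT keyLe l).val.Pairwise fun x y => x.1 ≤ y.1 :=
  sortT_pairwise (fun _ _ _ h h' => h.trans h') (fun x y h => by simpa [keyLe] using h)
    (fun x y h => by simp [keyLe] at h; exact h.le) l

theorem within_sortT_keyLe {K W : ℕ} (l : List (ℕ × α)) (h : ∀ x ∈ l, x.1.size ≤ W)
    (hK : l.length.size ≤ K) :
    (sortT keyLe l).Within P 0 0 (2 * l.length * K * opCost K W) := by
  refine Timed.Within.monoBits (within_sortT (b := opCost K W) l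
    (fun x hx y hy => within_leN (h x hx) (h y hy)) hK) ?_
  have := four_le_opCost K W
  calc l.length * K * (opCost K W + 3) ≤ l.length * K * (2 * opCost K W) := by gcongr; omega
    _ = _ := by ring

/-! ### Removal of repetitions -/

theorem lexLe_val (x y : List ℕ) : (lexLe x y).val = decide (x ≤ y) := by
  induction x, y using lexLe.induct with
  | case1 y => simp [lexLe, ← not_lt]
  | case2 x xs => simp [lexLe, ← not_lt]
  | case3 x xs y ys ih =>
    rw [lexLe]
    simp only [Timed.bind_val, eqN_val, decide_eq_true_eq]
    split_ifs with h
    · simp [ih, h, ← not_lt]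
    · simp only [leN_val, ← not_lt, List.cons_lt_cons_iff, decide_eq_decide]
      omega

theorem within_lexLe {K W : ℕ} (x y : List ℕ) (hx : ∀ a ∈ x, a.size ≤ W)
    (hy : ∀ a ∈ y, a.size ≤ W) :
    (lexLe x y).Within P 0 0 ((x.length + 1) * opCost K W) := by
  have h4 := four_le_opCost K W
  induction x, y using lexLe.induct with
  | case1 y =>
    exact Timed.Within.monoBits ((within_tick 1).bindBits (within_ret _)) (by simpa using by omega)
  | case2 x xs =>
    exact Timed.Within.monoBits ((within_tick 1).bindBits (within_ret _)) (by simp; nlinarith)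
  | case3 x xs y ys ih =>
    rw [lexLe]
    have ih := ih (fun a ha => hx a (by simp [ha])) (fun a ha => hy a (by simp [ha]))
    refine Timed.Within.monoBits ((within_eqN (K := K) (hx x (by simp)) (hy y (by simp))).bindBits
      (b' := (xs.length + 1) * opCost K W) ?_) ?_
    · split_ifs
      · exact ih
      · exact Timed.Within.monoBits (within_leN (K := K) (hx x (by simp)) (hy y (by simp))) (by nlinarith)
    · simp only [List.length_cons]; ring_nf; exact le_rfl

theorem dedupSortedT_sublist (le : α → α → Timed Bool) (l : List α) :
    (dedupSortedT le l).val.Sublist l := by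
  induction l using dedupSortedT.induct with
  | case1 => simp [dedupSortedT]
  | case2 a => simp [dedupSortedT]
  | case3 a b l ih =>
    simp only [dedupSortedT, Timed.bind_val, Timed.ret_val]
    split_ifs
    · exact ih.cons a
    · exact ih.cons_cons a

/-- By the hypothesis, an element that is not strictly below its successor is equal to it, so that
dropping it loses nothing. -/
theorem mem_dedupSortedT {le : α → α → Timed Bool} {l : List α}
    (h : l.Pairwise fun x y => (le y x).val = true → x = y) {x : α} (hx : x ∈ l) :
    x ∈ (dedupSortedT le l).val := by
  induction l using dedupSortedT.induct with
  | case1 => simp at hx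
  | case2 a => simpa [dedupSortedT] using hx
  | case3 a b l ih =>
    rw [List.pairwise_cons] at h
    have ih := ih h.2
    simp only [dedupSortedT, Timed.bind_val, Timed.ret_val]
    rcases List.mem_cons.1 hx with rfl | hx
    · split_ifs with hc
      · exact ih (by simp [h.1 b (by simp) hc])
      · simp
    · split_ifs
      · exact ih hx
      · exact List.mem_cons_of_mem _ (ih hx)

theorem within_dedupSortedT {le : α → α → Timed Bool} {b : ℕ} (l : List α)
    (h : ∀ x ∈ l, ∀ y ∈ l, (le x y).Within P 0 0 b) :
    (dedupSortedT le l).Within P 0 0 (l.length * (b + 1)) := by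
  induction l using dedupSortedT.induct with
  | case1 => exact Timed.Within.monoBits (within_ret _) (by simp)
  | case2 a => exact Timed.Within.monoBits (within_ret _) (by simp)
  | case3 a c l ih =>
    refine Timed.Within.monoBits ((within_tick 1).bindBits ((h c (by simp) a (by simp)).bindBits
      ((ih fun x hx y hy => h x (List.mem_cons_of_mem _ hx) y
        (List.mem_cons_of_mem _ hy)).bindBits (within_ret _)))) ?_
    simp only [List.length_cons]; ring_nf; exact le_rfl

theorem dedupT_subset (subs : List (ℕ × List ℕ)) {x : ℕ × List ℕ} (hx : x ∈ (dedupT subs).val) :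
    x ∈ subs :=
  (sortT_perm _ _).mem_iff.1 ((dedupSortedT_sublist _ _).subset hx)

theorem length_dedupT_le (subs : List (ℕ × List ℕ)) :
    (dedupT subs).val.length ≤ subs.length :=
  (dedupSortedT_sublist _ _).length_le.trans (sortT_perm _ _).length_eq.le

/-- The set of pairs is unchanged by the deletion of repetitions. Hence the probability can be
analysed for the independent pairs that were originally drawn. -/
theorem mem_dedupT {subs : List (ℕ × List ℕ)} {x : ℕ × List ℕ} (hx : x ∈ subs) :
    x ∈ (dedupT subs).val := by
  refine mem_dedupSortedT ?_ ((sortT_perm _ _).mem_iff.2 hx)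
  refine (sortT_pairwise (r := fun x y : ℕ × List ℕ => x.1 :: x.2 ≤ y.1 :: y.2)
    (fun _ _ _ h h' => le_trans h h') (fun x y h => by simpa [lexLe_val] using h)
    (fun x y h => ?_) subs).imp ?_
  · simp only [lexLe_val, decide_eq_false_iff_not, not_le] at h
    exact h.le
  · intro x y h h'
    simp only [lexLe_val, decide_eq_true_eq] at h'
    have := le_antisymm h h'
    simp only [List.cons.injEq] at this
    exact Prod.ext this.1 this.2

theorem within_dedupT {K W n : ℕ} (subs : List (ℕ × List ℕ)) (hK : subs.length.size ≤ K)
    (hK1 : 1 ≤ K) (h : ∀ x ∈ subs, x.1.size ≤ W ∧ x.2.length = n ∧ ∀ a ∈ x.2, a.size ≤ W) :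
    (dedupT subs).Within P 0 0 (4 * subs.length * K * ((n + 2) * opCost K W)) := by
  have h4 := four_le_opCost K W
  have hle : ∀ x ∈ subs, ∀ y ∈ subs, (lexLe (x.1 :: x.2) (y.1 :: y.2)).Within P 0 0
      ((n + 2) * opCost K W) := by
    intro x hx y hy
    refine Timed.Within.monoBits (within_lexLe (K := K) (W := W) _ _ ?_ ?_) ?_
    · rintro a (_ | ⟨_, ha⟩)
      exacts [(h x hx).1, (h x hx).2.2 a ha]
    · rintro a (_ | ⟨_, ha⟩)
      exacts [(h y hy).1, (h y hy).2.2 a ha]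
    · simp [(h x hx).2.1]
  have hp := sortT_perm (fun x y : ℕ × List ℕ => lexLe (x.1 :: x.2) (y.1 :: y.2)) subs
  refine Timed.Within.monoBits ((within_sortT subs hle hK).bindBits (within_dedupSortedT _ fun x hx y hy =>
    hle x (hp.mem_iff.1 hx) y (hp.mem_iff.1 hy))) ?_
  rw [hp.length_eq]
  have h1 : 4 ≤ (n + 2) * opCost K W := by nlinarith
  generalize (n + 2) * opCost K W = Z at *
  calc _ ≤ subs.length * K * (2 * Z) + subs.length * K * (2 * Z) := by
        refine Nat.add_le_add (Nat.mul_le_mul le_rfl (by omega)) ?_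
        refine Nat.mul_le_mul ?_ (by omega)
        nlinarith
    _ = _ := by ring

/-! ### Sums and maxima -/

/-- `∑ e_k s_k`. -/
def dotN (es ss : List ℕ) : ℕ := (List.zipWith (· * ·) es ss).sum

@[simp] theorem dotT_val (acc : ℕ) (es ss : List ℕ) :
    (dotT acc es ss).val = acc + dotN es ss := by
  induction es generalizing acc ss with
  | nil => simp [dotT, dotN]
  | cons e es ih =>
    cases ss with
    | nil => simp [dotT, dotN]
    | cons s ss => simp [dotT, ih]; simp [dotN, add_assoc]

/-- All partial sums and all products are at most the final value, so that its size is the only one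
that needs a hypothesis. -/
theorem within_dotT {K W : ℕ} (acc : ℕ) (es ss : List ℕ)
    (h : (acc + dotN es ss).size ≤ W) (he : ∀ e ∈ es, e.size ≤ W) (hs : ∀ s ∈ ss, s.size ≤ K) :
    (dotT acc es ss).Within P 0 0 (2 * es.length * opCost K W) := by
  induction es generalizing acc ss with
  | nil => exact Timed.Within.monoBits (within_ret _) (by simp)
  | cons e es ih =>
    cases ss with
    | nil => exact Timed.Within.monoBits (within_ret _) (by simp)
    | cons s ss =>
      rw [dotT]
      have hd : acc + dotN (e :: es) (s :: ss) = acc + e * s + dotN es ss := by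
        simp [dotN, add_assoc]
      rw [hd] at h
      refine Timed.Within.monoBits ((within_mulN_right (he e (by simp)) (hs s (by simp))).bindBits
        ((within_addN (K := K) (W := W) ?_ ?_).bindBits (ih _ ss h (fun a ha => he a (by simp [ha]))
          fun a ha => hs a (by simp [ha])))) ?_
      · exact (Nat.size_le_size (by omega)).trans h
      · exact (Nat.size_le_size (by simp only [mulN_val]; omega)).trans h
      · simp only [List.length_cons]; ring_nf; exact le_rfl

@[simp] theorem sumT_val (acc : ℕ) (es : List ℕ) : (sumT acc es).val = acc + es.sum := by
  induction es generalizing acc with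
  | nil => simp [sumT]
  | cons e es ih => simp [sumT, ih, add_assoc]

theorem within_sumT {K W : ℕ} (acc : ℕ) (es : List ℕ) (h : (acc + es.sum).size ≤ W) :
    (sumT acc es).Within P 0 0 (es.length * opCost K W) := by
  induction es generalizing acc with
  | nil => exact Timed.Within.monoBits (within_ret _) (by simp)
  | cons e es ih =>
    rw [List.sum_cons, ← add_assoc] at h
    refine Timed.Within.monoBits ((within_addN (K := K) (W := W) ?_ ?_).bindBits (ih _ h)) ?_
    · exact (Nat.size_le_size (by omega)).trans h
    · exact (Nat.size_le_size (by omega)).trans h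
    · simp only [List.length_cons]; ring_nf; exact le_rfl

theorem le_maxT (acc : ℕ) (l : List ℕ) :
    acc ≤ (maxT acc l).val ∧ ∀ a ∈ l, a ≤ (maxT acc l).val := by
  induction l generalizing acc with
  | nil => simp [maxT]
  | cons a l ih =>
    have := ih (max acc a)
    simp only [maxT, Timed.bind_val, maxN_val, List.mem_cons, forall_eq_or_imp]
    exact ⟨(le_max_left _ _).trans this.1, (le_max_right _ _).trans this.1, this.2⟩

theorem maxT_le {acc b : ℕ} {l : List ℕ} (hacc : acc ≤ b) (h : ∀ a ∈ l, a ≤ b) :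
    (maxT acc l).val ≤ b := by
  induction l generalizing acc with
  | nil => simpa [maxT] using hacc
  | cons a l ih =>
    exact ih (max_le hacc (h a (by simp))) fun x hx => h x (by simp [hx])

theorem within_maxT {K W : ℕ} {b : ℕ} (acc : ℕ) (l : List ℕ) (hb : b.size ≤ W)
    (hacc : acc ≤ b) (h : ∀ a ∈ l, a ≤ b) :
    (maxT acc l).Within P 0 0 (l.length * opCost K W) := by
  induction l generalizing acc with
  | nil => exact Timed.Within.monoBits (within_ret _) (by simp)
  | cons a l ih =>
    have ha := h a (by simp)
    refine Timed.Within.monoBits ((within_maxN (K := K) (W := W) ((Nat.size_le_size hacc).trans hb)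
      ((Nat.size_le_size ha).trans hb)).bindBits
      (ih _ (max_le hacc ha) fun x hx => h x (by simp [hx]))) ?_
    simp only [List.length_cons]; ring_nf; exact le_rfl

end Lists

end SparseInterp

namespace SparseInterp

open Timed

/-! ### Sparse representations of univariate polynomials -/

section Univariate

variable {R : Type*} [CommRing R]

@[simp] theorem toPoly_nil : toPoly ([] : List (ℕ × R)) = 0 := rfl

@[simp] theorem toPoly_cons (t : ℕ × R) (L : List (ℕ × R)) :
    toPoly (t :: L) = Polynomial.monomial t.1 t.2 + toPoly L := by
  simp [toPoly]

@[simp] theorem toPoly_append (L M : List (ℕ × R)) : toPoly (L ++ M) = toPoly L + toPoly M := by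
  simp [toPoly]

theorem toPoly_perm {L M : List (ℕ × R)} (h : L.Perm M) : toPoly L = toPoly M :=
  (h.map _).sum_eq

theorem toPoly_map_neg (L : List (ℕ × R)) :
    toPoly (L.map fun t => (t.1, -t.2)) = -toPoly L := by
  induction L with
  | nil => simp
  | cons t L ih => simp [ih]; ring

theorem coeff_toPoly_of_notMem {L : List (ℕ × R)} {d : ℕ} (h : d ∉ L.map Prod.fst) :
    (toPoly L).coeff d = 0 := by
  induction L with
  | nil => simp
  | cons t L ih =>
    simp only [List.map_cons, List.mem_cons, not_or] at h
    simp [Polynomial.coeff_monomial, ih h.2, Ne.symm h.1]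

theorem coeff_toPoly_of_mem {L : List (ℕ × R)} (hL : (L.map Prod.fst).Nodup) {t : ℕ × R}
    (h : t ∈ L) : (toPoly L).coeff t.1 = t.2 := by
  induction L with
  | nil => simp at h
  | cons u L ih =>
    rw [List.map_cons, List.nodup_cons] at hL
    rcases List.mem_cons.1 h with rfl | h
    · simp [coeff_toPoly_of_notMem hL.1]
    · have : u.1 ≠ t.1 := fun e => hL.1 (e ▸ List.mem_map_of_mem h)
      simp [Polynomial.coeff_monomial, this, ih hL.2 h]

theorem IsSparseRep.mem_iff {L : List (ℕ × R)} {g : Polynomial R} (h : IsSparseRep L g) {d : ℕ}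
    {c : R} : (d, c) ∈ L ↔ c ≠ 0 ∧ g.coeff d = c := by
  obtain ⟨h1, h2, rfl⟩ := h
  refine ⟨fun hm => ⟨h2 _ hm, coeff_toPoly_of_mem h1 hm⟩, ?_⟩
  rintro ⟨hc, rfl⟩
  by_cases hd : d ∈ L.map Prod.fst
  · obtain ⟨t, ht, rfl⟩ := List.mem_map.1 hd
    rwa [coeff_toPoly_of_mem h1 ht]
  · exact absurd (coeff_toPoly_of_notMem hd) hc

theorem IsSparseRep.toFinset_eq {L : List (ℕ × R)} {g : Polynomial R} (h : IsSparseRep L g) :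
    (L.map Prod.fst).toFinset = g.support := by
  ext d
  simp only [List.mem_toFinset, List.mem_map, Polynomial.mem_support_iff, Prod.exists,
    exists_and_right, exists_eq_right, h.mem_iff]
  exact ⟨fun ⟨c, hc, hd⟩ => hd ▸ hc, fun hd => ⟨_, hd, rfl⟩⟩

theorem IsSparseRep.length_eq {L : List (ℕ × R)} {g : Polynomial R} (h : IsSparseRep L g) :
    L.length = g.support.card := by
  rw [← h.toFinset_eq, List.toFinset_card_of_nodup h.1, List.length_map]

/-- `L` lists the terms of `g` by increasing exponents. -/
structure IsSortedRep (L : List (ℕ × R)) (g : Polynomial R) : Prop where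
  pairwise : L.Pairwise fun x y => x.1 < y.1
  ne_zero : ∀ t ∈ L, t.2 ≠ 0
  toPoly_eq : toPoly L = g

theorem IsSortedRep.isSparseRep {L : List (ℕ × R)} {g : Polynomial R} (h : IsSortedRep L g) :
    IsSparseRep L g :=
  ⟨List.pairwise_map.2 (h.1.imp fun h => h.ne), h.2, h.3⟩

/-- Reduction modulo `x^p - 1`. -/
noncomputable def reduceExp (p : ℕ) : Polynomial R →ₗ[R] Polynomial R :=
  Polynomial.lsum fun e => Polynomial.monomial (e % p)

theorem reduceExp_monomial (p e : ℕ) (c : R) :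
    reduceExp p (Polynomial.monomial e c) = Polynomial.monomial (e % p) c := by
  simp [reduceExp, Polynomial.lsum_apply, Polynomial.sum_monomial_index]

theorem toPoly_map_mod (p : ℕ) (L : List (ℕ × R)) :
    toPoly (L.map fun t => (t.1 % p, t.2)) = reduceExp p (toPoly L) := by
  induction L with
  | nil => simp
  | cons t L ih => simp [ih, reduceExp_monomial]

variable [DecidableEq R]

/-- The second claim, that no new exponents appear, is needed in the induction: it shows that the
head has a strictly smaller exponent than the rest of the output. -/
theorem collectT_spec (e : ℕ) (c : R) (l : List (ℕ × R)) (hl : l.Pairwise fun x y => x.1 ≤ y.1)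
    (he : ∀ t ∈ l, e ≤ t.1) :
    IsSortedRep (collectT e c l).val (Polynomial.monomial e c + toPoly l) ∧
      ∀ t ∈ (collectT e c l).val, t.1 ∈ e :: l.map Prod.fst := by
  induction l generalizing e c with
  | nil =>
    simp only [collectT, Timed.bind_val, isZeroR_val, Timed.ret_val, decide_eq_true_eq]
    split_ifs with h
    · exact ⟨⟨by simp, by simp, by simp [h]⟩, by simp⟩
    · exact ⟨⟨by simp, by simpa using h, by simp⟩, by simp⟩
  | cons t l ih =>
    rw [List.pairwise_cons] at hl
    simp only [collectT, Timed.bind_val, eqN_val, decide_eq_true_eq]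
    split_ifs with h
    · subst h
      obtain ⟨h1, h2⟩ := ih t.1 (c + t.2) hl.2 hl.1
      refine ⟨⟨h1.1, h1.2, h1.3.trans ?_⟩,
        fun u hu => List.mem_cons_of_mem _ (by simpa using h2 u hu)⟩
      rw [toPoly_cons, map_add, add_assoc]
    · obtain ⟨h1, h2⟩ := ih t.1 t.2 hl.2 hl.1
      have hlt : e < t.1 := lt_of_le_of_ne (he t (by simp)) h
      have h3 : ∀ u ∈ (collectT t.1 t.2 l).val, e < u.1 := by
        intro u hu
        rcases List.mem_cons.1 (h2 u hu) with hu | hu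
        · rw [hu]; exact hlt
        · obtain ⟨v, hv, hvu⟩ := List.mem_map.1 hu
          rw [← hvu]; exact hlt.trans_le (hl.1 v hv)
      simp only [Timed.bind_val, Timed.ret_val]
      split_ifs with hc <;> simp only [isZeroR_val, decide_eq_true_eq] at hc
      · refine ⟨⟨h1.1, h1.2, ?_⟩, fun u hu => List.mem_cons_of_mem _ (by simpa using h2 u hu)⟩
        rw [h1.3, toPoly_cons, hc]; simp
      · refine ⟨⟨List.pairwise_cons.2 ⟨h3, h1.1⟩, ?_, ?_⟩, ?_⟩
        · rintro u (_ | ⟨_, hu⟩)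
          exacts [hc, h1.2 u hu]
        · rw [toPoly_cons, h1.3, toPoly_cons]
        · rintro u (_ | ⟨_, hu⟩)
          exacts [by simp, List.mem_cons_of_mem _ (by simpa using h2 u hu)]

theorem length_collectT_le (e : ℕ) (c : R) (l : List (ℕ × R)) :
    (collectT e c l).val.length ≤ l.length + 1 := by
  induction l generalizing e c with
  | nil =>
    simp only [collectT, Timed.bind_val, Timed.ret_val]
    split_ifs <;> simp
  | cons t l ih =>
    simp only [collectT, Timed.bind_val]
    split_ifs
    · exact (ih _ _).trans (by simp)
    · have := ih t.1 t.2
      simp only [Timed.bind_val, Timed.ret_val]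
      split_ifs <;> simp only [List.length_cons] <;> omega

/-- Each term of `l` causes either one addition or one test for zero, and there is one last test at
the end of the list. -/
theorem within_collectT {P : Query → Prop} {K W : ℕ} (e : ℕ) (c : R) (l : List (ℕ × R))
    (he : e.size ≤ W) (h : ∀ t ∈ l, t.1.size ≤ W) :
    (collectT e c l).Within P 0 (l.length + 1) (l.length * opCost K W) := by
  induction l generalizing e c with
  | nil => exact Timed.Within.mono (within_isZeroR c).bindRet le_rfl le_rfl (by simp)
  | cons t l ih =>
    rw [collectT]
    have ih' := fun c => ih t.1 c (h t (by simp)) fun u hu => h u (by simp [hu])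
    refine Timed.Within.mono (Timed.Within.bind (within_eqN (K := K) he (h t (by simp)))
      (m' := 0) (r' := l.length + 2) (b' := l.length * opCost K W) ?_) le_rfl (by simp) ?_
    · split_ifs with hb
      · simp only [eqN_val, decide_eq_true_eq] at hb
        subst hb
        exact Timed.Within.mono (Timed.Within.bind (within_addR _ _) (ih' _)) le_rfl (by omega)
          (by omega)
      · exact Timed.Within.mono (Timed.Within.bind (within_isZeroR _) (ih' _).bindRet) le_rfl
          (by omega) (by omega)
    · simp only [List.length_cons]; ring_nf; exact le_rfl

theorem normalizeT_spec (L : List (ℕ × R)) :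
    IsSortedRep (normalizeT L).val (toPoly L) ∧
      (∀ t ∈ (normalizeT L).val, t.1 ∈ L.map Prod.fst) ∧
      (normalizeT L).val.length ≤ L.length := by
  have hp := sortT_perm keyLe L
  have hs := sortT_keyLe_pairwise L
  rw [normalizeT]
  simp only [Timed.bind_val]
  revert hp hs
  generalize (sortT keyLe L).val = M
  intro hp hs
  rw [← toPoly_perm hp, ← hp.length_eq]
  cases M with
  | nil => exact ⟨⟨by simp, by simp, by simp⟩, by simp, by simp⟩
  | cons t l =>
    rw [List.pairwise_cons] at hs
    obtain ⟨h1, h2⟩ := collectT_spec t.1 t.2 l hs.2 hs.1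
    exact ⟨by simpa using h1, fun u hu => (hp.map Prod.fst).mem_iff.1 (by simpa using h2 u hu),
      length_collectT_le _ _ _⟩

theorem within_normalizeT {P : Query → Prop} {K W : ℕ} (L : List (ℕ × R))
    (h : ∀ t ∈ L, t.1.size ≤ W) (hK : L.length.size ≤ K) (hK1 : 1 ≤ K) :
    (normalizeT L).Within P 0 L.length (3 * L.length * K * opCost K W) := by
  have hp := sortT_perm keyLe L
  rw [normalizeT]
  refine Timed.Within.mono (Timed.Within.bind (within_sortT_keyLe L h hK)
    (m' := 0) (r' := L.length) (b' := L.length * opCost K W) ?_) le_rfl (by simp) ?_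
  · rw [← hp.length_eq]
    have h' : ∀ t ∈ (sortT keyLe L).val, t.1.size ≤ W := fun t ht => h t (hp.mem_iff.1 ht)
    revert h'
    generalize (sortT keyLe L).val = M
    intro h'
    cases M with
    | nil => exact Timed.Within.mono (within_ret _) le_rfl (by simp) (by simp)
    | cons t l =>
      refine Timed.Within.mono (within_collectT (K := K) t.1 t.2 l (h' t (by simp))
        fun u hu => h' u (by simp [hu])) le_rfl (by simp) ?_
      exact Nat.mul_le_mul_right _ (by simp)
  · have : L.length * opCost K W ≤ L.length * opCost K W * K := Nat.le_mul_of_pos_right _ hK1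
    nlinarith

theorem subPolyT_spec (P Q : List (ℕ × R)) :
    IsSortedRep (subPolyT P Q).val (toPoly P - toPoly Q) ∧
      (∀ t ∈ (subPolyT P Q).val, t.1 ∈ P.map Prod.fst ∨ t.1 ∈ Q.map Prod.fst) ∧
      (subPolyT P Q).val.length ≤ P.length + Q.length := by
  have h := normalizeT_spec (P ++ Q.map fun t => (t.1, -t.2))
  rw [toPoly_append, toPoly_map_neg, ← sub_eq_add_neg] at h
  simp only [subPolyT, Timed.bind_val, appendT_val, mapT_val, negR_val, Timed.ret_val]
  refine ⟨h.1, fun t ht => ?_, ?_⟩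
  · have := h.2.1 t ht
    simpa using this
  · simpa using h.2.2

theorem within_subPolyT {X : Query → Prop} {K W : ℕ} (P Q : List (ℕ × R))
    (hP : ∀ t ∈ P, t.1.size ≤ W) (hQ : ∀ t ∈ Q, t.1.size ≤ W)
    (hK : (P.length + Q.length).size ≤ K) (hK1 : 1 ≤ K) :
    (subPolyT P Q).Within X 0 (2 * (P.length + Q.length))
      (4 * (P.length + Q.length) * K * opCost K W) := by
  have h4 := four_le_opCost K W
  have hQ' : (mapT (fun t : ℕ × R => (negR t.2).bind fun c => ret (t.1, c)) Q).val =
    Q.map fun t => (t.1, -t.2) := by simp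
  rw [subPolyT]
  refine Timed.Within.mono (Timed.Within.bind (within_mapT (m := 0) (r := 1) (b := 0)
    fun t _ => Timed.Within.bindRet (within_negR _)) (Timed.Within.bind (within_appendT _ _)
      (within_normalizeT (K := K) (W := W) _ ?_ ?_ hK1))) (by simp) ?_ ?_
  · rw [hQ']
    intro t ht
    simp only [appendT_val, List.mem_append, List.mem_map] at ht
    rcases ht with ht | ⟨u, hu, rfl⟩
    exacts [hP t ht, hQ u hu]
  · rw [hQ']; simpa using hK
  · rw [hQ']; simp; omega
  · rw [hQ']
    simp only [appendT_val, List.length_append, List.length_map]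
    have : (P.length + Q.length) * 1 ≤ (P.length + Q.length) * (K * opCost K W) :=
      Nat.mul_le_mul_left _ (Nat.mul_pos hK1 (by omega))
    nlinarith

theorem modPolyT_spec (p : ℕ) (P : List (ℕ × R)) :
    IsSortedRep (modPolyT p P).val (reduceExp p (toPoly P)) ∧
      (∀ t ∈ (modPolyT p P).val, ∃ u ∈ P, t.1 = u.1 % p) ∧
      (modPolyT p P).val.length ≤ P.length := by
  have h := normalizeT_spec (P.map fun t => (t.1 % p, t.2))
  rw [toPoly_map_mod] at h
  simp only [modPolyT, Timed.bind_val, mapT_val, divModN_val, Timed.ret_val]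
  refine ⟨h.1, fun t ht => ?_, by simpa using h.2.2⟩
  obtain ⟨u, hu, hut⟩ := List.mem_map.1 (h.2.1 t ht)
  obtain ⟨v, hv, rfl⟩ := List.mem_map.1 hu
  exact ⟨v, hv, hut.symm⟩

theorem within_modPolyT {X : Query → Prop} {K W : ℕ} (p : ℕ) (P : List (ℕ × R))
    (hP : ∀ t ∈ P, t.1.size ≤ W) (hp : p.size ≤ K) (hK : P.length.size ≤ K) (hK1 : 1 ≤ K) :
    (modPolyT p P).Within X 0 P.length (5 * P.length * K * opCost K W) := by
  have h4 := four_le_opCost K W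
  have hP' : (mapT (fun t : ℕ × R => (divModN t.1 p).bind fun qr => ret (qr.2, t.2)) P).val =
    P.map fun t => (t.1 % p, t.2) := by simp
  rw [modPolyT]
  refine Timed.Within.mono (Timed.Within.bind (within_mapT (m := 0) (r := 0) (b := opCost K W)
    fun t ht => Timed.Within.bindRet (within_divModN (hP t ht) hp))
      (within_normalizeT (K := K) (W := W) _ ?_ ?_ hK1)) (by simp) ?_ ?_
  · rw [hP']
    intro t ht
    obtain ⟨u, hu, rfl⟩ := List.mem_map.1 ht
    exact (Nat.size_le_size (Nat.mod_le _ _)).trans (hP u hu)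
  · rw [hP']; simpa using hK
  · rw [hP']; simp
  · rw [hP']
    simp only [List.length_map]
    have : P.length * opCost K W ≤ P.length * opCost K W * K := Nat.le_mul_of_pos_right _ hK1
    nlinarith

end Univariate

/-! ### Substitution -/

section Substitution

variable {R : Type*} [CommRing R] {n : ℕ}

/-- The exponent of the image of `x^e` under `x_i ↦ x^{s_i}`. -/
def kronExp (s : List ℕ) (e : Fin n →₀ ℕ) : ℕ := ∑ i, e i * s.getD i 0

/-- The exponent vector with the given list of entries. -/
noncomputable def expVec (n : ℕ) (l : List ℕ) : Fin n →₀ ℕ :=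
  Finsupp.equivFunOnFinite.symm fun i : Fin n => l.getD i 0

@[simp] theorem expVec_apply (l : List ℕ) (i : Fin n) : expVec n l i = l.getD i 0 := rfl

/-- The equality of lengths is essential, because `getD` pads with zeros. -/
theorem expVec_injOn {l m : List ℕ} (hl : l.length = n) (hm : m.length = n)
    (h : expVec n l = expVec n m) : l = m := by
  refine List.ext_getElem (hl.trans hm.symm) fun i h1 h2 => ?_
  have := DFunLike.congr_fun h ⟨i, hl ▸ h1⟩
  rwa [expVec_apply, expVec_apply, List.getD_eq_getElem _ _ h1, List.getD_eq_getElem _ _ h2] at this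

theorem dotN_eq_sum (n : ℕ) (es ss : List ℕ) (he : es.length = n) (hs : ss.length = n) :
    dotN es ss = ∑ i : Fin n, es.getD i 0 * ss.getD i 0 := by
  induction n generalizing es ss with
  | zero => simp_all [dotN]
  | succ n ih =>
    cases es with
    | nil => simp at he
    | cons e es =>
      cases ss with
      | nil => simp at hs
      | cons s ss =>
        rw [Fin.sum_univ_succ]
        have := ih es ss (by simpa using he) (by simpa using hs)
        simp [dotN] at this ⊢
        exact this

theorem dotN_eq_kronExp {es ss : List ℕ} (he : es.length = n) (hs : ss.length = n) :
    dotN es ss = kronExp ss (expVec n es) := by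
  simp [kronExp, dotN_eq_sum n es ss he hs]

theorem kronExp_le {s : List ℕ} {b D : ℕ} (hs : ∀ i < n, s.getD i 0 ≤ b) {e : Fin n →₀ ℕ}
    (he : ∑ i, e i ≤ D) : kronExp s e ≤ b * D := by
  calc kronExp s e ≤ ∑ i, e i * b := Finset.sum_le_sum fun i _ =>
        Nat.mul_le_mul_left _ (hs i i.2)
    _ = b * ∑ i, e i := by rw [← Finset.sum_mul, mul_comm]
    _ ≤ b * D := Nat.mul_le_mul_left _ he

theorem kron_monomial (s : List ℕ) (e : Fin n →₀ ℕ) (a : R) :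
    kron (MvPolynomial.monomial e a) s = Polynomial.monomial (kronExp s e) a := by
  rw [kron, MvPolynomial.aeval_monomial, Finsupp.prod_fintype _ _ (by simp)]
  simp only [← pow_mul, Finset.prod_pow_eq_pow_sum, kronExp, mul_comm (s.getD _ 0)]
  rw [← Polynomial.C_eq_algebraMap, Polynomial.C_mul_X_pow_eq_monomial]

theorem kron_add (f g : MvPolynomial (Fin n) R) (s : List ℕ) :
    kron (f + g) s = kron f s + kron g s := map_add _ _ _

theorem kron_sub (f g : MvPolynomial (Fin n) R) (s : List ℕ) :
    kron (f - g) s = kron f s - kron g s := map_sub _ _ _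

theorem kron_eq_sum (f : MvPolynomial (Fin n) R) (s : List ℕ) :
    kron f s = ∑ e ∈ f.support, Polynomial.monomial (kronExp s e) (f.coeff e) := by
  conv_lhs => rw [f.as_sum, kron, map_sum]
  exact Finset.sum_congr rfl fun e _ => kron_monomial s e _

/-- Only an inclusion, since terms with equal images may cancel. -/
theorem support_kron_subset (f : MvPolynomial (Fin n) R) (s : List ℕ) :
    (kron f s).support ⊆ f.support.image (kronExp s) := by
  classical
  intro d hd
  rw [Polynomial.mem_support_iff, kron_eq_sum, Polynomial.finsetSum_coeff] at hd
  obtain ⟨e, he, h⟩ := Finset.exists_ne_zero_of_sum_ne_zero hd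
  rw [Polynomial.coeff_monomial] at h
  exact Finset.mem_image.2 ⟨e, he, by by_contra h'; exact h (if_neg h')⟩

theorem card_support_kron_le (f : MvPolynomial (Fin n) R) (s : List ℕ) :
    (kron f s).support.card ≤ f.support.card :=
  (Finset.card_le_card (support_kron_subset f s)).trans Finset.card_image_le

theorem sum_le_of_mem_support {f : MvPolynomial (Fin n) R} {D : ℕ} (hf : f.totalDegree ≤ D)
    {e : Fin n →₀ ℕ} (he : e ∈ f.support) : ∑ i, e i ≤ D := by
  have := (MvPolynomial.le_totalDegree he).trans hf
  rwa [Finsupp.sum_fintype _ _ (by simp)] at this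

theorem kronExp_le_of_mem_support {f : MvPolynomial (Fin n) R} {s : List ℕ} {b D : ℕ}
    (hs : ∀ i < n, s.getD i 0 ≤ b) (hf : f.totalDegree ≤ D) {d : ℕ}
    (hd : d ∈ (kron f s).support) : d ≤ b * D := by
  classical
  obtain ⟨e, he, rfl⟩ := Finset.mem_image.1 (support_kron_subset f s hd)
  exact kronExp_le hs (sum_le_of_mem_support hf he)

theorem natDegree_kron_le {f : MvPolynomial (Fin n) R} {s : List ℕ} {b D : ℕ}
    (hs : ∀ i < n, s.getD i 0 ≤ b) (hf : f.totalDegree ≤ D) : (kron f s).natDegree ≤ b * D :=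
  Polynomial.natDegree_le_iff_coeff_eq_zero.2 fun d hd => by
    by_contra h
    exact absurd (kronExp_le_of_mem_support hs hf (Polynomial.mem_support_iff.2 h)) (by omega)

/-- Evaluating the black box at the point `(a^(s_i))` amounts to evaluating `f(x^s)` at `a`. So a
black box for `f` provides one for each univariate image. -/
theorem aeval_kron {S : Type*} [CommRing S] [Algebra R S] (f : MvPolynomial (Fin n) R)
    (s : List ℕ) (a : S) :
    Polynomial.aeval a (kron f s) = MvPolynomial.aeval (fun i : Fin n => a ^ s.getD i 0) f := by
  rw [kron, ← AlgHom.comp_apply, MvPolynomial.comp_aeval]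
  simp

/-! ### Sparse representations of polynomials in several indeterminates -/

@[simp] theorem toMvPoly_nil : toMvPoly n ([] : List (List ℕ × R)) = 0 := rfl

@[simp] theorem toMvPoly_cons (t : List ℕ × R) (L : List (List ℕ × R)) :
    toMvPoly n (t :: L) = MvPolynomial.monomial (expVec n t.1) t.2 + toMvPoly n L := by
  simp [toMvPoly, expVec]

theorem kron_toMvPoly (L : List (List ℕ × R)) (s : List ℕ) :
    kron (toMvPoly n L) s = toPoly (L.map fun t => (kronExp s (expVec n t.1), t.2)) := by
  induction L with
  | nil => simp [kron]
  | cons t L ih => simp [kron_add, kron_monomial, ih]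

theorem coeff_toMvPoly_of_notMem {L : List (List ℕ × R)} {e : Fin n →₀ ℕ}
    (h : e ∉ L.map fun t => expVec n t.1) : (toMvPoly n L).coeff e = 0 := by
  classical
  induction L with
  | nil => simp
  | cons t L ih =>
    simp only [List.map_cons, List.mem_cons, not_or] at h
    simp [MvPolynomial.coeff_monomial, ih h.2, Ne.symm h.1]

theorem coeff_toMvPoly_of_mem {L : List (List ℕ × R)}
    (hL : (L.map fun t => expVec n t.1).Nodup) {t : List ℕ × R} (h : t ∈ L) :
    (toMvPoly n L).coeff (expVec n t.1) = t.2 := by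
  classical
  induction L with
  | nil => simp at h
  | cons u L ih =>
    rw [List.map_cons, List.nodup_cons] at hL
    rcases List.mem_cons.1 h with rfl | h
    · simp [coeff_toMvPoly_of_notMem hL.1]
    · have : expVec n u.1 ≠ expVec n t.1 := fun e =>
        hL.1 (e ▸ List.mem_map_of_mem (f := fun t => expVec n t.1) h)
      simp [MvPolynomial.coeff_monomial, this, ih hL.2 h]

theorem nodup_map_expVec {A : Type*} {L : List (List ℕ × A)} (hL : (L.map Prod.fst).Nodup)
    (hn : ∀ t ∈ L, t.1.length = n) : (L.map fun t => expVec n t.1).Nodup := by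
  have h := List.Nodup.map_on (f := expVec n) (fun x hx y hy hxy => ?_) hL
  · rwa [List.map_map] at h
  · obtain ⟨a, ha, rfl⟩ := List.mem_map.1 hx
    obtain ⟨b, hb, rfl⟩ := List.mem_map.1 hy
    exact expVec_injOn (hn a ha) (hn b hb) hxy

theorem IsMvSparseRep.mem_support {L : List (List ℕ × R)} {g : MvPolynomial (Fin n) R}
    (h : IsMvSparseRep n L g) {t : List ℕ × R} (ht : t ∈ L) : expVec n t.1 ∈ g.support := by
  obtain ⟨h1, h2, rfl⟩ := h
  rw [MvPolynomial.mem_support_iff,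
    coeff_toMvPoly_of_mem (nodup_map_expVec h1 fun t ht => (h2 t ht).1) ht]
  exact (h2 t ht).2

theorem IsMvSparseRep.length_le {L : List (List ℕ × R)} {g : MvPolynomial (Fin n) R}
    (h : IsMvSparseRep n L g) : L.length ≤ g.support.card := by
  classical
  have hnd := nodup_map_expVec h.1 fun t ht => (h.2.1 t ht).1
  rw [← List.length_map (fun t : List ℕ × R => expVec n t.1), ← List.toFinset_card_of_nodup hnd]
  refine Finset.card_le_card fun e he => ?_
  obtain ⟨t, ht, rfl⟩ := List.mem_map.1 (List.mem_toFinset.1 he)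
  exact h.mem_support ht

theorem substT_val {A : Type*} (G : List (List ℕ × A)) (s : List ℕ) :
    (substT G s).val = G.map fun t => (dotN t.1 s, t) := by
  simp [substT]

theorem within_substT {A : Type*} {X : Query → Prop} {K W : ℕ} (G : List (List ℕ × A)) (s : List ℕ)
    (hG : ∀ t ∈ G, t.1.length = n ∧ (dotN t.1 s).size ≤ W ∧ ∀ e ∈ t.1, e.size ≤ W)
    (hs : ∀ a ∈ s, a.size ≤ K) (hn : 1 ≤ n) :
    (substT G s).Within X 0 0 (3 * G.length * n * opCost K W) := by
  have h4 := four_le_opCost K W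
  refine Timed.Within.mono (within_mapT (m := 0) (r := 0) (b := 2 * n * opCost K W)
    fun t ht => Timed.Within.bindRet ?_) (by simp) (by simp) ?_
  · have := within_dotT (P := X) (K := K) (W := W) 0 t.1 s (by simpa using (hG t ht).2.1)
      (hG t ht).2.2 hs
    rwa [(hG t ht).1] at this
  · have : G.length * 1 ≤ G.length * (n * opCost K W) :=
      Nat.mul_le_mul_left _ (Nat.mul_pos hn (by omega))
    nlinarith

end Substitution

end SparseInterp

namespace SparseInterp

open Timed

/-! ### The sieve of Eratosthenes -/

section Sieve

variable {P : Query → Prop}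

theorem markT_val (q c j : ℕ) (a : ℕ → Bool) (i : ℕ) :
    (markT q c j a).val i = true ↔ a i = true ∧ ∀ k < c, i ≠ j + k * q := by
  induction c generalizing j a with
  | zero => simp [markT]
  | succ c ih =>
    simp only [markT, Timed.bind_val, addN_val, writeBit_val, ih]
    constructor
    · rintro ⟨h1, h2⟩
      have hij : i ≠ j := by rintro rfl; simp at h1
      rw [Function.update_of_ne hij] at h1
      refine ⟨h1, fun k hk => ?_⟩
      cases k with
      | zero => simpa using hij
      | succ k =>
        have := h2 k (by omega)
        rwa [add_mul, one_mul, add_comm (k * q), ← add_assoc]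
    · rintro ⟨h1, h2⟩
      have hij : i ≠ j := by simpa using h2 0 (by omega)
      rw [Function.update_of_ne hij]
      refine ⟨h1, fun k hk => ?_⟩
      have := h2 (k + 1) (by omega)
      rwa [add_mul, one_mul, add_comm (k * q), ← add_assoc] at this

/-- `i` has no divisor between `2` and `q - 1`, except perhaps itself. -/
def Unsieved (q i : ℕ) : Prop := 2 ≤ i ∧ ∀ m, 2 ≤ m → m < q → m ∣ i → i = m

/-- The round for a surviving `q`: the proper multiples of `q` up to `b` are `2q, …, (b / q) q`, and
these are `b / q - 1` numbers. -/
theorem unsieved_succ_of_unsieved {q i b : ℕ} (hq : 2 ≤ q) (hi : i ≤ b) :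
    Unsieved (q + 1) i ↔ Unsieved q i ∧ ∀ k < b / q - 1, i ≠ q + q + k * q := by
  constructor
  · rintro ⟨h1, h2⟩
    refine ⟨⟨h1, fun m hm hmq => h2 m hm (by omega)⟩, ?_⟩
    rintro k - rfl
    have := h2 q hq (by omega) ⟨2 + k, by ring⟩
    omega
  · rintro ⟨⟨h1, h2⟩, h3⟩
    refine ⟨h1, fun m hm hmq hd => ?_⟩
    rcases Nat.lt_succ_iff_lt_or_eq.1 hmq with h | rfl
    · exact h2 m hm h hd
    · obtain ⟨c, rfl⟩ := hd
      -- Cofactor 0 contradicts `2 ≤ i`, cofactor 1 is the number `q` itself, and cofactor `c + 2`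
      -- is the `c`-th deleted number.
      rcases c with _ | _ | c
      · simp at h1
      · simp
      · refine absurd (by ring) (h3 c ?_)
        have : c + 1 + 1 ≤ b / m :=
          (Nat.le_div_iff_mul_le (by omega)).2 (by rw [mul_comm]; exact hi)
        omega

/-- A deleted `q` has a divisor `k` with `2 ≤ k < q`. Every multiple of `q` is a proper multiple of
`k` and is already gone. -/
theorem unsieved_succ_of_not_unsieved {q i : ℕ} (hq : 2 ≤ q) (h : ¬Unsieved q q) :
    Unsieved (q + 1) i ↔ Unsieved q i := by
  constructor
  · rintro ⟨h1, h2⟩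
    exact ⟨h1, fun m hm hmq => h2 m hm (by omega)⟩
  · rintro ⟨h1, h2⟩
    refine ⟨h1, fun m hm hmq hd => ?_⟩
    rcases Nat.lt_succ_iff_lt_or_eq.1 hmq with h' | rfl
    · exact h2 m hm h' hd
    · simp only [Unsieved, hq, true_and] at h
      push Not at h
      obtain ⟨k, hk, hkm, hkd, -⟩ := h
      have := h2 k hk hkm (hkd.trans hd)
      have := Nat.le_of_dvd (by omega) hd
      omega

theorem unsieved_iff_prime {q i : ℕ} (h : i < q) : Unsieved q i ↔ i.Prime := by
  rw [Nat.prime_def]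
  refine and_congr_right fun h2 => ⟨fun H m hm => ?_, fun H m hm _ hd => ?_⟩
  · have hle := Nat.le_of_dvd (by omega) hm
    have := Nat.pos_of_dvd_of_pos hm (by omega)
    by_contra! hne
    exact hne.2 (H m (by omega) (by omega) hm).symm
  · rcases H m hd with h' | h' <;> omega

theorem sieveLoopT_val (b r q : ℕ) (a : ℕ → Bool) (hq : 2 ≤ q) (hr : q + r ≤ b + 1)
    (ha : ∀ i ≤ b, a i = true ↔ Unsieved q i) :
    ∀ i ≤ b, (sieveLoopT b r q a).val i = true ↔ Unsieved (q + r) i := by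
  induction r generalizing q a with
  | zero => simpa [sieveLoopT] using ha
  | succ r ih =>
    rw [sieveLoopT]
    simp only [Timed.bind_val, addN_val]
    have := ih (q + 1) (a := (if (readBit a q).val then
        (divModN b q).bind fun qr =>
        (subN qr.1 1).bind fun c =>
        (addN q q).bind fun j => markT q c j a
      else ret a).val) (by omega) (by omega) ?_
    · rwa [add_assoc, add_comm 1] at this
    · intro i hi
      split_ifs with h
      · rw [readBit_val, ha q (by omega)] at h
        simp only [Timed.bind_val, divModN_val, subN_val, addN_val, markT_val]
        rw [unsieved_succ_of_unsieved hq hi, ha i hi]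
      · rw [readBit_val, ha q (by omega)] at h
        rw [Timed.ret_val, unsieved_succ_of_not_unsieved hq h, ha i hi]

theorem survivorsT_val (a : ℕ → Bool) (r i : ℕ) :
    (survivorsT a r i).val = (List.range' i r).filter fun k => a k := by
  induction r generalizing i with
  | zero => rfl
  | succ r ih =>
    simp only [survivorsT, Timed.bind_val, addN_val, readBit_val, Timed.ret_val, ih,
      List.range'_succ, List.filter_cons]

/-- The list of the primes in `[lo, b]`. -/
def primesIn (lo b : ℕ) : List ℕ := (List.range' lo (b + 1 - lo)).filter fun k => k.Prime

theorem mem_primesIn {lo b p : ℕ} : p ∈ primesIn lo b ↔ p.Prime ∧ lo ≤ p ∧ p ≤ b := by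
  simp only [primesIn, List.mem_filter, List.mem_range'_1, decide_eq_true_eq]
  constructor
  · rintro ⟨h1, h2⟩; exact ⟨h2, by omega, by omega⟩
  · rintro ⟨h1, h2, h3⟩; exact ⟨by omega, h1⟩

theorem nodup_primesIn (lo b : ℕ) : (primesIn lo b).Nodup := List.Nodup.filter _ List.nodup_range'

theorem length_primesIn (lo b : ℕ) :
    (primesIn lo b).length = ((Finset.Icc lo b).filter Nat.Prime).card := by
  rw [← List.toFinset_card_of_nodup (nodup_primesIn lo b)]
  congr 1
  ext p
  simp only [List.mem_toFinset, mem_primesIn, Finset.mem_filter, Finset.mem_Icc]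
  tauto

theorem length_primesIn_mono (lo : ℕ) {b b' : ℕ} (h : b ≤ b') :
    (primesIn lo b).length ≤ (primesIn lo b').length := by
  rw [length_primesIn, length_primesIn]
  exact Finset.card_le_card (Finset.filter_subset_filter _ (Finset.Icc_subset_Icc_right h))

theorem length_primesIn_le (lo b : ℕ) : (primesIn lo b).length ≤ b + 1 :=
  (List.length_filter_le _ _).trans (by simp)

theorem sieveT_val (lo b : ℕ) (hb : 1 ≤ b) : (sieveT lo b).val = primesIn lo b := by
  simp only [sieveT, Timed.bind_val, subN_val, survivorsT_val, primesIn]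
  refine List.filter_congr fun k hk => ?_
  rw [List.mem_range'_1] at hk
  -- The loop runs over all `q` from 2 to `b`, not only to `√b`, and ends with `Unsieved (b + 1)`,
  -- which is primality for numbers up to `b`.
  have := sieveLoopT_val b (b - 1) 2 (fun i => decide (2 ≤ i)) le_rfl (by omega)
    (fun i _ => by simp only [Unsieved, decide_eq_true_eq]
                   exact ⟨fun h => ⟨h, fun m _ _ => by omega⟩, fun h => h.1⟩) k (by omega)
  rw [unsieved_iff_prime (by omega)] at this
  rw [Bool.eq_iff_iff, this, decide_eq_true_eq]

/-! ### Cost of the sieve -/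

/-- For `c ≥ 1` the last hypothesis says that the last number to be deleted, `j + (c - 1) q`, is at
most `b`. So all indices written have at most `W` bits. -/
theorem within_markT {K W b : ℕ} (q c j : ℕ) (a : ℕ → Bool) (hb : b.size ≤ W) (hq : q ≤ b)
    (hj : j + c * q ≤ b + q) :
    (markT q c j a).Within P 0 0 (2 * c * opCost K W) := by
  induction c generalizing j a with
  | zero => exact Timed.Within.monoBits (within_ret _) (by simp)
  | succ c ih =>
    rw [markT]
    have hjb : j.size ≤ W := (Nat.size_le_size (by nlinarith)).trans hb
    refine Timed.Within.monoBits (Timed.Within.bindBits (within_writeBit (K := K) _ _ hjb)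
      (Timed.Within.bindBits (within_addN (K := K) hjb ((Nat.size_le_size hq).trans hb))
        (ih _ _ ?_))) ?_
    · simp only [addN_val]; nlinarith
    · ring_nf; exact le_rfl

theorem within_sieveLoopT {W b : ℕ} (r q : ℕ) (a : ℕ → Bool) (hb : b.size ≤ W) (hb1 : 1 ≤ b)
    (hq : 1 ≤ q) (hr : q + r ≤ b + 1) :
    (sieveLoopT b r q a).Within P 0 0
      (5 * r * opCost W W + 2 * opCost W W * ∑ i ∈ Finset.range r, b / (q + i)) := by
  induction r generalizing q a with
  | zero => exact Timed.Within.monoBits (within_ret _) (by simp)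
  | succ r ih =>
    rw [sieveLoopT]
    have hqb : q.size ≤ W := (Nat.size_le_size (by omega)).trans hb
    have h1 : Nat.size 1 ≤ W := (Nat.size_le_size hb1).trans hb
    refine Timed.Within.monoBits (Timed.Within.bindBits (within_readBit (K := W) _ hqb)
      (Timed.Within.bindBits (b := 3 * opCost W W + 2 * (b / q) * opCost W W) ?_
        (Timed.Within.bindBits (within_addN (K := W) hqb h1)
        (ih _ _ (by simp only [addN_val]; omega) (by simp only [addN_val]; omega))))) ?_
    · split_ifs
      · refine Timed.Within.monoBits (Timed.Within.bindBits (within_divModN hb hqb)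
          (Timed.Within.bindBits (within_subN (K := W) (W := W) ?_ h1)
          (Timed.Within.bindBits (within_addN (K := W) hqb hqb)
            (within_markT (K := W) _ _ _ _ hb (by omega) ?_)))) ?_
        · exact (Nat.size_le_size (Nat.div_le_self _ _)).trans hb
        · simp only [divModN_val, subN_val, addN_val]
          have h2 := Nat.div_mul_le_self b q
          have h3 : 1 ≤ b / q := (Nat.le_div_iff_mul_le hq).2 (by omega)
          obtain ⟨c, hc⟩ := Nat.exists_eq_add_of_le h3
          rw [hc] at h2 ⊢
          simp only [add_tsub_cancel_left]
          nlinarith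
        · simp only [divModN_val, subN_val]
          have : 2 * (b / q - 1) * opCost W W ≤ 2 * (b / q) * opCost W W := by
            gcongr; exact Nat.sub_le _ _
          omega
      · exact Timed.Within.monoBits (within_ret _) (by simp)
    · simp only [addN_val]
      rw [Finset.sum_range_succ']
      simp only [add_zero, add_assoc, add_comm 1]
      ring_nf
      exact le_rfl

/-- Dyadic grouping as for the harmonic series: the `2^(k+1)` divisors from `2^(k+1)` to `2^(k+2) -
1` contribute at most `b / 2^(k+1)` each, hence at most `b` together. Charging all divisors rather
than the primes alone costs only a logarithmic factor. -/
theorem sum_div_le {b S : ℕ} (hb : b.size ≤ S) (r : ℕ) (hr : r < b) :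
    ∑ i ∈ Finset.range r, b / (2 + i) ≤ b * S := by
  have key : ∀ k, ∑ i ∈ Finset.range (2 ^ (k + 1) - 2), b / (2 + i) ≤ b * k := by
    intro k
    induction k with
    | zero => simp
    | succ k ih =>
      have h2 : 2 ≤ 2 ^ (k + 1) := Nat.le_self_pow (by omega) 2
      have hk : 2 ^ (k + 1 + 1) - 2 = (2 ^ (k + 1) - 2) + 2 ^ (k + 1) := by
        rw [pow_succ 2 (k + 1)]; omega
      rw [hk, Finset.sum_range_add, mul_add, mul_one]
      refine add_le_add ih ?_
      calc ∑ x ∈ Finset.range (2 ^ (k + 1)), b / (2 + (2 ^ (k + 1) - 2 + x))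
          ≤ ∑ x ∈ Finset.range (2 ^ (k + 1)), b / 2 ^ (k + 1) :=
            Finset.sum_le_sum fun x _ => Nat.div_le_div_left (by omega) (by positivity)
        _ = 2 ^ (k + 1) * (b / 2 ^ (k + 1)) := by simp
        _ ≤ b := Nat.mul_div_le _ _
  refine (Finset.sum_le_sum_of_subset (Finset.range_mono ?_)).trans
    ((key b.size).trans (Nat.mul_le_mul_left _ hb))
  have := Nat.lt_size_self b
  rw [pow_succ]
  omega

theorem within_survivorsT {W : ℕ} (a : ℕ → Bool) (r i : ℕ) (h : (i + r).size ≤ W) :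
    (survivorsT a r i).Within P 0 0 (2 * r * opCost W W) := by
  induction r generalizing i with
  | zero => exact Timed.Within.monoBits (within_ret _) (by simp)
  | succ r ih =>
    rw [survivorsT]
    have hi : i.size ≤ W := (Nat.size_le_size (by omega)).trans h
    have h1 : Nat.size 1 ≤ W := (Nat.size_le_size (by omega)).trans h
    refine Timed.Within.monoBits (Timed.Within.bindBits (within_readBit (K := W) _ hi)
      (Timed.Within.bindBits (within_addN (K := W) hi h1)
        (ih _ ?_).bindRet)) ?_
    · simpa only [addN_val, add_assoc, add_comm 1] using h
    · ring_nf; exact le_rfl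

theorem within_sieveT {W b : ℕ} (lo : ℕ) (hb1 : 1 ≤ b) (hlo : lo ≤ b + 1)
    (hb : (b + 1).size ≤ W) :
    (sieveT lo b).Within P 0 0 (13 * (b + 1) * W * opCost W W) := by
  have hbW : b.size ≤ W := (Nat.size_le_size (by omega)).trans hb
  have h1 : Nat.size 1 ≤ W := (Nat.size_le_size (by omega)).trans hb
  have hW1 : 1 ≤ W := h1
  have h4 := four_le_opCost W W
  rw [sieveT]
  refine Timed.Within.monoBits (Timed.Within.bindBits (within_tick _)
    (Timed.Within.bindBits (within_subN (K := W) hbW h1)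
    (Timed.Within.bindBits (within_sieveLoopT _ _ _ hbW hb1 (by omega) (by simp; omega))
    (Timed.Within.bindBits (within_subN (K := W) hb ((Nat.size_le_size hlo).trans hb))
    (within_survivorsT (W := W) _ _ _ ?_))))) ?_
  · simp only [subN_val]; rwa [Nat.add_sub_cancel' hlo]
  · simp only [subN_val]
    have hs := sum_div_le hbW (b - 1) (by omega)
    have hW : b + 1 ≤ (b + 1) * W := Nat.le_mul_of_pos_right _ hW1
    have e1 : 5 * (b - 1) * opCost W W ≤ 5 * ((b + 1) * W) * opCost W W := by gcongr; omega
    have e2 : 2 * opCost W W * ∑ i ∈ Finset.range (b - 1), b / (2 + i) ≤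
        2 * opCost W W * ((b + 1) * W) := by
      gcongr; exact hs.trans (Nat.mul_le_mul_right _ (by omega))
    have e3 : 2 * (b + 1 - lo) * opCost W W ≤ 2 * ((b + 1) * W) * opCost W W := by gcongr; omega
    have e4 : 1 * opCost W W ≤ ((b + 1) * W) * opCost W W := by gcongr; omega
    have e5 : (b + 1) ≤ ((b + 1) * W) * opCost W W := hW.trans (Nat.le_mul_of_pos_right _ (by omega))
    rw [mul_assoc 13]
    generalize (b + 1) * W = Z at *
    nlinarith

/-! ### The search for primes -/

/-- Bertrand's postulate provides a new prime in `(b, 2b]`. -/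
theorem length_primesIn_succ_le {lo b : ℕ} (hb : b ≠ 0) (h : lo ≤ b) :
    (primesIn lo b).length + 1 ≤ (primesIn lo (b + b)).length := by
  obtain ⟨p, hp, hlt, hle⟩ := Nat.exists_prime_lt_and_le_two_mul b hb
  rw [length_primesIn, length_primesIn, ← Finset.card_insert_of_notMem (a := p)]
  · refine Finset.card_le_card (Finset.insert_subset ?_
      (Finset.filter_subset_filter _ (Finset.Icc_subset_Icc_right (by omega))))
    simp only [Finset.mem_filter, Finset.mem_Icc]
    exact ⟨⟨by omega, by omega⟩, hp⟩
  · simp; omega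

/-- One new prime per doubling. This shows only that the fuel suffices; the bounds for the primes
and for the cost come from `primeBound`. -/
theorem le_length_primesIn {lo b : ℕ} (hb : b ≠ 0) (h : lo ≤ b) (N : ℕ) :
    N ≤ (primesIn lo (b * 2 ^ N)).length := by
  induction N with
  | zero => simp
  | succ N ih =>
    have h1 : b ≤ b * 2 ^ N := Nat.le_mul_of_pos_right _ (by positivity)
    have := length_primesIn_succ_le (lo := lo) (b := b * 2 ^ N) (by omega) (by omega)
    rw [pow_succ, ← mul_assoc, mul_two]
    omega

/-- A round that fails has `b < M`, since `[lo, M]` already contains `N` primes. So doubling never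
leads beyond `2 * M`. -/
theorem searchPrimesT_val {lo N M : ℕ} (hM : N ≤ (primesIn lo M).length) (fuel b : ℕ)
    (hb : 1 ≤ b) (hbM : b ≤ 2 * M)
    (hfuel : N ≤ (primesIn lo (b * 2 ^ fuel)).length) :
    ∃ b' ≤ 2 * M, (searchPrimesT lo N (fuel + 1) b).val = (primesIn lo b').take N ∧
      N ≤ (primesIn lo b').length := by
  induction fuel generalizing b with
  | zero =>
    refine ⟨b, hbM, ?_, by simpa using hfuel⟩
    simp only [searchPrimesT, Timed.bind_val, lengthT_val, leN_val, sieveT_val lo b hb,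
      decide_eq_true_eq]
    rw [if_pos (by simpa using hfuel)]
    rfl
  | succ fuel ih =>
    rw [searchPrimesT]
    simp only [Timed.bind_val, lengthT_val, leN_val, sieveT_val lo b hb, decide_eq_true_eq]
    split_ifs with h
    · exact ⟨b, hbM, rfl, h⟩
    · have hlt : b < M := by
        by_contra hMb
        exact h (hM.trans (length_primesIn_mono lo (by omega)))
      exact ih (b + b) (by omega) (by omega) (by rwa [← two_mul, mul_comm 2 b, mul_assoc, ← pow_succ'])

/-- The parameter `j` bounds the rounds that remain: each failed round doubles `b`, which stays at
most `2 * M`. Thus the number of rounds is logarithmic in `M`, whatever the fuel. -/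
theorem within_searchPrimesT {lo N M W : ℕ} (hM : N ≤ (primesIn lo M).length)
    (hW : (2 * M + 1).size ≤ W) (fuel b j : ℕ) (hb : 1 ≤ b) (hlo : lo ≤ b) (hbM : b ≤ 2 * M)
    (hj : 2 * M < b * 2 ^ j) :
    (searchPrimesT lo N fuel b).Within P 0 0 (j * (17 * (2 * M + 1) * W * opCost W W)) := by
  induction fuel generalizing b j with
  | zero => exact Timed.Within.monoBits (within_ret _) (by simp)
  | succ fuel ih =>
    cases j with
    | zero => simp at hj; omega
    | succ j =>
      have h4 := four_le_opCost W W
      have hbW : (b + 1).size ≤ W := (Nat.size_le_size (by omega)).trans hW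
      have hbW' : b.size ≤ W := (Nat.size_le_size (by omega)).trans hW
      have hW1 : 1 ≤ W := (Nat.size_le_size (m := 1) (by omega)).trans hW
      have hl := length_primesIn_le lo b
      have hN : N ≤ 2 * M + 1 := by
        have := length_primesIn_le lo M
        omega
      rw [searchPrimesT]
      refine Timed.Within.monoBits (Timed.Within.bindBits (within_sieveT lo hb (by omega) hbW)
        (Timed.Within.bindBits (within_lengthT (K := W) (W := W) _ ?_ hW1)
        (Timed.Within.bindBits (within_leN (K := W) (W := W) ((Nat.size_le_size hN).trans hW) ?_)
        (b' := (2 * M + 1) * 1 + opCost W W + j * (17 * (2 * M + 1) * W * opCost W W)) ?_))) ?_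
      · rw [sieveT_val _ _ hb]; exact (Nat.size_le_size hl).trans hbW
      · rw [lengthT_val, sieveT_val _ _ hb]; exact (Nat.size_le_size hl).trans hbW
      · split_ifs with h
        · exact Timed.Within.monoBits (Timed.Within.bindBits (within_tick N)
            (b' := 0) (within_ret _)) (by omega)
        · simp only [lengthT_val, leN_val, sieveT_val lo b hb, decide_eq_true_eq] at h
          have hlt : b < M := by
            by_contra hMb
            exact h (hM.trans (length_primesIn_mono lo (by omega)))
          refine Timed.Within.monoBits (Timed.Within.bindBits (within_addN (K := W) hbW' hbW')
            (ih (b + b) j (by omega) (by omega) (by omega) ?_)) (by omega)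
          rwa [← two_mul, mul_comm 2 b, mul_assoc, ← pow_succ']
      · rw [sieveT_val _ _ hb]
        have e1 : 13 * (b + 1) * W * opCost W W ≤ 13 * (2 * M + 1) * W * opCost W W := by
          gcongr 13 * ?_ * W * opCost W W
          omega
        have e2 : (primesIn lo b).length * opCost W W ≤ (2 * M + 1) * W * opCost W W := by
          gcongr
          calc _ ≤ (2 * M + 1) * 1 := by omega
            _ ≤ _ := by gcongr
        have e3 : 1 * opCost W W ≤ (2 * M + 1) * W * opCost W W := by
          gcongr
          nlinarith
        have e4 : (2 * M + 1) * 1 ≤ (2 * M + 1) * (W * opCost W W) := by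
          gcongr
          nlinarith
        rw [← mul_assoc] at e4
        nlinarith

/-- A number below which there are at least `m` primes. -/
def primeBound (m : ℕ) : ℕ := 16 * m * m.size

/-- Chebyshev: `π(n) ≥ (n log 2 - log (n + 1)) / log n`. For `n = 16 m s` with `s = m.size` one has
`n + 1 ≤ 2^(5 + 2s)`, hence `m log n + log (n + 1) ≤ (m + 1)(5 + 2s) log 2 ≤ n log 2`. -/
theorem le_primeCounting_primeBound {m : ℕ} (hm : 1 ≤ m) :
    m ≤ Nat.primeCounting (primeBound m) := by
  have hs : 1 ≤ m.size := Nat.size_pos.2 hm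
  set s := m.size with hsdef
  set n := primeBound m with hn
  have hn' : n = 16 * m * s := rfl
  have hn16 : 16 ≤ n := by rw [hn']; nlinarith
  have hle : n + 1 ≤ 2 ^ (5 + 2 * s) := by
    have h1 : m < 2 ^ s := Nat.lt_size_self m
    have h2 : s < 2 ^ s := Nat.lt_two_pow_self
    have h3 : m * s ≤ 2 ^ s * 2 ^ s := Nat.mul_le_mul h1.le h2.le
    have h4 : 2 ^ (5 + 2 * s) = 32 * (2 ^ s * 2 ^ s) := by rw [pow_add, two_mul, pow_add]; norm_num
    rw [h4, hn']
    nlinarith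
  have hlog2 : 0 < Real.log 2 := Real.log_pos (by norm_num)
  have hlog1 : Real.log (n + 1) ≤ (5 + 2 * s) * Real.log 2 := by
    have : ((n : ℝ) + 1) ≤ (2 : ℝ) ^ (5 + 2 * s) := by exact_mod_cast hle
    calc Real.log (n + 1) ≤ Real.log ((2 : ℝ) ^ (5 + 2 * s)) :=
          Real.log_le_log (by positivity) this
      _ = _ := by rw [Real.log_pow]; push_cast; ring
  have hn16' : (16 : ℝ) ≤ n := by exact_mod_cast hn16
  have hlog0 : 0 < Real.log n := Real.log_pos (by linarith)
  have hlog : Real.log n ≤ (5 + 2 * s) * Real.log 2 :=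
    (Real.log_le_log (by linarith) (by linarith)).trans hlog1
  have hpi := Chebyshev.pi_ge n
  have : (m : ℝ) ≤ (n * Real.log 2 - Real.log (n + 1)) / Real.log n := by
    rw [le_div_iff₀ hlog0]
    have hm' : (1 : ℝ) ≤ m := by exact_mod_cast hm
    have hs' : (1 : ℝ) ≤ s := by exact_mod_cast hs
    have e1 : (m : ℝ) * Real.log n ≤ m * ((5 + 2 * s) * Real.log 2) := by gcongr
    have e2 : (n : ℝ) = 16 * m * s := by rw [hn']; push_cast; ring
    have e3 : (m : ℝ) * (5 + 2 * s) + (5 + 2 * s) ≤ 16 * m * s := by nlinarith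
    have e4 := mul_le_mul_of_nonneg_right e3 hlog2.le
    rw [← e2] at e4
    linarith
  exact_mod_cast this.trans hpi

/-- Among at least `lo + N` primes up to `primeBound (lo + N)`, at most `lo` are smaller than `lo`.
-/
theorem le_length_primesIn_primeBound {lo N : ℕ} (hN : 1 ≤ N) :
    N ≤ (primesIn lo (primeBound (lo + N))).length := by
  have h := le_primeCounting_primeBound (m := lo + N) (by omega)
  rw [← Nat.primesLE_card_eq_primeCounting] at h
  rw [length_primesIn]
  have hsub : Nat.primesLE (primeBound (lo + N)) ⊆
      Finset.range lo ∪ (Finset.Icc lo (primeBound (lo + N))).filter Nat.Prime := by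
    intro p hp
    rw [Nat.mem_primesLE] at hp
    simp only [Finset.mem_union, Finset.mem_range, Finset.mem_filter, Finset.mem_Icc]
    by_cases hlt : p < lo
    · exact Or.inl hlt
    · exact Or.inr ⟨⟨by omega, hp.1⟩, hp.2⟩
  have := (Finset.card_le_card hsub).trans (Finset.card_union_le _ _)
  rw [Finset.card_range] at this
  omega

theorem add_two_le_primeBound {lo N : ℕ} (hN : 1 ≤ N) : lo + 2 ≤ 2 * primeBound (lo + N) := by
  have : 1 ≤ (lo + N).size := Nat.size_pos.2 (by omega)
  unfold primeBound
  nlinarith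

theorem firstPrimesT_spec {lo N : ℕ} (hN : 1 ≤ N) :
    (firstPrimesT lo N).val.length = N ∧ (firstPrimesT lo N).val.Nodup ∧
      ∀ p ∈ (firstPrimesT lo N).val, p.Prime ∧ lo ≤ p ∧ p ≤ 2 * primeBound (lo + N) := by
  obtain ⟨b', hb', h1, h2⟩ := searchPrimesT_val (le_length_primesIn_primeBound (lo := lo) hN) N
    (lo + 2) (by omega) (add_two_le_primeBound hN)
    (le_length_primesIn (by omega) (by omega) N)
  have hv : (firstPrimesT lo N).val = (primesIn lo b').take N := h1
  rw [hv]
  refine ⟨by simpa using h2, (nodup_primesIn lo b').sublist (List.take_sublist _ _),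
    fun p hp => ?_⟩
  have := mem_primesIn.1 (List.mem_of_mem_take hp)
  exact ⟨this.1, this.2.1, this.2.2.trans hb'⟩

theorem within_firstPrimesT {lo N W : ℕ} (hN : 1 ≤ N)
    (hW : (2 * primeBound (lo + N) + 1).size ≤ W) :
    (firstPrimesT lo N).Within P 0 0
      (18 * (2 * primeBound (lo + N) + 1) * W ^ 2 * opCost W W) := by
  have h2 := add_two_le_primeBound (lo := lo) hN
  have hW1 : 1 ≤ W := (Nat.size_le_size (m := 1) (by omega)).trans hW
  -- `W` rounds are enough, because `2 * primeBound (lo + N) + 1` has at most `W` bits and is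
  -- therefore below `2^W`.
  have hj := within_searchPrimesT (P := P) (le_length_primesIn_primeBound (lo := lo) hN) hW
    (N + 1) (lo + 2) W (by omega) (by omega) h2 ?_
  · refine Timed.Within.monoBits (Timed.Within.bindBits (within_addN (K := W) (W := W)
      ((Nat.size_le_size (by omega)).trans hW) ((Nat.size_le_size (by omega)).trans hW)) hj) ?_
    have : 1 * opCost W W ≤ (2 * primeBound (lo + N) + 1) * W ^ 2 * opCost W W := by
      gcongr
      exact Nat.mul_pos (by omega) (by positivity)
    nlinarith
  · have h3 := (Nat.size_le.1 hW)
    have : 1 * 2 ^ W ≤ (lo + 2) * 2 ^ W := by gcongr; omega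
    omega

end Sieve

end SparseInterp

namespace SparseInterp

open Timed

/-! ### Recovery of terms -/

section Recovery

variable {P : Query → Prop}

/-- Earlier occurrences of the current key `d` are no longer in `l`, and the flag `single` stands
for them. All other keys are described by their multiplicity in `l`. -/
theorem uniqueT_spec (d u : ℕ) (single : Bool) (l : List (ℕ × ℕ))
    (hl : l.Pairwise fun x y => x.1 ≤ y.1) (hd : ∀ t ∈ l, d ≤ t.1) :
    ((uniqueT d u single l).val.Pairwise fun x y => x.1 < y.1) ∧
    (∀ t ∈ (uniqueT d u single l).val, d ≤ t.1) ∧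
    ∀ t, t ∈ (uniqueT d u single l).val ↔
      (single = true ∧ t = (d, u) ∧ d ∉ l.map Prod.fst) ∨
        (t.1 ≠ d ∧ t ∈ l ∧ (l.map Prod.fst).count t.1 = 1) := by
  induction l generalizing d u single with
  | nil => cases single <;> simp [uniqueT]
  | cons t l ih =>
    rw [List.pairwise_cons] at hl
    simp only [uniqueT, Timed.bind_val, eqN_val, decide_eq_true_eq]
    by_cases h : d = t.1
    · rw [if_pos h]
      subst h
      obtain ⟨h1, h2, h3⟩ := ih t.1 u false hl.2 hl.1
      refine ⟨h1, h2, fun x => ?_⟩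
      rw [h3]
      by_cases hx : x.1 = t.1
      · simp [hx]
      · have : x ≠ t := fun e => hx (by rw [e])
        simp [hx, this, List.count_cons_of_ne (Ne.symm hx)]
    · rw [if_neg h]
      obtain ⟨h1, h2, h3⟩ := ih t.1 t.2 true hl.2 hl.1
      have hlt : d < t.1 := lt_of_le_of_ne (hd t (by simp)) h
      have hdl : d ∉ l.map Prod.fst := by
        intro hm
        obtain ⟨x, hx, hxd⟩ := List.mem_map.1 hm
        have := hl.1 x hx
        omega
      have key : ∀ x : ℕ × ℕ, x ∈ (uniqueT t.1 t.2 true l).val ↔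
          x.1 ≠ d ∧ x ∈ t :: l ∧ ((t :: l).map Prod.fst).count x.1 = 1 := by
        intro x
        rw [h3]
        by_cases hx : x.1 = t.1
        · have hxd : x.1 ≠ d := by omega
          simp only [hx, ne_eq, not_true_eq_false, false_and, or_false, true_and, List.map_cons,
            List.count_cons_self, Nat.add_eq_right, List.count_eq_zero, List.mem_cons]
          constructor
          · rintro ⟨rfl, h⟩; exact ⟨by omega, Or.inl rfl, h⟩
          · rintro ⟨-, h | h, h'⟩
            · exact ⟨h, h'⟩
            · exact absurd (hx ▸ List.mem_map_of_mem (f := Prod.fst) h) h'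
        · have hxt : x ≠ t := fun e => hx (by rw [e])
          simp only [Prod.mk.eta, hxt, false_and, and_false, ne_eq, hx, not_false_eq_true,
            true_and, false_or, List.mem_cons, List.map_cons, List.count_cons_of_ne (Ne.symm hx)]
          refine ⟨fun h => ⟨?_, h⟩, fun h => h.2⟩
          intro hxd
          exact hdl (hxd ▸ List.mem_map_of_mem h.1)
      have hd' : d ∉ (t :: l).map Prod.fst := by
        rw [List.map_cons, List.mem_cons, not_or]; exact ⟨h, hdl⟩
      simp only [Timed.bind_val, Timed.ret_val]
      cases single with
      | false =>
        refine ⟨h1, fun x hx => hlt.le.trans (h2 x hx), fun x => ?_⟩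
        simp only [Bool.false_eq_true, if_false, false_and, false_or]
        exact key x
      | true =>
        simp only [if_true, List.pairwise_cons, List.mem_cons, forall_eq_or_imp]
        refine ⟨⟨fun x hx => hlt.trans_le (h2 x hx), h1⟩,
          ⟨le_rfl, fun x hx => hlt.le.trans (h2 x hx)⟩, fun x => ?_⟩
        refine (or_congr_right (key x)).trans ?_
        rw [List.mem_cons (l := l)]
        exact or_congr_left ⟨fun h => ⟨trivial, h, hd'⟩, fun h => h.2.1⟩

theorem length_uniqueT_le (d u : ℕ) (single : Bool) (l : List (ℕ × ℕ)) :
    (uniqueT d u single l).val.length ≤ l.length + 1 := by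
  induction l generalizing d u single with
  | nil => cases single <;> simp [uniqueT]
  | cons t l ih =>
    have := ih t.1 t.2 true
    simp only [uniqueT, Timed.bind_val]
    split_ifs
    · exact (ih _ _ _).trans (by simp)
    all_goals simp only [Timed.bind_val, Timed.ret_val, List.length_cons]; omega

theorem within_uniqueT {K W : ℕ} (d u : ℕ) (single : Bool) (l : List (ℕ × ℕ)) (hd : d.size ≤ W)
    (hl : ∀ t ∈ l, t.1.size ≤ W) :
    (uniqueT d u single l).Within P 0 0 (l.length * opCost K W) := by
  induction l generalizing d u single with
  | nil => exact Timed.Within.monoBits (within_ret _) (by simp)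
  | cons t l ih =>
    rw [uniqueT]
    have hl' : ∀ x ∈ l, x.1.size ≤ W := fun x hx => hl x (by simp [hx])
    refine Timed.Within.monoBits (Timed.Within.bindBits (within_eqN (K := K) hd (hl t (by simp)))
      (b' := l.length * opCost K W) ?_) ?_
    · by_cases hb : (eqN d t.1).val = true
      · rw [if_pos hb]; exact ih _ _ _ hd hl'
      · rw [if_neg hb]; exact Timed.Within.bindRet (ih _ _ _ (hl t (by simp)) hl')
    · simp only [List.length_cons]; ring_nf; exact le_rfl

variable {R : Type*}

theorem singlesT_spec (p : ℕ) (L : List (ℕ × R)) :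
    ((singlesT p L).val.Pairwise fun x y => x.1 < y.1) ∧
    (singlesT p L).val.length ≤ L.length ∧
    ∀ t, t ∈ (singlesT p L).val ↔ t ∈ L.map (fun t => (t.1 % p, t.1)) ∧
      ((L.map Prod.fst).map (· % p)).count t.1 = 1 := by
  have hp := sortT_perm keyLe (L.map fun t => (t.1 % p, t.1))
  have hs := sortT_keyLe_pairwise (L.map fun t => (t.1 % p, t.1))
  have hv : (mapT (fun t : ℕ × R => (divModN t.1 p).bind fun qr => ret (qr.2, t.1)) L).val =
    L.map fun t => (t.1 % p, t.1) := by simp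
  have hm : (L.map Prod.fst).map (· % p) = (L.map fun t => (t.1 % p, t.1)).map Prod.fst := by
    simp
  have hlen : L.length = (L.map fun t => (t.1 % p, t.1)).length := by simp
  rw [singlesT, hm, hlen]
  simp only [Timed.bind_val, hv]
  revert hp hs
  generalize (sortT keyLe (L.map fun t => (t.1 % p, t.1))).val = M
  generalize (L.map fun t => (t.1 % p, t.1)) = N
  intro hp hs
  rw [← hp.length_eq]
  cases M with
  | nil => simp [← hp.mem_iff]
  | cons t l =>
    rw [List.pairwise_cons] at hs
    obtain ⟨h1, -, h3⟩ := uniqueT_spec t.1 t.2 true l hs.2 hs.1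
    refine ⟨h1, length_uniqueT_le _ _ _ _, fun x => ?_⟩
    refine (h3 x).trans ?_
    rw [← (hp.map Prod.fst).count_eq, ← hp.mem_iff]
    by_cases hx : x.1 = t.1
    · simp only [Prod.mk.eta, hx, ne_eq, not_true_eq_false, false_and, or_false, true_and,
        List.map_cons, List.count_cons_self, Nat.add_eq_right, List.count_eq_zero, List.mem_cons]
      constructor
      · rintro ⟨rfl, h⟩; exact ⟨Or.inl rfl, h⟩
      · rintro ⟨h | h, h'⟩
        · exact ⟨h, h'⟩
        · exact absurd (hx ▸ List.mem_map_of_mem (f := Prod.fst) h) h'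
    · have hxt : x ≠ t := fun e => hx (by rw [e])
      simp [hx, hxt, List.count_cons_of_ne (Ne.symm hx)]

theorem of_mem_singlesT {p : ℕ} {L : List (ℕ × R)} {d u : ℕ} (h : (d, u) ∈ (singlesT p L).val) :
    u % p = d ∧ ∃ t ∈ L, t.1 = u := by
  obtain ⟨t, ht, htu⟩ := List.mem_map.1 (((singlesT_spec p L).2.2 _).1 h).1
  simp only [Prod.mk.injEq] at htu
  exact ⟨htu.2 ▸ htu.1, t, ht, htu.2⟩

/-- Since the exponents are distinct, `u` occurs once; by hypothesis it is the only exponent in its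
residue class, so that the residue also has multiplicity one. -/
theorem mem_singlesT {p : ℕ} {L : List (ℕ × R)} (hL : (L.map Prod.fst).Nodup) {u : ℕ}
    (hu : u ∈ L.map Prod.fst) (h : ∀ v ∈ L.map Prod.fst, v % p = u % p → v = u) :
    (u % p, u) ∈ (singlesT p L).val := by
  refine ((singlesT_spec p L).2.2 _).2 ⟨?_, ?_⟩
  · obtain ⟨t, ht, rfl⟩ := List.mem_map.1 hu
    exact List.mem_map.2 ⟨t, ht, rfl⟩
  · rw [← List.count_eq_one_of_mem hL hu, List.count, List.countP_map, List.count]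
    refine List.countP_congr fun v hv => ?_
    simp only [Function.comp_apply, beq_iff_eq]
    exact ⟨h v hv, fun e => by rw [e]⟩

theorem within_singlesT {K W : ℕ} (p : ℕ) (L : List (ℕ × R)) (hL : ∀ t ∈ L, t.1.size ≤ W)
    (hp : p.size ≤ K) (hK : L.length.size ≤ K) (hK1 : 1 ≤ K) :
    (singlesT p L).Within P 0 0 (5 * L.length * K * opCost K W) := by
  have h4 := four_le_opCost K W
  have hv : (mapT (fun t : ℕ × R => (divModN t.1 p).bind fun qr => ret (qr.2, t.1)) L).val =
    L.map fun t => (t.1 % p, t.1) := by simp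
  have hs : ∀ t ∈ L.map (fun t => (t.1 % p, t.1)), t.1.size ≤ W := by
    intro t ht
    obtain ⟨u, hu, rfl⟩ := List.mem_map.1 ht
    exact (Nat.size_le_size (Nat.mod_le _ _)).trans (hL u hu)
  have hperm := sortT_perm keyLe (L.map fun t => (t.1 % p, t.1))
  rw [singlesT]
  refine Timed.Within.mono (Timed.Within.bind (within_mapT (m := 0) (r := 0) (b := opCost K W)
    fun t ht => Timed.Within.bindRet (within_divModN (hL t ht) hp))
      (Timed.Within.bindBits (within_sortT_keyLe (K := K) (W := W) _ (by rwa [hv])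
        (by rwa [hv, List.length_map])) (b' := L.length * opCost K W) ?_))
        (by simp) (by simp) ?_
  · rw [hv]
    have hs' := fun t ht => hs t (hperm.mem_iff.1 ht)
    have hlen := hperm.length_eq
    rw [List.length_map] at hlen
    rw [← hlen]
    revert hs'
    generalize (sortT keyLe (L.map fun t => (t.1 % p, t.1))).val = M
    intro hs'
    cases M with
    | nil => exact Timed.Within.monoBits (within_ret _) (by simp)
    | cons t l =>
      refine Timed.Within.monoBits (within_uniqueT (K := K) (W := W) _ _ _ _ (hs' t (by simp))
        fun x hx => hs' x (by simp [hx])) ?_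
      exact Nat.mul_le_mul_right _ (by simp)
  · rw [hv, List.length_map]
    have : L.length * opCost K W ≤ L.length * opCost K W * K := Nat.le_mul_of_pos_right _ hK1
    nlinarith

/-! ### Joins -/

variable {α β : Type*}

/-- Because the keys increase strictly, the smaller of two different heads has no partner in the
other list and can be dropped. -/
theorem joinT_spec (l : List (ℕ × α)) (m : List (ℕ × β)) (hl : l.Pairwise fun x y => x.1 < y.1)
    (hm : m.Pairwise fun x y => x.1 < y.1) :
    ((joinT l m).val.Pairwise fun x y => x.1 < y.1) ∧ (joinT l m).val.length ≤ l.length ∧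
    ∀ t, t ∈ (joinT l m).val ↔ (t.1, t.2.1) ∈ l ∧ (t.1, t.2.2) ∈ m := by
  induction l, m using joinT.induct with
  | case1 m => simp [joinT]
  | case2 x l => simp [joinT]
  | case3 x l y m ih1 ih2 ih3 =>
    have ih1 := ih1 (List.pairwise_cons.1 hl).2 (List.pairwise_cons.1 hm).2
    have ih2 := ih2 (List.pairwise_cons.1 hl).2 hm
    have ih3 := ih3 hl (List.pairwise_cons.1 hm).2
    rw [List.pairwise_cons] at hl hm
    rw [joinT]
    simp only [Timed.bind_val, eqN_val, decide_eq_true_eq]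
    have hx : ∀ d a, (d, a) ∈ l → x.1 < d := fun d a h => hl.1 _ h
    have hy : ∀ d a, (d, a) ∈ m → y.1 < d := fun d a h => hm.1 _ h
    split_ifs with h
    · obtain ⟨h1, h2, h3⟩ := ih1
      simp only [Timed.bind_val, Timed.ret_val, List.pairwise_cons, List.length_cons,
        Nat.add_le_add_iff_right, List.mem_cons]
      refine ⟨⟨fun t ht => hx _ _ ((h3 t).1 ht).1, h1⟩, h2, fun t => ?_⟩
      rw [h3 t]
      constructor
      · rintro (rfl | ⟨ha, hb⟩)
        · exact ⟨Or.inl rfl, Or.inl (by rw [h])⟩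
        · exact ⟨Or.inr ha, Or.inr hb⟩
      · rintro ⟨ha | ha, hb | hb⟩
        · left; subst ha; subst hb; rfl
        · have := hy _ _ hb; have := congrArg Prod.fst ha; simp only at this; omega
        · have := hx _ _ ha; have := congrArg Prod.fst hb; simp only at this; omega
        · exact Or.inr ⟨ha, hb⟩
    · simp only [Timed.bind_val, leN_val, decide_eq_true_eq]
      split_ifs with h'
      · obtain ⟨h1, h2, h3⟩ := ih2
        refine ⟨h1, h2.trans (by simp), fun t => ?_⟩
        rw [h3 t, List.mem_cons (a := (t.1, t.2.1))]
        refine and_congr_left fun hb => ⟨Or.inr, ?_⟩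
        rintro (rfl | ha)
        · exfalso
          rcases List.mem_cons.1 hb with hb | hb
          · have := congrArg Prod.fst hb; simp only at this; exact h this
          · have := hy _ _ hb; simp only at h h'; omega
        · exact ha
      · obtain ⟨h1, h2, h3⟩ := ih3
        refine ⟨h1, h2, fun t => ?_⟩
        rw [h3 t, List.mem_cons (a := (t.1, t.2.2))]
        refine and_congr_right fun ha => ⟨Or.inr, ?_⟩
        rintro (rfl | hb)
        · exfalso
          rcases List.mem_cons.1 ha with ha | ha
          · have := congrArg Prod.fst ha; simp only at this; exact h this.symm
          · have := hx _ _ ha; simp only at h h'; omega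
        · exact hb

theorem within_joinT {K W : ℕ} (l : List (ℕ × α)) (m : List (ℕ × β))
    (hl : ∀ t ∈ l, t.1.size ≤ W) (hm : ∀ t ∈ m, t.1.size ≤ W) :
    (joinT l m).Within P 0 0 ((l.length + m.length) * (2 * opCost K W)) := by
  induction l, m using joinT.induct with
  | case1 m => rw [joinT]; exact Timed.Within.monoBits (within_ret _) (by simp)
  | case2 x l => rw [joinT]; exact Timed.Within.monoBits (within_ret _) (by simp)
  | case3 x l y m ih1 ih2 ih3 =>
    have hl' : ∀ t ∈ l, t.1.size ≤ W := fun t ht => hl t (by simp [ht])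
    have hm' : ∀ t ∈ m, t.1.size ≤ W := fun t ht => hm t (by simp [ht])
    have hx := hl x (by simp)
    have hy := hm y (by simp)
    rw [joinT]
    refine Timed.Within.monoBits (Timed.Within.bindBits (within_eqN (K := K) hx hy)
      (b' := opCost K W + (l.length + m.length + 1) * (2 * opCost K W)) ?_) ?_
    · split_ifs
      · refine Timed.Within.monoBits (Timed.Within.bindRet (ih1 hl' hm')) ?_
        nlinarith
      · refine Timed.Within.bindBits (within_leN (K := K) hx hy) ?_
        split_ifs
        · refine Timed.Within.monoBits (ih2 hl' hm) ?_
          simp only [List.length_cons]; nlinarith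
        · refine Timed.Within.monoBits (ih3 hl hm') ?_
          simp only [List.length_cons]; nlinarith
    · simp only [List.length_cons]; nlinarith

/-- Joins only remove records. The bound on the length keeps each of the successive joins linear,
and it later bounds the number of selected terms. -/
theorem matchT_spec (p : ℕ) (base : List (ℕ × (R × ℕ))) (gs : List (List (ℕ × R)))
    (hb : base.Pairwise fun x y => x.1 < y.1) :
    ((matchT p base gs).val.Pairwise fun x y => x.1 < y.1) ∧
    (matchT p base gs).val.length ≤ base.length ∧
    ∀ t, t ∈ (matchT p base gs).val ↔ (t.1, t.2.1) ∈ base ∧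
      List.Forall₂ (fun g b => (t.1, b) ∈ (singlesT p g).val) gs t.2.2 := by
  induction gs with
  | nil =>
    simp only [matchT, mapT_val, Timed.ret_val, List.pairwise_map, List.length_map, le_refl,
      true_and, List.mem_map, List.forall₂_nil_left_iff]
    refine ⟨hb, fun t => ⟨?_, ?_⟩⟩
    · rintro ⟨u, hu, rfl⟩; exact ⟨hu, rfl⟩
    · rintro ⟨h1, h2⟩; exact ⟨_, h1, by rw [← h2]⟩
  | cons g gs ih =>
    obtain ⟨h1, h2, h3⟩ := ih
    obtain ⟨j1, j2, j3⟩ := joinT_spec _ _ h1 (singlesT_spec p g).1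
    simp only [matchT, Timed.bind_val, mapT_val, Timed.ret_val, List.pairwise_map,
      List.length_map, List.mem_map]
    refine ⟨j1, j2.trans h2, fun t => ⟨?_, ?_⟩⟩
    · rintro ⟨u, hu, rfl⟩
      obtain ⟨k1, k2⟩ := (j3 u).1 hu
      obtain ⟨k3, k4⟩ := (h3 _).1 k1
      exact ⟨k3, List.Forall₂.cons k2 k4⟩
    · rintro ⟨k1, k2⟩
      obtain ⟨d, au, bs⟩ := t
      cases k2 with
      | cons k3 k4 =>
        rename_i b bs
        exact ⟨(d, ((au, bs), b)), (j3 _).2 ⟨(h3 (d, (au, bs))).2 ⟨k1, k4⟩, k3⟩, rfl⟩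

theorem within_matchT {K W M : ℕ} (p : ℕ) (base : List (ℕ × (R × ℕ)))
    (gs : List (List (ℕ × R))) (hb : base.Pairwise fun x y => x.1 < y.1)
    (hbM : base.length ≤ M) (hgM : ∀ g ∈ gs, g.length ≤ M) (hbW : ∀ t ∈ base, t.1.size ≤ W)
    (hgW : ∀ g ∈ gs, ∀ t ∈ g, t.1.size ≤ W) (hp : p.size ≤ K) (hM : M.size ≤ K) (hM1 : 1 ≤ M) :
    (matchT p base gs).Within P 0 0 (M + gs.length * (11 * M * K * opCost K W)) := by
  have h4 := four_le_opCost K W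
  have hK1 : 1 ≤ K := (Nat.size_pos.2 hM1).trans_le hM
  induction gs with
  | nil =>
    refine Timed.Within.mono (within_mapT (m := 0) (r := 0) (b := 0) fun _ _ => within_ret _)
      (by simp) (by simp) (by simpa using hbM)
  | cons g gs ih =>
    have hgM' := hgM g (by simp)
    have hgW' := hgW g (by simp)
    obtain ⟨h1, h2, h3⟩ := matchT_spec p base gs hb
    obtain ⟨s1, s2, s3⟩ := singlesT_spec p g
    obtain ⟨j1, j2, j3⟩ := joinT_spec _ _ h1 s1
    rw [matchT]
    refine Timed.Within.mono (Timed.Within.bind (within_tick 1) (Timed.Within.bindBits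
      (ih (fun g hg => hgM g (by simp [hg])) (fun g hg => hgW g (by simp [hg])))
      (Timed.Within.bindBits (within_singlesT p g hgW' hp
        ((Nat.size_le_size hgM').trans hM) hK1)
      (Timed.Within.bindBits (within_joinT (K := K) (W := W) _ _ ?_ ?_)
        (within_mapT (m := 0) (r := 0) (b := 0) fun _ _ => within_ret _)))))
      (by simp) (by simp) ?_
    · exact fun t ht => hbW _ ((h3 t).1 ht).1
    · rintro ⟨d, u⟩ ht
      obtain ⟨rfl, t, htg, rfl⟩ := of_mem_singlesT ht
      exact (Nat.size_le_size (Nat.mod_le _ _)).trans (hgW' _ htg)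
    · have e1 : 5 * g.length * K * opCost K W ≤ 5 * M * K * opCost K W := by gcongr
      have e2 : ((matchT p base gs).val.length + (singlesT p g).val.length) * (2 * opCost K W) ≤
          (M + M) * (2 * opCost K W) := by gcongr <;> omega
      have e3 : (joinT (matchT p base gs).val (singlesT p g).val).val.length * (0 + 1) ≤ M := by
        omega
      have e4 : M * opCost K W ≤ M * opCost K W * K := Nat.le_mul_of_pos_right _ hK1
      have e5 : M * 4 ≤ M * opCost K W := Nat.mul_le_mul_left _ h4
      simp only [List.length_cons]
      nlinarith

/-! ### Tests -/

theorem exponentsT_of_eq {p : ℕ} (hp : 0 < p) (u : ℕ) (es : List ℕ) :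
    (exponentsT p u (es.map fun e => u + e * p)).val = some es := by
  induction es with
  | nil => rfl
  | cons e es ih =>
    have h1 : u + e * p - u = e * p := by omega
    simp [exponentsT, ih, h1, Nat.mul_div_cancel _ hp]

/-- A partial converse is enough. It fixes the number of exponents and bounds their size; that a
selected term is a correct one is never needed. -/
theorem of_exponentsT {p u : ℕ} {bs es : List ℕ} (h : (exponentsT p u bs).val = some es) :
    List.Forall₂ (fun b e => e ≤ b) bs es := by
  induction bs generalizing es with
  | nil =>
    simp only [exponentsT, Timed.ret_val, Option.some.injEq] at h
    subst h; exact List.Forall₂.nil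
  | cons b bs ih =>
    simp only [exponentsT, Timed.bind_val, leN_val, decide_eq_true_eq] at h
    split_ifs at h
    · simp only [Timed.bind_val, subN_val, divModN_val, eqN_val, decide_eq_true_eq] at h
      split_ifs at h
      · simp only [Timed.bind_val, Timed.ret_val, Option.map_eq_some_iff] at h
        obtain ⟨l, hl, rfl⟩ := h
        exact List.Forall₂.cons ((Nat.div_le_self _ _).trans (Nat.sub_le _ _)) (ih hl)
      · simp at h
    · simp at h

theorem within_exponentsT {K W : ℕ} (p u : ℕ) (bs : List ℕ) (hp : p.size ≤ K)
    (hu : u.size ≤ W) (hb : ∀ b ∈ bs, b.size ≤ W) :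
    (exponentsT p u bs).Within P 0 0 (bs.length * (4 * opCost K W)) := by
  induction bs with
  | nil => exact Timed.Within.monoBits (within_ret _) (by simp)
  | cons b bs ih =>
    have ih := ih fun x hx => hb x (by simp [hx])
    have hbW := hb b (by simp)
    rw [exponentsT]
    refine Timed.Within.monoBits (Timed.Within.bindBits (within_leN (K := K) hu hbW)
      (b' := 3 * opCost K W + bs.length * (4 * opCost K W)) ?_) ?_
    · split_ifs
      · have hx : (subN b u).val.size ≤ W := (Nat.size_le_size (Nat.sub_le _ _)).trans hbW
        refine Timed.Within.monoBits (Timed.Within.bindBits (within_subN (K := K) hbW hu)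
          (Timed.Within.bindBits (within_divModN hx hp)
          (Timed.Within.bindBits (within_eqN (K := K) (W := W) ?_ (by simp))
            (b' := bs.length * (4 * opCost K W)) ?_))) ?_
        · exact (Nat.size_le_size (Nat.mod_le _ _)).trans hx
        · split_ifs
          · exact Timed.Within.bindRet ih
          · exact Timed.Within.monoBits (within_ret _) (by simp)
        · omega
      · exact Timed.Within.monoBits (within_ret _) (by simp)
    · simp only [List.length_cons]; ring_nf; exact le_rfl

theorem testTermT_of_eq {p : ℕ} (hp : 0 < p) {s es : List ℕ} {D : ℕ} (d : ℕ) (a : R)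
    (hD : es.sum ≤ D) :
    (testTermT p s D (d, ((a, dotN es s), es.map fun e => dotN es s + e * p))).val =
      some (es, a) := by
  simp only [testTermT, Timed.bind_val, exponentsT_of_eq hp]
  simp [hD]

/-- The test `u = ∑ e_k s_k` makes the exponent vector determine `u`, and hence the residue class
from which it was recovered. -/
theorem of_testTermT {p D d u : ℕ} {a : R} {s bs : List ℕ} {r : List ℕ × R}
    (h : (testTermT p s D (d, ((a, u), bs))).val = some r) :
    r.1.length = bs.length ∧ dotN r.1 s = u := by
  simp only [testTermT, Timed.bind_val] at h
  cases he : (exponentsT p u bs).val with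
  | none => simp [he] at h
  | some es =>
    simp only [he, Timed.bind_val, dotT_val, eqN_val, decide_eq_true_eq, zero_add] at h
    split_ifs at h with hu
    · simp only [Timed.bind_val, Timed.ret_val] at h
      split_ifs at h
      · simp only [Option.some.injEq] at h
        subst h
        exact ⟨(of_exponentsT he).length_eq.symm, hu.symm⟩
    · simp at h

/-- Before the tests the quotients need not belong to a term of small degree; each is only known to
be at most `Y`. Therefore `hdot` concerns all vectors with such entries. -/
theorem within_testTermT {K W Y n : ℕ} {p D : ℕ} {s : List ℕ} {t : ℕ × ((R × ℕ) × List ℕ)}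
    (hp : p.size ≤ K) (hu : t.2.1.2.size ≤ W) (hn : t.2.2.length = n)
    (hn1 : 1 ≤ n) (hb : ∀ b ∈ t.2.2, b ≤ Y) (hY : Y.size ≤ W) (hD : D.size ≤ W)
    (hs : ∀ a ∈ s, a.size ≤ K)
    (hdot : ∀ es : List ℕ, es.length = n → (∀ e ∈ es, e ≤ Y) →
      (dotN es s).size ≤ W ∧ es.sum.size ≤ W) :
    (testTermT p s D t).Within P 0 0 (9 * n * opCost K W) := by
  rw [testTermT]
  refine Timed.Within.monoBits (Timed.Within.bindBits (within_exponentsT (K := K) (W := W) _ _ _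
    hp hu fun b hbt => (Nat.size_le_size (hb b hbt)).trans hY)
    (b' := (3 * n + 2) * opCost K W) ?_) ?_
  · cases he : (exponentsT p t.2.1.2 t.2.2).val with
    | none => exact Timed.Within.monoBits (within_ret _) (by simp)
    | some es =>
      have hle := of_exponentsT he
      have hlen : es.length = n := hle.length_eq.symm.trans hn
      have heY : ∀ e ∈ es, e ≤ Y := by
        intro e hmem
        obtain ⟨i, hi, rfl⟩ := List.getElem_of_mem hmem
        have := (List.forall₂_iff_get.1 hle).2 i (hle.length_eq ▸ hi) hi
        exact this.trans (hb _ (List.getElem_mem _))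
      obtain ⟨h1, h2⟩ := hdot es hlen heY
      refine Timed.Within.monoBits (Timed.Within.bindBits (within_dotT (K := K) (W := W) 0 es s
        (by simpa using h1) (fun e he => (Nat.size_le_size (heY e he)).trans hY) hs)
        (Timed.Within.bindBits (within_eqN (K := K) (W := W) hu (by simpa using h1))
          (b' := (n + 1) * opCost K W) ?_)) ?_
      · split_ifs
        · refine Timed.Within.monoBits (Timed.Within.bindBits (within_sumT (K := K) (W := W) 0 es
            (by simpa using h2)) (Timed.Within.bindRet (within_leN (K := K) (W := W)
              (by simpa using h2) hD))) ?_
          rw [hlen]; ring_nf; exact le_rfl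
        · exact Timed.Within.monoBits (within_ret _) (by simp)
      · rw [hlen]; ring_nf; exact le_rfl
  · rw [hn]
    have : 1 * opCost K W ≤ n * opCost K W := Nat.mul_le_mul_right _ hn1
    nlinarith

/-! ### The recovered terms -/

variable {p D n : ℕ} {s : List ℕ} {fmod fs : List (ℕ × R)} {gs : List (List (ℕ × R))}

/-- Different records have different residues `d`, and a vector `es` selected from the record of `d`
satisfies `dotN es s % p = d`. So no exponent vector is selected twice. -/
theorem tsTermsT_spec (hfmod : fmod.Pairwise fun x y => x.1 < y.1) (hgs : gs.length = n) :
    (tsTermsT fmod fs gs p s D).val.length ≤ fmod.length ∧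
    (∀ t ∈ (tsTermsT fmod fs gs p s D).val, t.1.length = n) ∧
    ((tsTermsT fmod fs gs p s D).val.map Prod.fst).Nodup := by
  obtain ⟨j1, j2, j3⟩ := joinT_spec fmod (singlesT p fs).val hfmod (singlesT_spec p fs).1
  obtain ⟨m1, m2, m3⟩ := matchT_spec p _ gs j1
  have key : ∀ t ∈ (matchT p (joinT fmod (singlesT p fs).val).val gs).val, ∀ r,
      (testTermT p s D t).val = some r → r.1.length = n ∧ dotN r.1 s % p = t.1 := by
    rintro ⟨d, ⟨a, u⟩, bs⟩ ht r hr
    obtain ⟨h1, h2⟩ := of_testTermT hr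
    obtain ⟨k1, k2⟩ := (m3 _).1 ht
    refine ⟨h1.trans (k2.length_eq.symm.trans hgs), ?_⟩
    rw [h2]
    exact (of_mem_singlesT ((j3 _).1 k1).2).1
  simp only [tsTermsT, Timed.bind_val, filterMapT_val]
  refine ⟨(List.length_filterMap_le _ _).trans (m2.trans j2), fun r hr => ?_, ?_⟩
  · obtain ⟨t, ht, htr⟩ := List.mem_filterMap.1 hr
    exact (key t ht r htr).1
  · rw [List.Nodup, List.pairwise_map, List.pairwise_filterMap]
    refine m1.imp_of_mem fun {x y} hx hy hxy r hr r' hr' heq => ?_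
    have h1 := (key x hx r hr).2
    have h2 := (key y hy r' hr').2
    rw [heq, h2] at h1
    omega

theorem mem_tsTermsT (hfmod : fmod.Pairwise fun x y => x.1 < y.1) (hp : 0 < p)
    {es : List ℕ} {a : R} (ha : (dotN es s % p, a) ∈ fmod)
    (hfs : (dotN es s % p, dotN es s) ∈ (singlesT p fs).val)
    (hgs : List.Forall₂ (fun g e => (dotN es s % p, dotN es s + e * p) ∈ (singlesT p g).val) gs es)
    (hD : es.sum ≤ D) : (es, a) ∈ (tsTermsT fmod fs gs p s D).val := by
  obtain ⟨j1, j2, j3⟩ := joinT_spec fmod (singlesT p fs).val hfmod (singlesT_spec p fs).1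
  obtain ⟨m1, m2, m3⟩ := matchT_spec p _ gs j1
  simp only [tsTermsT, Timed.bind_val, filterMapT_val, List.mem_filterMap]
  refine ⟨_, (m3 (dotN es s % p, ((a, dotN es s), es.map fun e => dotN es s + e * p))).2
    ⟨(j3 (_, (a, dotN es s))).2 ⟨ha, hfs⟩, ?_⟩, testTermT_of_eq hp _ _ hD⟩
  rwa [List.forall₂_map_right_iff]

theorem within_tsTermsT {K W Y M : ℕ} (hfmod : fmod.Pairwise fun x y => x.1 < y.1)
    (hgs : gs.length = n) (hn : 1 ≤ n) (hM : M.size ≤ K) (hM1 : 1 ≤ M) (hp : p.size ≤ K)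
    (hY : Y.size ≤ W) (hD : D.size ≤ W) (hs : ∀ a ∈ s, a.size ≤ K)
    (h1M : fmod.length ≤ M) (h2M : fs.length ≤ M) (h3M : ∀ g ∈ gs, g.length ≤ M)
    (h1Y : ∀ t ∈ fmod, t.1 ≤ Y) (h2Y : ∀ t ∈ fs, t.1 ≤ Y) (h3Y : ∀ g ∈ gs, ∀ t ∈ g, t.1 ≤ Y)
    (hdot : ∀ es : List ℕ, es.length = n → (∀ e ∈ es, e ≤ Y) →
      (dotN es s).size ≤ W ∧ es.sum.size ≤ W) :
    (tsTermsT fmod fs gs p s D).Within P 0 0 (31 * n * M * K * opCost K W) := by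
  have h4 := four_le_opCost K W
  have hK1 : 1 ≤ K := (Nat.size_pos.2 hM1).trans_le hM
  have hYW : ∀ {a}, a ≤ Y → a.size ≤ W := fun h => (Nat.size_le_size h).trans hY
  obtain ⟨s1, s2, s3⟩ := singlesT_spec p fs
  obtain ⟨j1, j2, j3⟩ := joinT_spec fmod (singlesT p fs).val hfmod s1
  obtain ⟨m1, m2, m3⟩ := matchT_spec p _ gs j1
  rw [tsTermsT]
  refine Timed.Within.mono (Timed.Within.bind (within_singlesT p fs (fun t ht => hYW (h2Y t ht)) hp
    ((Nat.size_le_size h2M).trans hM) hK1) (Timed.Within.bindBits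
    (within_joinT (K := K) (W := W) _ _ (fun t ht => hYW (h1Y t ht)) ?_) (Timed.Within.bindBits
    (within_matchT (K := K) (W := W) (M := M) p _ gs j1 (j2.trans h1M) h3M ?_
      (fun g hg t ht => hYW (h3Y g hg t ht)) hp hM hM1)
    (within_filterMapT (m := 0) (r := 0) (b := 9 * n * opCost K W) ?_))))
    (by simp) (by simp) ?_
  · rintro ⟨d, u⟩ ht
    obtain ⟨rfl, t, htf, rfl⟩ := of_mem_singlesT ht
    exact hYW ((Nat.mod_le _ _).trans (h2Y _ htf))
  · exact fun t ht => hYW (h1Y _ ((j3 t).1 ht).1)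
  · intro t ht
    obtain ⟨k1, k2⟩ := (m3 t).1 ht
    refine within_testTermT hp ?_ (k2.length_eq.symm.trans hgs) hn ?_ hY hD hs hdot
    · obtain ⟨-, u, hu, hut⟩ := of_mem_singlesT ((j3 _).1 k1).2
      exact hYW (hut ▸ h2Y _ hu)
    · intro b hb
      obtain ⟨i, hi, rfl⟩ := List.getElem_of_mem hb
      have hi' : i < gs.length := k2.length_eq ▸ hi
      obtain ⟨-, u, hu, hut⟩ := of_mem_singlesT ((List.forall₂_iff_get.1 k2).2 i hi' hi)
      exact hut.symm.le.trans (h3Y _ (List.getElem_mem hi') _ hu)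
  · have e1 : 5 * fs.length * K * opCost K W ≤ 5 * M * K * opCost K W := by gcongr
    have e2 : (fmod.length + (singlesT p fs).val.length) * (2 * opCost K W) ≤
        (M + M) * (2 * opCost K W) := by gcongr; omega
    have e3 : (matchT p (joinT fmod (singlesT p fs).val).val gs).val.length *
        (9 * n * opCost K W + 1) ≤ M * (9 * n * opCost K W + 1) := by gcongr; omega
    have e4 : M * opCost K W ≤ M * opCost K W * K := Nat.le_mul_of_pos_right _ hK1
    have e5 : M * 4 ≤ M * opCost K W := Nat.mul_le_mul_left _ h4
    have e6 : M * opCost K W * K * 1 ≤ M * opCost K W * K * n := Nat.mul_le_mul_left _ hn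
    have e7 : M * opCost K W * n ≤ M * opCost K W * n * K := Nat.le_mul_of_pos_right _ hK1
    rw [hgs]
    nlinarith

end Recovery

end SparseInterp

namespace SparseInterp

open Timed

/-! ### Isolated terms -/

section Isolated

variable {R : Type*} [CommRing R] {n : ℕ}

open scoped Classical in
/-- The exponent vectors of `g` whose images modulo `x^p - 1` under `x_i ↦ x^{s_i}` differ from
those of all other terms of `g`. -/
noncomputable def isolated (g : MvPolynomial (Fin n) R) (p : ℕ) (s : List ℕ) :
    Finset (Fin n →₀ ℕ) :=
  g.support.filter fun e => ∀ e' ∈ g.support, kronExp s e' % p = kronExp s e % p → e' = e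

theorem mem_isolated {g : MvPolynomial (Fin n) R} {p : ℕ} {s : List ℕ} {e : Fin n →₀ ℕ} :
    e ∈ isolated g p s ↔
      e ∈ g.support ∧ ∀ e' ∈ g.support, kronExp s e' % p = kronExp s e % p → e' = e := by
  simp [isolated]

theorem isolated_subset (g : MvPolynomial (Fin n) R) (p : ℕ) (s : List ℕ) :
    isolated g p s ⊆ g.support := fun _ he => (mem_isolated.1 he).1

theorem coeff_kron_of_isolated {g : MvPolynomial (Fin n) R} {p : ℕ} {s : List ℕ}
    {e : Fin n →₀ ℕ} (he : e ∈ isolated g p s) :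
    (kron g s).coeff (kronExp s e) = g.coeff e := by
  rw [mem_isolated] at he
  rw [kron_eq_sum, Polynomial.finsetSum_coeff, Finset.sum_eq_single e]
  · simp
  · intro e' he' hne
    rw [Polynomial.coeff_monomial, if_neg]
    exact fun h => hne (he.2 e' he' (by rw [h]))
  · exact fun h => absurd he.1 h

theorem reduceExp_kron (g : MvPolynomial (Fin n) R) (p : ℕ) (s : List ℕ) :
    reduceExp p (kron g s) =
      ∑ e ∈ g.support, Polynomial.monomial (kronExp s e % p) (g.coeff e) := by
  rw [kron_eq_sum, map_sum]
  exact Finset.sum_congr rfl fun e _ => reduceExp_monomial _ _ _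

theorem coeff_reduceExp_of_isolated {g : MvPolynomial (Fin n) R} {p : ℕ} {s : List ℕ}
    {e : Fin n →₀ ℕ} (he : e ∈ isolated g p s) :
    (reduceExp p (kron g s)).coeff (kronExp s e % p) = g.coeff e := by
  rw [mem_isolated] at he
  rw [reduceExp_kron, Polynomial.finsetSum_coeff, Finset.sum_eq_single e]
  · simp
  · intro e' he' hne
    rw [Polynomial.coeff_monomial, if_neg]
    exact fun h => hne (he.2 e' he' h)
  · exact fun h => absurd he.1 h

theorem support_reduceExp_subset (g : MvPolynomial (Fin n) R) (p : ℕ) (s : List ℕ) :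
    (reduceExp p (kron g s)).support ⊆ g.support.image fun e => kronExp s e % p := by
  classical
  intro d hd
  rw [Polynomial.mem_support_iff, reduceExp_kron, Polynomial.finsetSum_coeff] at hd
  obtain ⟨e, he, h⟩ := Finset.exists_ne_zero_of_sum_ne_zero hd
  rw [Polynomial.coeff_monomial] at h
  exact Finset.mem_image.2 ⟨e, he, by by_contra h'; exact h (if_neg h')⟩

/-- Isolated terms keep their coefficients and have pairwise different residues. -/
theorem card_isolated_le (g : MvPolynomial (Fin n) R) (p : ℕ) (s : List ℕ) :
    (isolated g p s).card ≤ (reduceExp p (kron g s)).support.card := by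
  refine Finset.card_le_card_of_injOn (fun e => kronExp s e % p) ?_ ?_
  · intro e he
    have he : e ∈ isolated g p s := he
    rw [Finset.mem_coe, Polynomial.mem_support_iff, coeff_reduceExp_of_isolated he]
    exact MvPolynomial.mem_support_iff.1 (isolated_subset _ _ _ he)
  · intro e he e' he' h
    exact (mem_isolated.1 he').2 e (isolated_subset _ _ _ he) h

/-- Count by residues. A residue hit by `g` comes either from at least two terms, or from exactly
one term, which is then isolated and is counted twice on the right. -/
theorem two_mul_card_support_reduceExp_le (g : MvPolynomial (Fin n) R) (p : ℕ) (s : List ℕ) :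
    2 * (reduceExp p (kron g s)).support.card ≤ g.support.card + (isolated g p s).card := by
  classical
  set φ : (Fin n →₀ ℕ) → ℕ := fun e => kronExp s e % p with hφ
  have h1 : (reduceExp p (kron g s)).support.card ≤ (g.support.image φ).card :=
    Finset.card_le_card (support_reduceExp_subset g p s)
  have h2 : 2 * (g.support.image φ).card ≤ g.support.card + (isolated g p s).card := by
    have hiso : (isolated g p s).card =
        ∑ d ∈ g.support.image φ, ((isolated g p s).filter fun e => φ e = d).card :=
      Finset.card_eq_sum_card_fiberwise fun e he =>
        Finset.mem_image_of_mem φ (isolated_subset _ _ _ he)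
    have hsup : g.support.card =
        ∑ d ∈ g.support.image φ, (g.support.filter fun e => φ e = d).card :=
      Finset.card_eq_sum_card_fiberwise fun e he => Finset.mem_image_of_mem φ he
    rw [hiso, hsup, ← Finset.sum_add_distrib, mul_comm, ← smul_eq_mul]
    refine Finset.card_nsmul_le_sum _ _ _ fun d hd => ?_
    obtain ⟨e, he, rfl⟩ := Finset.mem_image.1 hd
    have he' : e ∈ g.support.filter fun e' => φ e' = φ e := Finset.mem_filter.2 ⟨he, rfl⟩
    by_cases hs : ∃ e' ∈ g.support, φ e' = φ e ∧ e' ≠ e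
    · obtain ⟨e', h1, h2, h3⟩ := hs
      have : 1 < (g.support.filter fun e' => φ e' = φ e).card :=
        Finset.one_lt_card.2 ⟨e', Finset.mem_filter.2 ⟨h1, h2⟩, e, he', h3⟩
      omega
    · push Not at hs
      have h1 := Finset.card_pos.2 ⟨e, he'⟩
      have h2 : 0 < ((isolated g p s).filter fun e' => φ e' = φ e).card :=
        Finset.card_pos.2 ⟨e, Finset.mem_filter.2 ⟨mem_isolated.2 ⟨he, hs⟩, rfl⟩⟩
      omega
  omega

theorem kronExp_mod_eq {s s' : List ℕ} {p : ℕ} {e : Fin n →₀ ℕ} {c : ℕ}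
    (h : kronExp s' e = kronExp s e + c * p) : kronExp s' e % p = kronExp s e % p := by
  rw [h, Nat.add_mul_mod_self_right]

/-- The shift by `p` in position `k` encodes `e k` in the exponent while leaving its residue modulo
`p`, and with it the set of isolated terms, unchanged. -/
theorem kronExp_modify {s : List ℕ} (hs : s.length = n) (p : ℕ) (k : Fin n) (e : Fin n →₀ ℕ) :
    kronExp (s.modify k fun y => y + p) e = kronExp s e + e k * p := by
  have h : ∀ i : Fin n, (s.modify k fun y => y + p).getD i 0 =
      s.getD i 0 + if i = k then p else 0 := by
    intro i
    have hi : (i : ℕ) < s.length := hs ▸ i.2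
    rw [List.getD_eq_getElem _ _ (by simpa using hi), List.getD_eq_getElem _ _ hi,
      List.getElem_modify]
    by_cases hik : i = k
    · simp [hik]
    · have : (k : ℕ) ≠ i := fun h => hik (Fin.ext h.symm)
      simp [hik, this]
  simp only [kronExp, h, mul_add, Finset.sum_add_distrib]
  simp

theorem isolated_modify (g : MvPolynomial (Fin n) R) {s : List ℕ} (hs : s.length = n) (p : ℕ)
    (k : Fin n) : isolated g p (s.modify k fun y => y + p) = isolated g p s := by
  ext e
  simp only [mem_isolated, kronExp_mod_eq (kronExp_modify hs p k _)]

/-- Every exponent of `g(x^s)` is the image of a term of `g`, and no term other than `e` has an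
image in the residue class of `e`. -/
theorem mem_singlesT_of_isolated {g : MvPolynomial (Fin n) R} {p : ℕ} {s : List ℕ}
    {L : List (ℕ × R)} (hL : IsSparseRep L (kron g s)) {e : Fin n →₀ ℕ}
    (he : e ∈ isolated g p s) : (kronExp s e % p, kronExp s e) ∈ (singlesT p L).val := by
  classical
  have hmem : ∀ v, v ∈ L.map Prod.fst ↔ v ∈ (kron g s).support := by
    intro v; rw [← hL.toFinset_eq, List.mem_toFinset]
  refine mem_singlesT hL.1 ?_ ?_
  · rw [hmem, Polynomial.mem_support_iff, coeff_kron_of_isolated he]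
    exact MvPolynomial.mem_support_iff.1 (isolated_subset _ _ _ he)
  · intro v hv h
    rw [hmem] at hv
    obtain ⟨e', he', rfl⟩ := Finset.mem_image.1 (support_kron_subset g s hv)
    rw [(mem_isolated.1 he).2 e' he' h]

/-- If all isolated terms of `g` are recovered, then the error is bounded by the number of the
other terms. -/
theorem card_support_sub_toMvPoly_le {g : MvPolynomial (Fin n) R} {H : List (List ℕ × R)}
    (hlen : ∀ t ∈ H, t.1.length = n) (hnd : (H.map Prod.fst).Nodup) {I : Finset (Fin n →₀ ℕ)}
    (hI : I ⊆ g.support) (hH : ∀ e ∈ I, ∃ t ∈ H, expVec n t.1 = e ∧ t.2 = g.coeff e) :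
    (g - toMvPoly n H).support.card + 2 * I.card ≤ g.support.card + H.length := by
  classical
  have hnd' := nodup_map_expVec hnd hlen
  set E := (H.map fun t => expVec n t.1).toFinset with hE
  have hEcard : E.card = H.length := by
    rw [hE, List.toFinset_card_of_nodup hnd', List.length_map]
  have hIE : I ⊆ E := by
    intro e he
    obtain ⟨t, ht, hte, -⟩ := hH e he
    exact List.mem_toFinset.2 (List.mem_map.2 ⟨t, ht, hte⟩)
  -- On `I` the coefficients agree. What remains are the terms of `g` outside `I` and the wrongly
  -- selected ones, and `I` is subtracted from both sets.
  have hsub : (g - toMvPoly n H).support ⊆ (g.support \ I) ∪ (E \ I) := by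
    intro e he
    rw [MvPolynomial.mem_support_iff, MvPolynomial.coeff_sub] at he
    have heI : e ∉ I := by
      intro heI
      obtain ⟨t, ht, hte, htc⟩ := hH e heI
      apply he
      rw [← htc, ← hte, coeff_toMvPoly_of_mem hnd' ht, sub_self]
    rw [Finset.mem_union, Finset.mem_sdiff, Finset.mem_sdiff]
    by_cases heg : e ∈ g.support
    · exact Or.inl ⟨heg, heI⟩
    · refine Or.inr ⟨?_, heI⟩
      by_contra heE
      apply he
      rw [MvPolynomial.notMem_support_iff.1 heg, coeff_toMvPoly_of_notMem, sub_self]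
      rwa [hE, List.mem_toFinset] at heE
  have h1 := (Finset.card_le_card hsub).trans (Finset.card_union_le _ _)
  rw [Finset.card_sdiff_of_subset hI, Finset.card_sdiff_of_subset hIE, hEcard] at h1
  have h2 := Finset.card_le_card hI
  have h3 := Finset.card_le_card hIE
  omega

end Isolated

/-! ### The deterministic part of HalfPoly -/

section Deterministic

variable {n : ℕ} {R : Type*} [CommRing R] {S : ℕ → Type*}
  [∀ d, CommRing (S d)] [∀ d, Algebra R (S d)]

/-- The hypotheses on the input of HalfPoly. -/
structure IsInput (B : ∀ d, (Fin n → S d) → S d) (A : ∀ d, (S d → S d) → ℕ → List (ℕ × R))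
    (f fstar : MvPolynomial (Fin n) R) (F : List (List ℕ × R)) (T T₁ D : ℕ) : Prop where
  one_le_n : 1 ≤ n
  blackBox : IsBlackBox B f
  interpolator : IsInterpolator A
  sparseRep : IsMvSparseRep n F fstar
  card_f : f.support.card ≤ T
  card_fstar : fstar.support.card ≤ T
  card_sub : (f - fstar).support.card ≤ T₁
  one_le_T₁ : 1 ≤ T₁
  T₁_le : T₁ ≤ T
  degree_f : f.totalDegree ≤ D
  degree_fstar : fstar.totalDegree ≤ D

variable {B : ∀ d, (Fin n → S d) → S d} {A : ∀ d, (S d → S d) → ℕ → List (ℕ × R)}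
  {f fstar : MvPolynomial (Fin n) R} {F : List (List ℕ × R)} {T T₁ D : ℕ}

theorem IsInput.length_F_le (h : IsInput B A f fstar F T T₁ D) : F.length ≤ T :=
  h.sparseRep.length_le.trans h.card_fstar

theorem IsInput.degree_sub_le (h : IsInput B A f fstar F T T₁ D) :
    (f - fstar).totalDegree ≤ D :=
  (MvPolynomial.totalDegree_sub _ _).trans (max_le h.degree_f h.degree_fstar)

theorem query_spec (h : IsInput B A f fstar F T T₁ D) {s : List ℕ} {d : ℕ}
    (hd : (kron f s).natDegree ≤ d) : IsSparseRep (query B A s d T).val (kron f s) := by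
  have : (fun a => B d fun i : Fin n => a ^ s.getD i 0) =
      fun a => Polynomial.aeval a (kron f s) := by
    funext a
    rw [h.blackBox, aeval_kron]
  simp only [query, this]
  exact h.interpolator _ _ _ hd ((card_support_kron_le _ _).trans h.card_f)

/-- The query `q` respects the bounds that are passed to the interpolation algorithm, and its
degree bound is at most `b`. -/
structure IsAdmissible (f : MvPolynomial (Fin n) R) (T b : ℕ) (q : Query) : Prop where
  natDegree_le : (kron f q.exps).natDegree ≤ q.degBound
  card_le : (kron f q.exps).support.card ≤ q.termBound
  degBound_le : q.degBound ≤ b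
  termBound_le : q.termBound ≤ T

theorem within_query (h : IsInput B A f fstar F T T₁ D) {s : List ℕ} {d b : ℕ}
    (hd : (kron f s).natDegree ≤ d) (hb : d ≤ b) :
    (query B A s d T).Within (IsAdmissible f T b) 1 0 0 := by
  refine ⟨le_rfl, ?_, le_rfl, le_rfl⟩
  intro q hq
  simp only [query, List.mem_singleton] at hq
  subst hq
  exact ⟨hd, (card_support_kron_le _ _).trans h.card_f, hb, le_rfl⟩

theorem IsMvSparseRep.getD_sum_le {L : List (List ℕ × R)} {g : MvPolynomial (Fin n) R}
    (h : IsMvSparseRep n L g) (hD : g.totalDegree ≤ D) {t : List ℕ × R} (ht : t ∈ L) :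
    ∑ i, expVec n t.1 i ≤ D := sum_le_of_mem_support hD (h.mem_support ht)

theorem IsMvSparseRep.dotN_le {L : List (List ℕ × R)} {g : MvPolynomial (Fin n) R}
    (h : IsMvSparseRep n L g) (hD : g.totalDegree ≤ D) {t : List ℕ × R} (ht : t ∈ L)
    {s : List ℕ} (hs : s.length = n) {b : ℕ} (hb : ∀ i < n, s.getD i 0 ≤ b) :
    dotN t.1 s ≤ b * D := by
  rw [dotN_eq_kronExp (h.2.1 t ht).1 hs]
  exact kronExp_le hb (h.getD_sum_le hD ht)

theorem IsMvSparseRep.le_of_mem {L : List (List ℕ × R)} {g : MvPolynomial (Fin n) R}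
    (h : IsMvSparseRep n L g) (hD : g.totalDegree ≤ D) {t : List ℕ × R} (ht : t ∈ L) {e : ℕ}
    (he : e ∈ t.1) : e ≤ D := by
  obtain ⟨i, hi, rfl⟩ := List.getElem_of_mem he
  have hn := (h.2.1 t ht).1
  refine le_trans ?_ (h.getD_sum_le hD ht)
  refine le_trans (le_of_eq ?_) (Finset.single_le_sum (f := fun i => expVec n t.1 i)
    (fun _ _ => Nat.zero_le _) (Finset.mem_univ ⟨i, hn ▸ hi⟩))
  simp [hi]

theorem getD_le {s : List ℕ} {b : ℕ} (h : ∀ a ∈ s, a ≤ b) (i : ℕ) : s.getD i 0 ≤ b := by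
  by_cases hi : i < s.length
  · rw [List.getD_eq_getElem _ _ hi]; exact h _ (List.getElem_mem hi)
  · rw [List.getD_eq_default _ _ (by omega)]; exact Nat.zero_le _

/-- `im` is what is kept of the substitution `(p, s)` of `g`. -/
structure IsImage (g : MvPolynomial (Fin n) R) (p : ℕ) (s : List ℕ) (im : Image R) : Prop where
  p_eq : im.p = p
  s_eq : im.s = s
  norm_eq : im.norm = (maxT 0 s).val
  poly : IsSortedRep im.poly (kron g s)
  polyMod : IsSortedRep im.polyMod (reduceExp p (kron g s))
  count_eq : im.count = (reduceExp p (kron g s)).support.card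

theorem natDegree_kron_maxT_le (hf : f.totalDegree ≤ D) (s : List ℕ) :
    (kron f s).natDegree ≤ (maxT 0 s).val * D :=
  natDegree_kron_le (fun i _ => getD_le (le_maxT 0 s).2 i) hf

theorem toPoly_substT {L : List (List ℕ × R)} {g : MvPolynomial (Fin n) R}
    (h : IsMvSparseRep n L g) {s : List ℕ} (hs : s.length = n) :
    toPoly (L.map fun t => (dotN t.1 s, t.2)) = kron g s := by
  rw [← h.2.2, kron_toMvPoly]
  congr 1
  exact List.map_congr_left fun t ht => by rw [dotN_eq_kronExp (h.2.1 t ht).1 hs]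

theorem imageT_spec [DecidableEq R] (h : IsInput B A f fstar F T T₁ D) {p : ℕ} {s : List ℕ}
    (hs : s.length = n) :
    IsImage (f - fstar) p s (imageT B A F T D (p, s)).val := by
  simp only [imageT, Timed.bind_val, Timed.ret_val, mulN_val, mapT_val, substT_val, List.map_map,
    lengthT_val]
  have hq := query_spec h (natDegree_kron_maxT_le h.degree_f s)
  have hsub := (subPolyT_spec (query B A s ((maxT 0 s).val * D) T).val
    (F.map fun t => (dotN t.1 s, t.2))).1
  rw [toPoly_substT h.sparseRep hs, hq.2.2, ← kron_sub] at hsub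
  have hmod := (modPolyT_spec p (subPolyT (query B A s ((maxT 0 s).val * D) T).val
    (F.map fun t => (dotN t.1 s, t.2))).val).1
  rw [hsub.3] at hmod
  exact ⟨rfl, rfl, rfl, hsub, hmod, hmod.isSparseRep.length_eq⟩

/-- Bounds for the sizes of the numbers that occur, where the primes are at most `X`, and there
are at most `l` substitutions. -/
structure SizeBounds (n T D X l K W : ℕ) : Prop where
  one_le_X : 1 ≤ X
  size_X : (2 * X).size ≤ K
  size_T : (2 * T).size ≤ K
  size_n : n.size ≤ K
  size_l : l.size ≤ K
  K_le : K ≤ W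
  size_D : (n * (2 * X * D) * (2 * X)).size ≤ W

variable {X l K W : ℕ}

theorem SizeBounds.size_mul (hb : SizeBounds n T D X l K W) (hn : 1 ≤ n) :
    (2 * X * D).size ≤ W := by
  refine (Nat.size_le_size ?_).trans hb.size_D
  have := hb.one_le_X
  calc 2 * X * D = 1 * (2 * X * D) * 1 := by ring
    _ ≤ _ := by gcongr; omega

theorem SizeBounds.size_le_of_le (hb : SizeBounds n T D X l K W) (hn : 1 ≤ n) {a : ℕ}
    (ha : a ≤ 2 * X * D) : a.size ≤ W := (Nat.size_le_size ha).trans (hb.size_mul hn)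

theorem SizeBounds.size_D' (hb : SizeBounds n T D X l K W) (hn : 1 ≤ n) : D.size ≤ W := by
  refine hb.size_le_of_le hn ?_
  have := hb.one_le_X
  exact Nat.le_mul_of_pos_left _ (by omega)

/-- The `n` candidate exponents are at most `2 * X * D` each, and the entries of `s` at most `X`.
This is the largest number that is ever computed, and the reason for the form of `size_D`. -/
theorem SizeBounds.size_dotN (hb : SizeBounds n T D X l K W) {s : List ℕ}
    (hs : s.length = n) (hsX : ∀ a ∈ s, a ≤ X) {es : List ℕ} (hes : es.length = n)
    (he : ∀ e ∈ es, e ≤ 2 * X * D) : (dotN es s).size ≤ W ∧ es.sum.size ≤ W := by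
  have hX := hb.one_le_X
  constructor
  · refine (Nat.size_le_size ?_).trans hb.size_D
    rw [dotN_eq_sum n es s hes hs]
    calc ∑ i : Fin n, es.getD i 0 * s.getD i 0 ≤ ∑ _i : Fin n, (2 * X * D) * (2 * X) :=
          Finset.sum_le_sum fun i _ => Nat.mul_le_mul (getD_le he i)
            ((getD_le hsX i).trans (by omega))
      _ = _ := by simp [mul_assoc]
  · refine (Nat.size_le_size ?_).trans hb.size_D
    calc es.sum ≤ es.length • (2 * X * D) := List.sum_le_card_nsmul es _ he
      _ ≤ _ := by rw [hes, smul_eq_mul]; exact Nat.le_mul_of_pos_right _ (by omega)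

theorem IsSparseRep.le_of_mem {L : List (ℕ × R)} {g : MvPolynomial (Fin n) R} {s : List ℕ}
    (h : IsSparseRep L (kron g s)) (hg : g.totalDegree ≤ D) {b : ℕ}
    (hs : ∀ i < n, s.getD i 0 ≤ b) {t : ℕ × R} (ht : t ∈ L) : t.1 ≤ b * D := by
  refine kronExp_le_of_mem_support hs hg ?_
  rw [← h.toFinset_eq]
  exact List.mem_toFinset.2 (List.mem_map_of_mem ht)

/-- Both `f(x^s)` and the image of `fstar` have at most `T` terms. The subtraction takes `2 * (2T)`
ring operations and the reduction at most `2T`. In multiples of `n * T * K * opCost K W`, the bit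
operations are `1 + 1 + 3 + 1 + 8 + 10 + 2 = 26`, in the order of the algorithm. -/
theorem within_imageT [DecidableEq R] (h : IsInput B A f fstar F T T₁ D) (hb : SizeBounds n T D X l K W)
    {p : ℕ} {s : List ℕ} (hs : s.length = n) (hp : p ≤ X) (hsX : ∀ a ∈ s, a ≤ X) :
    (imageT B A F T D (p, s)).Within (IsAdmissible f T (2 * X * D)) 1 (6 * T)
      (26 * n * T * K * opCost K W) := by
  have hn := h.one_le_n
  have hX := hb.one_le_X
  have hT1 : 1 ≤ T := h.one_le_T₁.trans h.T₁_le
  have hK1 : 1 ≤ K := (Nat.size_pos.2 (by omega)).trans_le hb.size_X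
  have h4 := four_le_opCost K W
  have hm : (maxT 0 s).val ≤ X := maxT_le (Nat.zero_le _) hsX
  have hXK : X.size ≤ K := (Nat.size_le_size (by omega)).trans hb.size_X
  have hmD : (maxT 0 s).val * D ≤ 2 * X * D := Nat.mul_le_mul_right _ (by omega)
  have hq := query_spec h (natDegree_kron_maxT_le h.degree_f s)
  have hsX' : ∀ i < n, s.getD i 0 ≤ 2 * X := fun i _ => (getD_le hsX i).trans (by omega)
  have hF := h.length_F_le
  have hdot : ∀ t ∈ F, (dotN t.1 s).size ≤ W := fun t ht =>
    hb.size_le_of_le hn (h.sparseRep.dotN_le h.degree_fstar ht hs hsX')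
  have hQ : (mapT (fun t : ℕ × (List ℕ × R) => ret (t.1, t.2.2)) (substT F s).val).val =
      F.map fun t => (dotN t.1 s, t.2) := by simp [substT_val]
  have hPlen : (query B A s ((maxT 0 s).val * D) T).val.length ≤ T := by
    rw [hq.length_eq]; exact (card_support_kron_le _ _).trans h.card_f
  have hsub := subPolyT_spec (query B A s ((maxT 0 s).val * D) T).val
    (F.map fun t => (dotN t.1 s, t.2))
  rw [toPoly_substT h.sparseRep hs, hq.2.2, ← kron_sub, List.length_map] at hsub
  have hmod := modPolyT_spec p (subPolyT (query B A s ((maxT 0 s).val * D) T).val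
    (F.map fun t => (dotN t.1 s, t.2))).val
  rw [imageT]
  refine Timed.Within.mono (Timed.Within.bind (within_maxT (K := K) (W := W) 0 s
    (hXK.trans hb.K_le) (Nat.zero_le _) hsX)
    (Timed.Within.bind (within_mulN_left (K := K) ((Nat.size_le_size hm).trans hXK)
      (hb.size_D' hn))
    (Timed.Within.bind (within_query h (natDegree_kron_maxT_le h.degree_f s) hmD)
    (Timed.Within.bind (within_substT (K := K) (W := W) F s (fun t ht =>
      ⟨(h.sparseRep.2.1 t ht).1, hdot t ht, fun e he => (Nat.size_le_size
        (h.sparseRep.le_of_mem h.degree_fstar ht he)).trans (hb.size_D' hn)⟩)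
      (fun a ha => (Nat.size_le_size (hsX a ha)).trans hXK) hn)
    (Timed.Within.bind (within_mapT (m := 0) (r := 0) (b := 0) fun _ _ => within_ret _)
    (Timed.Within.bind (within_subPolyT (K := K) (W := W) _ _ ?_ ?_ ?_ hK1)
    (Timed.Within.bind (within_modPolyT (K := K) (W := W) _ _ ?_ ?_ ?_ hK1)
    (Timed.Within.bindRet (within_lengthT (K := K) (W := W) _ ?_ (hK1.trans hb.K_le))))))))))
    ?_ ?_ ?_
  · exact fun t ht => hb.size_le_of_le hn (hq.le_of_mem h.degree_f hsX' ht)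
  · rw [hQ]
    intro t ht
    obtain ⟨u, hu, rfl⟩ := List.mem_map.1 ht
    exact hdot u hu
  · rw [hQ, List.length_map]
    exact (Nat.size_le_size (by simp only [mulN_val]; omega)).trans hb.size_T
  · rw [hQ]
    exact fun t ht => hb.size_le_of_le hn
      (hsub.1.isSparseRep.le_of_mem h.degree_sub_le hsX' ht)
  · exact (Nat.size_le_size hp).trans hXK
  · rw [hQ]
    exact (Nat.size_le_size (by simp only [mulN_val]; omega)).trans hb.size_T
  · rw [hQ]
    exact (Nat.size_le_size (by simp only [mulN_val]; omega)).trans (hb.size_T.trans hb.K_le)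
  · simp
  · rw [hQ]
    simp only [mulN_val, List.length_map]
    omega
  · rw [hQ]
    simp only [mulN_val, List.length_map, hs, substT_val]
    have hnT : 1 ≤ n * T := Nat.mul_pos hn hT1
    have hO : 1 ≤ opCost K W := by omega
    set O := opCost K W with hOdef
    have e1 : n * O ≤ n * T * K * O := by
      calc n * O = n * 1 * 1 * O := by ring
        _ ≤ _ := by gcongr
    have e2 : O ≤ n * T * K * O := by
      calc O = 1 * 1 * 1 * O := by ring
        _ ≤ _ := by gcongr
    have e3 : 3 * F.length * n * O ≤ 3 * (n * T * K * O) := by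
      calc 3 * F.length * n * O ≤ 3 * T * n * O := by gcongr
        _ = 3 * (n * T * 1 * O) := by ring
        _ ≤ _ := by gcongr
    have e4 : F.length * (0 + 1) ≤ n * T * K * O := by
      calc F.length * (0 + 1) ≤ 1 * T * 1 * 1 := by omega
        _ ≤ _ := by gcongr
    have hgen : ∀ m, m ≤ 2 * T → ∀ c, c * m * K * O ≤ 2 * c * (n * T * K * O) := by
      intro m hm c
      calc c * m * K * O ≤ c * (2 * T) * K * O := by gcongr
        _ = 2 * c * (1 * T * K * O) := by ring
        _ ≤ _ := by gcongr
    have e5 := hgen _ (show (query B A s ((maxT 0 s).val * D) T).val.length + F.length ≤ 2 * T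
      by omega) 4
    have e6 := hgen _ (show (subPolyT (query B A s ((maxT 0 s).val * D) T).val
      (F.map fun t => (dotN t.1 s, t.2))).val.length ≤ 2 * T by omega) 5
    have e7 : (modPolyT p (subPolyT (query B A s ((maxT 0 s).val * D) T).val
      (F.map fun t => (dotN t.1 s, t.2))).val).val.length * O ≤ 2 * (n * T * K * O) := by
      calc _ ≤ (2 * T) * O := by gcongr; omega
        _ = 2 * (1 * T * 1 * O) := by ring
        _ ≤ _ := by gcongr
    linarith

/-! ### The best image and the shifted substitutions -/

theorem bestT_spec {α : Type*} (i : Image α) (L : List (Image α)) :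
    (bestT i L).val ∈ i :: L ∧ ∀ j ∈ i :: L, j.count ≤ (bestT i L).val.count := by
  induction L generalizing i with
  | nil => simp [bestT]
  | cons j L ih =>
    simp only [bestT, Timed.bind_val, leN_val, decide_eq_true_eq]
    split_ifs with hc
    · obtain ⟨h1, h2⟩ := ih i
      refine ⟨?_, fun k hk => ?_⟩
      · rcases List.mem_cons.1 h1 with h | h
        · rw [h]; simp
        · simp [h]
      · rcases List.mem_cons.1 hk with rfl | hk
        · exact h2 _ (by simp)
        · rcases List.mem_cons.1 hk with rfl | hk
          · exact hc.trans (h2 i (by simp))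
          · exact h2 k (by simp [hk])
    · obtain ⟨h1, h2⟩ := ih j
      refine ⟨List.mem_cons_of_mem _ h1, fun k hk => ?_⟩
      rcases List.mem_cons.1 hk with rfl | hk
      · exact (by omega : k.count ≤ j.count).trans (h2 j (by simp))
      · exact h2 k hk

theorem within_bestT {α : Type*} {P : Query → Prop} (i : Image α) (L : List (Image α))
    (h : ∀ j ∈ i :: L, j.count.size ≤ W) :
    (bestT i L).Within P 0 0 (L.length * opCost K W) := by
  induction L generalizing i with
  | nil => exact Timed.Within.monoBits (within_ret _) (by simp)
  | cons j L ih =>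
    rw [bestT]
    have h1 := h i (by simp)
    have h2 := h j (by simp)
    have h3 : ∀ k ∈ L, k.count.size ≤ W := fun k hk => h k (by simp [hk])
    refine Timed.Within.monoBits (Timed.Within.bindBits (within_leN (K := K) h2 h1)
      (b' := L.length * opCost K W) ?_) ?_
    · split_ifs
      · exact ih i (by simpa using ⟨h1, h3⟩)
      · exact ih j (by simpa using ⟨h2, h3⟩)
    · simp only [List.length_cons]; ring_nf; exact le_rfl

theorem polySubsT_val {α : Type*} (L : List (List ℕ × α)) (s : List ℕ) (p : ℕ) :
    (polySubsT n L s p).val = (List.range n).map fun k =>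
      L.map fun t => (dotN t.1 s + t.1.getD k 0 * p, t.2) := by
  simp [polySubsT, substT_val, Function.comp_def]

theorem toPoly_polySubsT {L : List (List ℕ × R)} {g : MvPolynomial (Fin n) R}
    (h : IsMvSparseRep n L g) {s : List ℕ} (hs : s.length = n) (p : ℕ) {k : ℕ} (hk : k < n) :
    toPoly (L.map fun t => (dotN t.1 s + t.1.getD k 0 * p, t.2)) =
      kron g (s.modify k fun y => y + p) := by
  rw [← h.2.2, kron_toMvPoly]
  congr 1
  refine List.map_congr_left fun t ht => ?_
  rw [dotN_eq_kronExp (h.2.1 t ht).1 hs, kronExp_modify hs p ⟨k, hk⟩, expVec_apply]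

theorem within_polySubsT (h : IsInput B A f fstar F T T₁ D) (hb : SizeBounds n T D X l K W)
    {P : Query → Prop} {p : ℕ} {s : List ℕ} (hs : s.length = n) (hp : p ≤ X)
    (hsX : ∀ a ∈ s, a ≤ X) :
    (polySubsT n F s p).Within P 0 0 (8 * n * T * opCost K W) := by
  have hn := h.one_le_n
  have hX := hb.one_le_X
  have hT1 : 1 ≤ T := h.one_le_T₁.trans h.T₁_le
  have h4 := four_le_opCost K W
  have hXK : X.size ≤ K := (Nat.size_le_size (by omega)).trans hb.size_X
  have hF := h.length_F_le
  have hdot : ∀ t ∈ F, (dotN t.1 s).size ≤ W := fun t ht =>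
    hb.size_le_of_le hn (h.sparseRep.dotN_le h.degree_fstar ht hs
      fun i _ => (getD_le hsX i).trans (by omega))
  have hle : ∀ t ∈ F, ∀ e ∈ t.1, e ≤ D := fun t ht e he =>
    h.sparseRep.le_of_mem h.degree_fstar ht he
  rw [polySubsT]
  refine Timed.Within.mono (Timed.Within.bind (within_substT (K := K) (W := W) F s (fun t ht =>
      ⟨(h.sparseRep.2.1 t ht).1, hdot t ht, fun e he => (Nat.size_le_size
        (hle t ht e he)).trans (hb.size_D' hn)⟩)
      (fun a ha => (Nat.size_le_size (hsX a ha)).trans hXK) hn)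
    (within_mapT (m := 0) (r := 0) (b := 4 * T * opCost K W) fun k hk => ?_))
    (by simp) (by simp) ?_
  · refine Timed.Within.mono (within_mapT (m := 0) (r := 0) (b := 3 * opCost K W) fun t ht => ?_)
      (by simp) (by simp) ?_
    · rw [substT_val] at ht
      obtain ⟨u, hu, rfl⟩ := List.mem_map.1 ht
      have hek : u.1.getD k 0 ≤ D := getD_le (hle u hu) k
      refine Timed.Within.monoBits (Timed.Within.bindBits (within_readN (K := K) (W := W) _ ?_)
        (Timed.Within.bindBits (within_mulN_right (K := K) (W := W) ?_ ?_)
        (Timed.Within.bindRet (within_addN (K := K) (W := W) (hdot u hu) ?_)))) ?_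
      · exact (Nat.size_le_size (List.mem_range.1 hk).le).trans (hb.size_n.trans hb.K_le)
      · exact (Nat.size_le_size hek).trans (hb.size_D' hn)
      · exact (Nat.size_le_size hp).trans hXK
      · refine hb.size_le_of_le hn ?_
        simp only [readN_val, mulN_val]
        calc u.1.getD k 0 * p ≤ D * (2 * X) := Nat.mul_le_mul hek (by omega)
          _ = _ := by ring
      · omega
    · rw [substT_val, List.length_map]
      calc F.length * (3 * opCost K W + 1) ≤ T * (4 * opCost K W) :=
            Nat.mul_le_mul hF (by omega)
        _ = _ := by ring
  · rw [List.length_range]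
    have e1 : 3 * F.length * n * opCost K W ≤ 3 * T * n * opCost K W := by gcongr
    have e2 : n * 1 ≤ n * (T * opCost K W) :=
      Nat.mul_le_mul_left _ (Nat.mul_pos hT1 (by omega))
    nlinarith

/-- Only the entry `k` of `s` grows, so `max im.norm (s_k + p)` is the norm of `s + p I_k`. The
bound on the degree is stated too because the query has to be admissible. -/
theorem shiftedT_spec [DecidableEq R] (h : IsInput B A f fstar F T T₁ D) {p : ℕ} {s : List ℕ} {im : Image R}
    (him : IsImage (f - fstar) p s im) (hs : s.length = n) {k : ℕ} (hk : k < n) :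
    IsSortedRep (shiftedT B A T D im
        (k, F.map fun t => (dotN t.1 s + t.1.getD k 0 * p, t.2))).val
      (kron (f - fstar) (s.modify k fun y => y + p)) ∧
    (kron f (s.modify k fun y => y + p)).natDegree ≤ max im.norm (s.getD k 0 + p) * D := by
  have hdeg : (kron f (s.modify k fun y => y + p)).natDegree ≤
      max im.norm (s.getD k 0 + p) * D := by
    refine natDegree_kron_le (fun i hi => ?_) h.degree_f
    rw [List.getD_eq_getElem _ _ (by simpa [hs] using hi), List.getElem_modify, him.norm_eq]
    split_ifs with hik
    · subst hik
      rw [List.getD_eq_getElem _ _ (by omega)]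
      exact le_max_right _ _
    · exact ((le_maxT 0 s).2 _ (List.getElem_mem _)).trans (le_max_left _ _)
  refine ⟨?_, hdeg⟩
  have hq := query_spec h hdeg
  have hsub := (subPolyT_spec (query B A (s.modify k fun y => y + p)
    (max im.norm (s.getD k 0 + p) * D) T).val
    (F.map fun t => (dotN t.1 s + t.1.getD k 0 * p, t.2))).1
  rw [toPoly_polySubsT h.sparseRep hs p hk, hq.2.2, ← kron_sub] at hsub
  simp only [shiftedT, Timed.bind_val, readN_val, addN_val, maxN_val, mulN_val, him.p_eq, him.s_eq]
  exact hsub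

theorem getD_modify_le {s : List ℕ} (hsX : ∀ a ∈ s, a ≤ X) {p : ℕ} (hp : p ≤ X) (k i : ℕ) :
    (s.modify k fun y => y + p).getD i 0 ≤ 2 * X := by
  refine getD_le (fun a ha => ?_) i
  obtain ⟨j, hj, rfl⟩ := List.getElem_of_mem ha
  rw [List.getElem_modify]
  have := hsX _ (List.getElem_mem (l := s) (n := j) (by simpa using hj))
  split_ifs <;> omega

theorem within_shiftedT [DecidableEq R] (h : IsInput B A f fstar F T T₁ D) (hb : SizeBounds n T D X l K W)
    {p : ℕ} {s : List ℕ} {im : Image R}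
    (him : IsImage (f - fstar) p s im) (hs : s.length = n) (hp : p ≤ X) (hsX : ∀ a ∈ s, a ≤ X)
    {k : ℕ} (hk : k < n) :
    (shiftedT B A T D im (k, F.map fun t => (dotN t.1 s + t.1.getD k 0 * p, t.2))).Within
      (IsAdmissible f T (2 * X * D)) 1 (4 * T) (12 * T * K * opCost K W) := by
  have hn := h.one_le_n
  have hX := hb.one_le_X
  have hT1 : 1 ≤ T := h.one_le_T₁.trans h.T₁_le
  have hK1 : 1 ≤ K := (Nat.size_pos.2 (by omega)).trans_le hb.size_X
  have hF := h.length_F_le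
  have h4 := four_le_opCost K W
  have hdeg := (shiftedT_spec h him hs hk).2
  have hq := query_spec h hdeg
  have hXW : ∀ {a}, a ≤ 2 * X → a.size ≤ W := fun ha =>
    (Nat.size_le_size ha).trans (hb.size_X.trans hb.K_le)
  have hsk : s.getD k 0 ≤ X := getD_le hsX k
  have hnorm : im.norm ≤ X := by rw [him.norm_eq]; exact maxT_le (Nat.zero_le _) hsX
  have hmod := fun i (_ : i < n) => getD_modify_le hsX hp k i
  rw [shiftedT]
  simp only [him.p_eq, him.s_eq]
  have hPlen : (query B A (s.modify k fun y => y + p)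
      (max im.norm (s.getD k 0 + p) * D) T).val.length ≤ T := by
    rw [hq.length_eq]; exact (card_support_kron_le _ _).trans h.card_f
  refine Timed.Within.mono (Timed.Within.bind (within_readN (K := K) (W := W) _ ?_)
    (Timed.Within.bind (within_addN (K := K) (W := W) ?_ ?_)
    (Timed.Within.bind (within_maxN (K := K) (W := W) ?_ ?_)
    (Timed.Within.bind (within_mulN_left (K := K) (W := W) ?_ (hb.size_D' hn))
    (Timed.Within.bind (within_query h hdeg ?_)
    (within_subPolyT (K := K) (W := W) _ _ ?_ ?_ ?_ hK1)))))) ?_ ?_ ?_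
  · exact (Nat.size_le_size hk.le).trans (hb.size_n.trans hb.K_le)
  · exact hXW (by simp only [readN_val]; omega)
  · exact hXW (by omega)
  · exact hXW (by omega)
  · exact hXW (by simp only [readN_val, addN_val]; omega)
  · refine (Nat.size_le_size (n := 2 * X) ?_).trans hb.size_X
    exact max_le (by omega) (by simp only [readN_val, addN_val]; omega)
  · exact Nat.mul_le_mul_right D (max_le (by omega) (by simp only [readN_val, addN_val]; omega))
  · exact fun t ht => hb.size_le_of_le hn (hq.le_of_mem h.degree_f hmod ht)
  · intro t ht
    obtain ⟨u, hu, rfl⟩ := List.mem_map.1 ht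
    refine hb.size_le_of_le hn ?_
    have hd : dotN u.1 s + u.1.getD k 0 * p =
        kronExp (s.modify k fun y => y + p) (expVec n u.1) := by
      rw [kronExp_modify hs p ⟨k, hk⟩, dotN_eq_kronExp (h.sparseRep.2.1 u hu).1 hs, expVec_apply]
    simp only [hd]
    exact kronExp_le hmod (h.sparseRep.getD_sum_le h.degree_fstar hu)
  · rw [List.length_map]
    exact (Nat.size_le_size (Nat.add_le_add hPlen hF |>.trans (by omega))).trans hb.size_T
  · simp
  · rw [List.length_map]
    have : (query B A (s.modify k fun y => y + p)
      (max im.norm (s.getD k 0 + p) * D) T).val.length + F.length ≤ 2 * T := by omega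
    calc _ ≤ 0 + (0 + (0 + (0 + (0 + 2 * (2 * T))))) := by gcongr; exact this
      _ = 4 * T := by ring
  · rw [List.length_map]
    have : (query B A (s.modify k fun y => y + p)
      (max im.norm (s.getD k 0 + p) * D) T).val.length + F.length ≤ 2 * T := by omega
    have e1 : opCost K W ≤ T * K * opCost K W :=
      Nat.le_mul_of_pos_left _ (Nat.mul_pos hT1 hK1)
    calc _ ≤ opCost K W + (opCost K W + (opCost K W + (opCost K W +
          (0 + 4 * (2 * T) * K * opCost K W)))) := by gcongr; exact this
      _ ≤ _ := by linarith

end Deterministic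

end SparseInterp

namespace SparseInterp

open Timed

/-! ### Correctness and cost of everything after the random choices -/

section Recover

variable {n : ℕ} {R : Type*} [CommRing R] [DecidableEq R] {S : ℕ → Type*}
  [∀ d, CommRing (S d)] [∀ d, Algebra R (S d)] {B : ∀ d, (Fin n → S d) → S d}
  {A : ∀ d, (S d → S d) → ℕ → List (ℕ × R)} {f fstar : MvPolynomial (Fin n) R}
  {F : List (List ℕ × R)} {T T₁ D X l K W : ℕ}

theorem mapT_shiftedT_val {S : ℕ → Type*} [∀ d, CommRing (S d)] {B : ∀ d, (Fin n → S d) → S d}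
    {A : ∀ d, (S d → S d) → ℕ → List (ℕ × R)} (p : ℕ) (s : List ℕ) (im : Image R) :
    (mapT (shiftedT B A T D im) ((List.range n).zip (polySubsT n F s p).val)).val =
      (List.range n).map fun k => (shiftedT B A T D im
        (k, F.map fun t => (dotN t.1 s + t.1.getD k 0 * p, t.2))).val := by
  rw [polySubsT_val, mapT_val]
  refine List.ext_getElem (by simp) fun i h1 h2 => ?_
  simp

/-- With `t` terms of `g`, of which `i` are isolated, and `c = im.count`, at most `c` terms are
selected. So the error is at most `t + c - 2i`, and `2c ≤ t + i` turns this into `3 (t - c)`. The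
unknown `i` has been eliminated in favour of the observable `c`. -/
theorem sub_recovered_le (h : IsInput B A f fstar F T T₁ D) {p : ℕ} {s : List ℕ} {im : Image R}
    (him : IsImage (f - fstar) p s im) (hs : s.length = n) (hp : 0 < p) :
    ((f - fstar) - toMvPoly n (tsTermsT im.polyMod im.poly
      (mapT (shiftedT B A T D im) ((List.range n).zip (polySubsT n F s p).val)).val
      p s D).val).support.card ≤ 3 * ((f - fstar).support.card - im.count) := by
  rw [mapT_shiftedT_val]
  set g := f - fstar with hg
  set gs := (List.range n).map fun k => (shiftedT B A T D im
        (k, F.map fun t => (dotN t.1 s + t.1.getD k 0 * p, t.2))).val with hgs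
  have hgsn : gs.length = n := by simp [hgs]
  obtain ⟨h1, h2, h3⟩ := tsTermsT_spec (p := p) (D := D) (s := s) (fs := im.poly)
    him.polyMod.pairwise hgsn
  have key := card_support_sub_toMvPoly_le h2 h3 (isolated_subset g p s) ?_
  · have e1 := card_isolated_le g p s
    have e2 := two_mul_card_support_reduceExp_le g p s
    rw [him.polyMod.isSparseRep.length_eq] at h1
    rw [him.count_eq]
    omega
  · intro e he
    have hvec : expVec n (List.ofFn e) = e := by
      ext i
      rw [expVec_apply, List.getD_eq_getElem _ _ (by simp)]
      simp
    have hdot : dotN (List.ofFn e) s = kronExp s e := by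
      rw [dotN_eq_kronExp (by simp) hs, hvec]
    -- An isolated `e` has the record with exponent `kronExp s e` in `g(x^s)` and `kronExp s e + e_k
    -- p` in the `k`-th shifted image.
    refine ⟨(List.ofFn e, g.coeff e), mem_tsTermsT him.polyMod.pairwise hp ?_ ?_ ?_ ?_, hvec, rfl⟩
    · rw [hdot, him.polyMod.isSparseRep.mem_iff, coeff_reduceExp_of_isolated he]
      exact ⟨MvPolynomial.mem_support_iff.1 (isolated_subset _ _ _ he), rfl⟩
    · rw [hdot]
      exact mem_singlesT_of_isolated him.poly.isSparseRep he
    · rw [hdot, List.forall₂_iff_get]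
      refine ⟨by simp [hgs], fun i hi hi' => ?_⟩
      have hin : i < n := by simpa [hgs] using hi
      have hspec := (shiftedT_spec h him hs hin).1
      have := mem_singlesT_of_isolated (L := gs.get ⟨i, hi⟩) (p := p) (e := e)
        (by simpa [hgs] using hspec.isSparseRep) ((isolated_modify g hs p ⟨i, hin⟩).symm ▸ he)
      rw [kronExp_modify hs p ⟨i, hin⟩ e, Nat.add_mul_mod_self_right] at this
      simpa using this
    · rw [List.sum_ofFn]
      exact sum_le_of_mem_support h.degree_sub_le (isolated_subset _ _ _ he)

/-- One good pair in the sample suffices: the best image has at least as many terms as the image of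
that pair, hence at least as many as that pair isolates. The exit with failure is excluded, as no
image has more terms than `g`. -/
theorem recoverT_spec (h : IsInput B A f fstar F T T₁ D) {subs : List (ℕ × List ℕ)}
    (hsubs : ∀ x ∈ subs, 0 < x.1 ∧ x.2.length = n)
    (hex : ∃ x ∈ subs, 6 * ((f - fstar).support.card - (isolated (f - fstar) x.1 x.2).card) ≤ T₁) :
    ∃ H, (recoverT B A F T T₁ D subs).val = some H ∧
      ((f - fstar) - toMvPoly n H).support.card ≤ T₁ / 2 := by
  obtain ⟨x, hx, hxT⟩ := hex
  have hx' := mem_dedupT hx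
  have hims : ∀ im ∈ (mapT (imageT B A F T D) (dedupT subs).val).val,
      ∃ p s, IsImage (f - fstar) p s im ∧ 0 < p ∧ s.length = n := by
    intro im him
    rw [mapT_val] at him
    obtain ⟨y, hy, rfl⟩ := List.mem_map.1 him
    have := hsubs y (dedupT_subset _ hy)
    exact ⟨y.1, y.2, imageT_spec h this.2, this⟩
  have hxim : (imageT B A F T D x).val ∈ (mapT (imageT B A F T D) (dedupT subs).val).val := by
    rw [mapT_val]; exact List.mem_map_of_mem (f := fun a => (imageT B A F T D a).val) hx'
  simp only [recoverT, Timed.bind_val]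
  revert hims hxim
  generalize (mapT (imageT B A F T D) (dedupT subs).val).val = L
  intro hims hxim
  cases L with
  | nil => simp at hxim
  | cons i L =>
    obtain ⟨hb1, hb2⟩ := bestT_spec i L
    obtain ⟨p, s, him, hp, hs⟩ := hims _ hb1
    have hcx := hb2 _ hxim
    set im := (bestT i L).val with him_def
    have hxim' := imageT_spec (p := x.1) (s := x.2) h (hsubs x hx).2
    have e1 := card_isolated_le (f - fstar) x.1 x.2
    rw [← hxim'.count_eq] at e1
    have e2 : im.count ≤ (f - fstar).support.card := by
      rw [him.count_eq]
      exact (Finset.card_le_card (support_reduceExp_subset _ _ _)).trans Finset.card_image_le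
    simp only [Timed.bind_val, ← him_def, leN_val, decide_eq_true_eq,
      if_pos (e2.trans h.card_sub), Timed.ret_val, Option.some.injEq, exists_eq_left']
    have := sub_recovered_le h him hs hp
    rw [him.p_eq, him.s_eq]
    refine this.trans ?_
    have hc : (f - fstar).support.card - im.count ≤
        (f - fstar).support.card - (isolated (f - fstar) x.1 x.2).card :=
      Nat.sub_le_sub_left (e1.trans hcx) _
    omega

theorem within_recoverT (h : IsInput B A f fstar F T T₁ D) (hb : SizeBounds n T D X l K W)
    {subs : List (ℕ × List ℕ)} (hl : subs.length ≤ l)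
    (hsubs : ∀ x ∈ subs, x.1 ≤ X ∧ x.2.length = n ∧ ∀ a ∈ x.2, a ≤ X) :
    (recoverT B A F T T₁ D subs).Within (IsAdmissible f T (2 * X * D)) (l + n)
      (6 * l * T + 4 * n * T) (130 * (l + 1) * n * T * K * opCost K W) := by
  have hn := h.one_le_n
  have hX := hb.one_le_X
  have hT1 : 1 ≤ T := h.one_le_T₁.trans h.T₁_le
  have hK1 : 1 ≤ K := (Nat.size_pos.2 (by omega)).trans_le hb.size_X
  have h4 := four_le_opCost K W
  have hXK : X.size ≤ K := (Nat.size_le_size (by omega)).trans hb.size_X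
  have hXW : ∀ {a}, a ≤ X → a.size ≤ W := fun ha =>
    (Nat.size_le_size ha).trans (hXK.trans hb.K_le)
  have hTW : ∀ {a}, a ≤ 2 * T → a.size ≤ W := fun ha =>
    (Nat.size_le_size ha).trans (hb.size_T.trans hb.K_le)
  set O := opCost K W with hO
  -- Common unit of account. Each pair costs at most `12 + 27 + 1` units for removing repetitions,
  -- its image and the comparison of counts. The final recovery costs at most `8 + 12 + 1 + 62`
  -- units, and the test against `T₁` one more.
  set U := n * T * K * O with hU
  have hnT : 1 ≤ n * T := Nat.mul_pos hn hT1
  have hOU : O ≤ U := by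
    calc O = 1 * 1 * O := by ring
      _ ≤ _ := by rw [hU]; gcongr
  have hnU : n * K * O ≤ U := by
    calc n * K * O = n * 1 * K * O := by ring
      _ ≤ _ := by rw [hU]; gcongr
  have hnTU : n * T * O ≤ U := by
    calc n * T * O = n * T * 1 * O := by ring
      _ ≤ _ := by rw [hU]; gcongr
  have hlen : (dedupT subs).val.length ≤ l := (length_dedupT_le subs).trans hl
  have hims : ∀ im ∈ (mapT (imageT B A F T D) (dedupT subs).val).val,
      ∃ p s, IsImage (f - fstar) p s im ∧ p ≤ X ∧ s.length = n ∧ ∀ a ∈ s, a ≤ X := by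
    intro im him
    rw [mapT_val] at him
    obtain ⟨y, hy, rfl⟩ := List.mem_map.1 him
    have := hsubs y (dedupT_subset _ hy)
    exact ⟨y.1, y.2, imageT_spec h this.2.1, this⟩
  have hlen' : (mapT (imageT B A F T D) (dedupT subs).val).val.length ≤ l := by
    rw [mapT_val, List.length_map]; exact hlen
  have hcount : ∀ im ∈ (mapT (imageT B A F T D) (dedupT subs).val).val, im.count ≤ T := by
    intro im hmem
    obtain ⟨p, s, him, -⟩ := hims im hmem
    rw [him.count_eq]
    exact ((Finset.card_le_card (support_reduceExp_subset _ _ _)).trans Finset.card_image_le).trans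
      (h.card_sub.trans h.T₁_le)
  rw [recoverT]
  refine Timed.Within.mono (Timed.Within.bind (within_dedupT (K := K) (W := W) (n := n) subs
      ((Nat.size_le_size hl).trans hb.size_l) hK1 fun x hx => ?_)
    (Timed.Within.bind (within_mapT (m := 1) (r := 6 * T) (b := 26 * n * T * K * O)
      fun x hx => ?_) (m' := n) (r' := 4 * n * T) (b' := l * O + 85 * U) ?_)) ?_ ?_ ?_
  · obtain ⟨h1, h2, h3⟩ := hsubs x hx
    exact ⟨hXW h1, h2, fun a ha => hXW (h3 a ha)⟩
  · obtain ⟨h1, h2, h3⟩ := hsubs x (dedupT_subset _ hx)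
    exact within_imageT h hb h2 h1 h3
  · revert hims hlen' hcount
    generalize (mapT (imageT B A F T D) (dedupT subs).val).val = L
    intro hims hlen' hcount
    cases L with
    | nil => exact Timed.Within.mono (within_ret _) (by omega) (by omega) (by omega)
    | cons i L =>
      obtain ⟨hb1, -⟩ := bestT_spec i L
      obtain ⟨p, s, him, hp, hs, hsX⟩ := hims _ hb1
      have hc := hcount _ hb1
      simp only
      refine Timed.Within.mono (Timed.Within.bind (within_bestT (K := K) (W := W) i L
          fun j hj => hTW ((hcount j hj).trans (by omega)))
        (Timed.Within.bind (within_leN (K := K) (W := W) (hTW (hc.trans (by omega)))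
          (hTW (h.T₁_le.trans (by omega)))) (m' := n) (r' := 4 * n * T) (b' := 84 * U) ?_)) ?_ ?_ ?_
      · set im := (bestT i L).val with him_def
        split_ifs
        · rw [him.p_eq, him.s_eq]
          have hspec : ∀ k < n, IsSortedRep (shiftedT B A T D im
              (k, F.map fun t => (dotN t.1 s + t.1.getD k 0 * p, t.2))).val
              (kron (f - fstar) (s.modify k fun y => y + p)) :=
            fun k hk => (shiftedT_spec h him hs hk).1
          have hdeg := h.degree_sub_le
          have hsX' : ∀ i < n, s.getD i 0 ≤ 2 * X := fun i _ =>
            (getD_le hsX i).trans (by omega)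
          have hlenK : ∀ {L : List (ℕ × R)} {s : List ℕ}, IsSortedRep L (kron (f - fstar) s) →
              L.length ≤ 2 * T := by
            intro L s hL
            rw [hL.isSparseRep.length_eq]
            exact (card_support_kron_le _ _).trans (h.card_sub.trans
              (h.T₁_le.trans (by omega)))
          refine Timed.Within.mono (Timed.Within.bind (within_polySubsT h hb hs hp hsX)
            (Timed.Within.bind (within_mapT (m := 1) (r := 4 * T) (b := 12 * T * K * O)
              fun x hx => ?_)
            (Timed.Within.bindRet (within_tsTermsT (n := n) (K := K) (W := W) (Y := 2 * X * D)
              (M := 2 * T) him.polyMod.pairwise ?_ hn hb.size_T (by omega)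
              ((Nat.size_le_size hp).trans hXK) (hb.size_mul hn) (hb.size_D' hn)
              (fun a ha => (Nat.size_le_size (hsX a ha)).trans hXK)
              ?_ (hlenK him.poly) ?_ ?_ ?_ ?_
              fun es hes he => hb.size_dotN hs hsX hes he)))) ?_ ?_ ?_
          · rw [polySubsT_val] at hx
            obtain ⟨k, hk, rfl⟩ : ∃ k < n, x = (k, F.map fun t =>
                (dotN t.1 s + t.1.getD k 0 * p, t.2)) := by
              obtain ⟨j, hj, rfl⟩ := List.getElem_of_mem hx
              exact ⟨j, by simpa using hj, by simp⟩
            exact within_shiftedT h hb him hs hp hsX hk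
          · rw [mapT_shiftedT_val]; simp
          · rw [him.polyMod.isSparseRep.length_eq, ← him.count_eq]; omega
          · rw [mapT_shiftedT_val]
            intro L hL
            obtain ⟨k, hk, rfl⟩ := List.mem_map.1 hL
            exact hlenK (hspec k (List.mem_range.1 hk))
          · intro t ht
            have hmem : t.1 ∈ (reduceExp p (kron (f - fstar) s)).support := by
              rw [← him.polyMod.isSparseRep.toFinset_eq]
              exact List.mem_toFinset.2 (List.mem_map_of_mem ht)
            obtain ⟨e, he, hte⟩ := Finset.mem_image.1 (support_reduceExp_subset _ _ _ hmem)
            rw [← hte]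
            exact (Nat.mod_le _ _).trans (kronExp_le hsX' (sum_le_of_mem_support hdeg he))
          · exact fun t ht => him.poly.isSparseRep.le_of_mem hdeg hsX' ht
          · rw [mapT_shiftedT_val]
            intro L hL t ht
            obtain ⟨k, hk, rfl⟩ := List.mem_map.1 hL
            exact (hspec k (List.mem_range.1 hk)).isSparseRep.le_of_mem hdeg
              (fun i _ => getD_modify_le hsX hp k i) ht
          · rw [polySubsT_val]; simp
          · rw [polySubsT_val]; simp only [List.length_zip, List.length_range, List.length_map,
              min_self, zero_add, add_zero]; exact le_of_eq (by ring)
          · rw [polySubsT_val]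
            simp only [List.length_zip, List.length_range, List.length_map, min_self]
            have e1 : 8 * n * T * O ≤ 8 * U := by
              calc 8 * n * T * O = 8 * (n * T * O) := by ring
                _ ≤ _ := by gcongr
            have e2 : n * (12 * T * K * O + 1) = 12 * U + n := by rw [hU]; ring
            have e3 : 31 * n * (2 * T) * K * O = 62 * U := by rw [hU]; ring
            have e4 : n ≤ U := by
              calc n = n * 1 * 1 * 1 := by ring
                _ ≤ U := by rw [hU]; gcongr; omega
            rw [← hO]
            omega
        · exact Timed.Within.mono (within_ret _) (by omega) (by omega) (by omega)
      · omega
      · omega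
      · simp only [List.length_cons] at hlen'
        have e1 : L.length * O ≤ l * O := by gcongr; omega
        rw [← hO]
        omega
  · rw [mul_one]; omega
  · have : (dedupT subs).val.length * (6 * T) ≤ l * (6 * T) := by gcongr
    linarith
  · have e1 : 4 * subs.length * K * ((n + 2) * O) ≤ 12 * (l * U) := by
      calc 4 * subs.length * K * ((n + 2) * O) ≤ 4 * l * K * ((3 * n) * O) := by gcongr; omega
        _ = 12 * (l * (n * K * O)) := by ring
        _ ≤ _ := by gcongr
    have e2 : (dedupT subs).val.length * (26 * n * T * K * O + 1) ≤ 27 * (l * U) := by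
      calc (dedupT subs).val.length * (26 * n * T * K * O + 1) ≤ l * (26 * U + U) := by
            have e0 : 26 * n * T * K * O = 26 * U := by rw [hU]; ring
            rw [e0]
            gcongr
            omega
        _ = _ := by ring
    have e3 : l * O ≤ l * U := by gcongr
    have e4 : 130 * (l + 1) * n * T * K * O = 130 * (l * U) + 130 * U := by rw [hU]; ring
    rw [e4, ← hO]
    omega

end Recover

end SparseInterp

namespace SparseInterp

open Timed
open scoped ENNReal

/-! ### Expectations -/

/-- The expectation of a function of the value of a random computation. -/
noncomputable def Rand.expect {α : Type*} (x : Rand α) (φ : α → ℝ≥0∞) : ℝ≥0∞ :=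
  ∑' t, x t * φ t.val

section Expect

variable {α β : Type*}

theorem tsum_bind_mul {γ δ : Type*} (μ : PMF γ) (f : γ → PMF δ) (φ : δ → ℝ≥0∞) :
    ∑' b, μ.bind f b * φ b = ∑' a, μ a * ∑' b, f a b * φ b := by
  simp only [PMF.bind_apply, ← ENNReal.tsum_mul_right, ← ENNReal.tsum_mul_left, mul_assoc]
  rw [ENNReal.tsum_comm]

theorem tsum_pure_mul {γ : Type*} (a : γ) (φ : γ → ℝ≥0∞) :
    ∑' b, (PMF.pure a) b * φ b = φ a := by
  rw [tsum_eq_single a]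
  · simp
  · intro b hb
    simp [hb]

theorem tsum_map_mul {γ δ : Type*} (μ : PMF γ) (f : γ → δ) (φ : δ → ℝ≥0∞) :
    ∑' b, μ.map f b * φ b = ∑' a, μ a * φ (f a) := by
  rw [← PMF.bind_pure_comp, tsum_bind_mul]
  simp only [Function.comp, tsum_pure_mul]

/-- Functions of the value do not see the costs, so that expectations can be computed as if the
computations were not timed. -/
theorem Rand.expect_bind (x : Rand α) (f : α → Rand β) (φ : β → ℝ≥0∞) :
    (Rand.bind x f).expect φ = x.expect fun a => (f a).expect φ := by
  simp only [Rand.expect, Rand.bind, tsum_bind_mul, tsum_map_mul]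

theorem Rand.expect_lift (x : Timed α) (φ : α → ℝ≥0∞) : (Rand.lift x).expect φ = φ x.val := by
  simp only [Rand.expect, Rand.lift, tsum_pure_mul]

/-- Removes the guard `max m 1`, which only makes the uniform law meaningful for `m = 0`. -/
theorem randBelow_eq {m : ℕ} (hm : 1 ≤ m) :
    randBelow m = PMF.map (fun x => (⟨x, ⟨[], 0, 1 + m.size⟩⟩ : Timed ℕ))
      (PMF.uniformOfFinset (Finset.range m) (Finset.nonempty_range_iff.2 (by omega))) := by
  have h : ∀ (k : ℕ) (hk : k = m) (hk' : (Finset.range k).Nonempty),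
      PMF.uniformOfFinset (Finset.range k) hk' = PMF.uniformOfFinset (Finset.range m)
        (Finset.nonempty_range_iff.2 (by omega)) := by
    rintro k rfl hk'
    rfl
  exact congrArg (PMF.map _) (h _ (max_eq_left hm) _)

theorem expect_randBelow {m : ℕ} (hm : 1 ≤ m) (φ : ℕ → ℝ≥0∞) :
    (randBelow m).expect φ = (∑ i ∈ Finset.range m, φ i) * (m : ℝ≥0∞)⁻¹ := by
  simp only [Rand.expect, randBelow_eq hm, tsum_map_mul]
  rw [tsum_eq_sum (s := Finset.range m), Finset.sum_mul]
  · refine Finset.sum_congr rfl fun i hi => ?_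
    rw [PMF.uniformOfFinset_apply, if_pos hi, mul_comm, Finset.card_range]
  · intro i hi
    rw [PMF.uniformOfFinset_apply, if_neg hi, zero_mul]

theorem Rand.expect_mono (x : Rand α) {φ ψ : α → ℝ≥0∞}
    (h : ∀ t ∈ x.support, φ t.val ≤ ψ t.val) : x.expect φ ≤ x.expect ψ := by
  refine ENNReal.tsum_le_tsum fun t => ?_
  by_cases ht : t ∈ x.support
  · exact mul_le_mul_right (h t ht) _
  · rw [(x.apply_eq_zero_iff t).2 ht, zero_mul, zero_mul]

theorem Rand.expect_add (x : Rand α) (φ ψ : α → ℝ≥0∞) :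
    (x.expect fun a => φ a + ψ a) = x.expect φ + x.expect ψ := by
  simp only [Rand.expect, mul_add, ENNReal.tsum_add]

theorem Rand.expect_const (x : Rand α) (c : ℝ≥0∞) : (x.expect fun _ => c) = c := by
  simp only [Rand.expect, ENNReal.tsum_mul_right, x.tsum_coe, one_mul]

theorem Rand.expect_mul_left (x : Rand α) (c : ℝ≥0∞) (φ : α → ℝ≥0∞) :
    (x.expect fun a => c * φ a) = c * x.expect φ := by
  simp only [Rand.expect, ← ENNReal.tsum_mul_left]
  exact tsum_congr fun t => by ring

theorem Rand.expect_sum {ι : Type*} (x : Rand α) (s : Finset ι) (φ : ι → α → ℝ≥0∞) :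
    (x.expect fun a => ∑ i ∈ s, φ i a) = ∑ i ∈ s, x.expect (φ i) := by
  simp only [Rand.expect, Finset.mul_sum]
  exact Summable.tsum_finsetSum fun _ _ => ENNReal.summable

theorem expect_replicate_succ (x : Rand α) (m : ℕ) (φ : List α → ℝ≥0∞) :
    (Rand.replicate x (m + 1)).expect φ =
      x.expect fun a => (Rand.replicate x m).expect fun l => φ (a :: l) := by
  simp only [Rand.replicate, Rand.expect_bind, Rand.expect_lift, Timed.ret_val]

open Classical in
theorem toOuterMeasure_eq_expect (x : Rand α) (Q : α → Prop) :
    x.toOuterMeasure {r | Q r.val} = x.expect fun a => if Q a then 1 else 0 := by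
  rw [PMF.toOuterMeasure_apply]
  refine tsum_congr fun t => ?_
  by_cases h : Q t.val <;> simp [Set.indicator, h]

/-- The probability that all of `m` independent runs have a property. -/
theorem expect_replicate_forall (x : Rand α) (Q : α → Prop) [DecidablePred Q]
    [∀ l : List α, Decidable (∀ a ∈ l, Q a)] (m : ℕ) :
    ((Rand.replicate x m).expect fun l => if ∀ a ∈ l, Q a then 1 else 0) =
      (x.expect fun a => if Q a then 1 else 0) ^ m := by
  induction m with
  | zero => simp [Rand.replicate, Rand.expect_lift]
  | succ m ih =>
    rw [expect_replicate_succ, pow_succ, ← ih, ← Rand.expect_mul_left]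
    congr 1
    funext a
    by_cases h : Q a
    · simp [h]
    · simp only [List.forall_mem_cons, h, false_and, if_false, mul_zero, Rand.expect_const]

end Expect

/-! ### Bounds for all random choices -/

/-- All values have the property `Q`, and all costs are bounded. -/
def Rand.Within {α : Type*} (P : Query → Prop) (x : Rand α) (Q : α → Prop) (m r b : ℕ) : Prop :=
  ∀ t ∈ x.support, Q t.val ∧ t.Within P m r b

section RandWithin

variable {α β : Type*} {P : Query → Prop}

theorem Rand.Within.bind {x : Rand α} {f : α → Rand β} {Q : α → Prop} {Q' : β → Prop}
    {m r b m' r' b' : ℕ} (hx : x.Within P Q m r b)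
    (hf : ∀ a, Q a → (f a).Within P Q' m' r' b') :
    (Rand.bind x f).Within P Q' (m + m') (r + r') (b + b') := by
  intro t ht
  rw [Rand.bind, PMF.mem_support_bind_iff] at ht
  obtain ⟨u, hu, ht⟩ := ht
  rw [PMF.mem_support_map_iff] at ht
  obtain ⟨v, hv, rfl⟩ := ht
  obtain ⟨hq, hu⟩ := hx u hu
  obtain ⟨hq', hv⟩ := hf _ hq v hv
  exact ⟨hq', Timed.Within.bind (f := fun _ => v) hu hv⟩

theorem Rand.Within.lift {x : Timed α} {Q : α → Prop} {m r b : ℕ} (hq : Q x.val)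
    (hx : x.Within P m r b) : (Rand.lift x).Within P Q m r b := by
  intro t ht
  rw [Rand.lift, PMF.support_pure, Set.mem_singleton_iff] at ht
  exact ht ▸ ⟨hq, hx⟩

theorem Rand.Within.mono {x : Rand α} {Q Q' : α → Prop} {m r b m' r' b' : ℕ}
    (h : x.Within P Q m r b) (hQ : ∀ a, Q a → Q' a) (hm : m ≤ m') (hr : r ≤ r') (hb : b ≤ b') :
    x.Within P Q' m' r' b' :=
  fun t ht => ⟨hQ _ (h t ht).1, (h t ht).2.mono hm hr hb⟩

theorem within_randBelow {m : ℕ} (hm : 1 ≤ m) :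
    (randBelow m).Within P (fun a => a < m) 0 0 (1 + m.size) := by
  intro t ht
  rw [randBelow_eq hm, PMF.mem_support_map_iff] at ht
  obtain ⟨a, ha, rfl⟩ := ht
  rw [PMF.mem_support_uniformOfFinset_iff, Finset.mem_range] at ha
  exact ⟨ha, within_of_bitOps _ _⟩

theorem within_replicate {x : Rand α} {Q : α → Prop} {b : ℕ} (hx : x.Within P Q 0 0 b) (m : ℕ) :
    (Rand.replicate x m).Within P (fun l => l.length = m ∧ ∀ a ∈ l, Q a) 0 0 (m * (b + 1)) := by
  induction m with
  | zero =>
    exact Rand.Within.mono (Rand.Within.lift (x := ret [])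
      (Q := fun l => l.length = 0 ∧ ∀ a ∈ l, Q a) (by simp) (within_ret _))
      (fun _ h => h) le_rfl le_rfl (Nat.zero_le _)
  | succ m ih =>
    refine Rand.Within.mono (Rand.Within.bind (f := _) hx fun a ha => Rand.Within.bind
      (Rand.Within.lift (Q := fun _ => True) trivial (within_tick 1)) fun _ _ =>
      Rand.Within.bind ih fun l hl => Rand.Within.lift (x := ret (a :: l))
        (Q := fun l => l.length = m + 1 ∧ ∀ a ∈ l, Q a) ?_ (within_ret _))
      (fun _ h => h) le_rfl le_rfl (by ring_nf; omega)
    exact ⟨by simp [hl.1], by simpa using ⟨ha, hl.2⟩⟩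

end RandWithin

theorem getD_mem {l : List ℕ} {i : ℕ} (h : i < l.length) : l.getD i 0 ∈ l := by
  rw [List.getD_eq_getElem _ _ h]
  exact List.getElem_mem h

theorem within_randSubst {P : Query → Prop} (n : ℕ) {N X K W : ℕ} {primes : List ℕ} (hN : 1 ≤ N)
    (hlen : primes.length = N) (hp : ∀ p ∈ primes, 1 ≤ p ∧ p ≤ X) (hNW : N.size ≤ W)
    (hX : X.size ≤ W) :
    (randSubst n N primes).Within P
      (fun x => x.1 ∈ primes ∧ x.2.length = n ∧ ∀ a ∈ x.2, a ≤ X) 0 0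
      ((n + 2) * (opCost K W + 1)) := by
  have hO := linear_le_opCost K W
  have hrep : ∀ p ∈ primes, (Rand.replicate (randBelow p) n).Within P
      (fun s => s.length = n ∧ ∀ a ∈ s, a < p) 0 0 (n * (opCost K W + 1)) := fun p hpm =>
    (within_replicate ((within_randBelow (hp p hpm).1).mono (fun _ h => h) le_rfl le_rfl
      (by have := Nat.size_le_size (hp p hpm).2; omega)) n)
  refine Rand.Within.mono (Rand.Within.bind (f := _) (within_randBelow hN) fun i hi =>
    Rand.Within.bind (Rand.Within.lift (x := readN primes i) (Q := fun p => p ∈ primes)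
      (getD_mem (hlen ▸ hi)) (within_readN (K := K) (W := W) _ ((Nat.size_le_size hi.le).trans hNW)))
    fun p hpm => Rand.Within.bind (hrep p hpm)
    fun s hs => Rand.Within.lift (x := ret (p, s))
      (Q := fun x => x.1 ∈ primes ∧ x.2.length = n ∧ ∀ a ∈ x.2, a < x.1)
      ⟨hpm, hs⟩ (within_ret _)) ?_ le_rfl le_rfl ?_
  · exact fun x hx => ⟨hx.1, hx.2.1, fun a ha => ((hx.2.2 a ha).trans_le (hp _ hx.1).2).le⟩
  · rw [Nat.add_mul]
    omega

end SparseInterp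

namespace SparseInterp

open Timed
open scoped ENNReal

/-! ### Collisions -/

open Classical in
/-- A nontrivial linear form takes a given value at a random vector with probability at most
`1 / p`. -/
theorem expect_linear_eq_le {p : ℕ} [Fact p.Prime] (n : ℕ) (a : ℕ → ZMod p) (c : ZMod p)
    (h : ∃ i < n, a i ≠ 0) :
    ((Rand.replicate (randBelow p) n).expect fun s =>
      if ∑ i ∈ Finset.range n, a i * ((s.getD i 0 : ℕ) : ZMod p) = c then 1 else 0) ≤
      (p : ℝ≥0∞)⁻¹ := by
  induction n generalizing a c with
  | zero => simp at h
  | succ n ih =>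
    rw [expect_replicate_succ]
    simp only [Finset.sum_range_succ', List.getD_cons_succ, List.getD_cons_zero]
    -- If a later coefficient is nonzero, fix the first coordinate and use induction for the others.
    -- Otherwise `a 0` is invertible and determines the first coordinate modulo `p`, which leaves at
    -- most one value below `p`.
    by_cases ht : ∃ i < n, a (i + 1) ≠ 0
    · refine (Rand.expect_mono _ fun t _ => ?_).trans (Rand.expect_const (randBelow p) _).le
      simpa only [← eq_sub_iff_add_eq] using
        ih (fun i => a (i + 1)) (c - a 0 * ((t.val : ℕ) : ZMod p)) ht
    · push Not at ht
      have h0 : a 0 ≠ 0 := by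
        obtain ⟨i, hi, hne⟩ := h
        rcases i with _ | i
        · exact hne
        · exact absurd (ht i (by omega)) hne
      have hs : ∀ s : List ℕ, ∑ i ∈ Finset.range n, a (i + 1) * ((s.getD i 0 : ℕ) : ZMod p) = 0 :=
        fun s => Finset.sum_eq_zero fun i hi => by rw [ht i (Finset.mem_range.1 hi), zero_mul]
      simp only [hs, zero_add, Rand.expect_const]
      rw [expect_randBelow (Fact.out : p.Prime).one_lt.le]
      refine mul_le_of_le_one_left' ?_
      rw [Finset.sum_boole]
      refine Nat.cast_le_one.2 (Finset.card_le_one.2 fun x hx y hy => ?_)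
      simp only [Finset.mem_filter, Finset.mem_range] at hx hy
      have := mul_left_cancel₀ h0 (hx.2.trans hy.2.symm)
      rw [ZMod.natCast_eq_natCast_iff'] at this
      rwa [Nat.mod_eq_of_lt hx.1, Nat.mod_eq_of_lt hy.1] at this

-- A collision is a zero of the linear form with coefficients `e j - e' j` over `ZMod p`, and the
-- hypothesis says that this form is not zero.
open Classical in
theorem expect_kronExp_eq_le {n p : ℕ} (hp : p.Prime) {e e' : Fin n →₀ ℕ}
    (h : ∃ i, ¬ (e i ≡ e' i [MOD p])) :
    ((Rand.replicate (randBelow p) n).expect fun s =>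
      if kronExp s e % p = kronExp s e' % p then 1 else 0) ≤ (p : ℝ≥0∞)⁻¹ := by
  have := Fact.mk hp
  obtain ⟨i, hi⟩ := h
  set a : ℕ → ZMod p := fun j => if hj : j < n then (e ⟨j, hj⟩ : ZMod p) - (e' ⟨j, hj⟩ : ZMod p)
    else 0 with ha
  have key : ∀ s : List ℕ, ∑ j ∈ Finset.range n, a j * ((s.getD j 0 : ℕ) : ZMod p) =
      (kronExp s e : ZMod p) - (kronExp s e' : ZMod p) := by
    intro s
    rw [← Fin.sum_univ_eq_sum_range (fun j => a j * ((s.getD j 0 : ℕ) : ZMod p)) n, kronExp, kronExp]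
    push_cast
    rw [← Finset.sum_sub_distrib]
    exact Finset.sum_congr rfl fun j _ => by simp [ha, sub_mul]
  refine le_trans (le_of_eq ?_) (expect_linear_eq_le n a 0 ⟨i, i.2, ?_⟩)
  · congr 1
    funext s
    simp only [key, sub_eq_zero, ZMod.natCast_eq_natCast_iff']
  · simp only [ha, i.2, dif_pos, ne_eq, sub_eq_zero, ZMod.natCast_eq_natCast_iff]
    exact hi

/-- The product of the primes in `s` divides `Δ`, and each of them is at least 2. -/
theorem card_prime_dvd_le {Δ D : ℕ} (hΔ : Δ ≠ 0) (hD : Δ ≤ D) {s : Finset ℕ}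
    (hs : ∀ p ∈ s, p.Prime ∧ p ∣ Δ) : s.card ≤ Nat.log 2 D := by
  refine Nat.le_log_of_pow_le one_lt_two (le_trans ?_ hD)
  refine le_trans ?_ (Nat.le_of_dvd (Nat.pos_of_ne_zero hΔ)
    (Finset.prod_primes_dvd Δ (fun p hp => (hs p hp).1.prime) fun p hp => (hs p hp).2))
  exact Finset.pow_card_le_prod s _ 2 fun p hp => (hs p hp).1.two_le

theorem sum_range_getD {N : ℕ} {L : List ℕ} (hlen : L.length = N) (hL : L.Nodup)
    (φ : ℕ → ℝ≥0∞) : ∑ i ∈ Finset.range N, φ (L.getD i 0) = ∑ p ∈ L.toFinset, φ p := by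
  subst hlen
  rw [List.sum_toFinset _ hL, ← Fin.sum_univ_eq_sum_range (fun i => φ (L.getD i 0)),
    ← Fin.sum_univ_fun_getElem]
  exact Finset.sum_congr rfl fun i _ => by simp

theorem expect_randSubst (n : ℕ) {N : ℕ} {primes : List ℕ} (hN : 1 ≤ N)
    (hlen : primes.length = N) (hL : primes.Nodup) (φ : ℕ × List ℕ → ℝ≥0∞) :
    (randSubst n N primes).expect φ =
      (∑ p ∈ primes.toFinset, (Rand.replicate (randBelow p) n).expect fun s => φ (p, s)) *
        (N : ℝ≥0∞)⁻¹ := by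
  simp only [randSubst, Rand.expect_bind, Rand.expect_lift, readN_val, Timed.ret_val]
  rw [expect_randBelow hN, sum_range_getD hlen hL
    (fun p => (Rand.replicate (randBelow p) n).expect fun s => φ (p, s))]

open Classical in
/-- The probability that two exponent vectors collide. -/
theorem expect_collision_le {n N D lo : ℕ} {primes : List ℕ} (hN : 1 ≤ N)
    (hlen : primes.length = N) (hL : primes.Nodup) (hp : ∀ p ∈ primes, p.Prime ∧ lo ≤ p)
    {e e' : Fin n →₀ ℕ} (hne : e ≠ e') (he : ∑ i, e i ≤ D) (he' : ∑ i, e' i ≤ D) :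
    ((randSubst n N primes).expect fun x =>
      if kronExp x.2 e % x.1 = kronExp x.2 e' % x.1 then 1 else 0) ≤
      (Nat.log 2 D : ℝ≥0∞) * (N : ℝ≥0∞)⁻¹ + (lo : ℝ≥0∞)⁻¹ := by
  obtain ⟨i, hi⟩ := DFunLike.ne_iff.1 hne
  have hiD : ∀ e : Fin n →₀ ℕ, ∑ i, e i ≤ D → e i ≤ D := fun e h =>
    (Finset.single_le_sum (f := fun i => e i) (fun _ _ => Nat.zero_le _) (Finset.mem_univ i)).trans h
  set Δ := ((e i : ℤ) - e' i).natAbs with hΔ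
  have hΔ0 : Δ ≠ 0 := by omega
  have hΔD : Δ ≤ D := by have := hiD e he; have := hiD e' he'; omega
  -- For these primes the two vectors may agree modulo `p` in coordinate `i`, and the probability of
  -- a collision is estimated by 1. For all others the linear form gives `1 / p ≤ 1 / lo`.
  set bad := primes.toFinset.filter fun p => p ∣ Δ with hbad
  have hcard : bad.card ≤ Nat.log 2 D := card_prime_dvd_le hΔ0 hΔD fun p hpb => by
    rw [hbad, Finset.mem_filter, List.mem_toFinset] at hpb
    exact ⟨(hp p hpb.1).1, hpb.2⟩
  have hN0 : (N : ℝ≥0∞) ≠ 0 := by exact_mod_cast (by omega : N ≠ 0)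
  rw [expect_randSubst n hN hlen hL]
  have hsum : ∑ p ∈ primes.toFinset, ((Rand.replicate (randBelow p) n).expect fun s =>
      if kronExp s e % p = kronExp s e' % p then (1 : ℝ≥0∞) else 0) ≤
      ∑ p ∈ primes.toFinset, ((if p ∣ Δ then 1 else 0) + (lo : ℝ≥0∞)⁻¹) := by
    refine Finset.sum_le_sum fun p hpm => ?_
    rw [List.mem_toFinset] at hpm
    by_cases hd : p ∣ Δ
    · rw [if_pos hd]
      refine le_trans ?_ le_self_add
      refine (Rand.expect_mono _ fun t _ => ?_).trans (Rand.expect_const _ _).le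
      split_ifs <;> simp
    · rw [if_neg hd, zero_add]
      refine (expect_kronExp_eq_le (hp p hpm).1 ⟨i, fun hm => hd ?_⟩).trans
        (ENNReal.inv_le_inv.2 (by exact_mod_cast (hp p hpm).2))
      rw [hΔ, ← Int.natCast_dvd]
      exact (Nat.modEq_iff_dvd.1 hm.symm)
  refine (mul_le_mul_left hsum _).trans ?_
  rw [Finset.sum_add_distrib, Finset.sum_boole, Finset.sum_const, List.toFinset_card_of_nodup hL,
    hlen, add_mul, nsmul_eq_mul, mul_right_comm, ENNReal.mul_inv_cancel hN0 (by simp), one_mul]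
  gcongr

/-- The integer `t * ⌊log₂ D⌋` is at most `(T₁ - 1) log₂ D`, and hence at most the floor of the
latter. -/
theorem mul_numPrimes_le {T₁ D t : ℕ} (h : t + 1 ≤ T₁) :
    31 * (t * Nat.log 2 D) ≤ numPrimes T₁ D := by
  refine le_trans (Nat.mul_le_mul_left 31 (Nat.le_floor ?_)) (le_max_left _ _)
  have h1 : (t : ℝ) ≤ T₁ - 1 := by
    have : ((t + 1 : ℕ) : ℝ) ≤ T₁ := by exact_mod_cast h
    push_cast at this
    linarith
  push_cast
  exact mul_le_mul h1 (by exact_mod_cast Real.natLog_le_logb D 2) (by positivity)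
    ((Nat.cast_nonneg t).trans h1)

end SparseInterp

namespace SparseInterp

open Timed
open scoped ENNReal

/-! ### The probability of success -/

section Success

variable {n : ℕ} {R : Type*} [CommRing R]

-- Union bound in counting form: a term that is not isolated collides with at least one other term.
open Classical in
theorem card_sub_card_isolated_le (g : MvPolynomial (Fin n) R) (p : ℕ) (s : List ℕ) :
    ((g.support.card - (isolated g p s).card : ℕ) : ℝ≥0∞) ≤
      ∑ e ∈ g.support, ∑ e' ∈ g.support.erase e,
        if kronExp s e % p = kronExp s e' % p then 1 else 0 := by
  rw [← Finset.card_sdiff_of_subset (isolated_subset g p s), ← nsmul_one, ← Finset.sum_const]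
  refine le_trans ?_ (Finset.sum_le_sum_of_subset (s := g.support \ isolated g p s)
    Finset.sdiff_subset)
  refine Finset.sum_le_sum fun e he => ?_
  rw [Finset.mem_sdiff, mem_isolated] at he
  obtain ⟨he, hne⟩ := he
  push Not at hne
  obtain ⟨e', he', heq, hee⟩ := hne he
  refine le_trans ?_ (Finset.single_le_sum (fun _ _ => zero_le) (Finset.mem_erase.2 ⟨hee, he'⟩))
  rw [if_pos heq.symm]

/-- The case `N = 0` is included, with `0 * ∞ = 0`. It occurs for `T₁ = 1`, when the lower bound `32
* (T₁ - 1)` for the primes is zero. -/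
theorem natCast_mul_inv_le {c x N : ℕ} (hc : c ≠ 0) (h : c * x ≤ N) :
    (x : ℝ≥0∞) * (N : ℝ≥0∞)⁻¹ ≤ (c : ℝ≥0∞)⁻¹ := by
  refine ENNReal.div_le_of_le_mul ?_
  calc (x : ℝ≥0∞) = (c : ℝ≥0∞)⁻¹ * ((c * x : ℕ) : ℝ≥0∞) := by
        push_cast
        rw [← mul_assoc, ENNReal.inv_mul_cancel (by exact_mod_cast hc) (by simp), one_mul]
    _ ≤ _ := by gcongr

open Classical in
/-- The expected number of terms that are not isolated. -/
theorem expect_not_isolated_le {g : MvPolynomial (Fin n) R} {T₁ D N lo : ℕ} {primes : List ℕ}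
    (hN : 1 ≤ N) (hlen : primes.length = N) (hL : primes.Nodup)
    (hp : ∀ p ∈ primes, p.Prime ∧ lo ≤ p) (hNT : 31 * ((T₁ - 1) * Nat.log 2 D) ≤ N)
    (hlo : 32 * (T₁ - 1) ≤ lo) (hg : g.support.card ≤ T₁) (hD : g.totalDegree ≤ D) :
    ((randSubst n N primes).expect fun x =>
      ((g.support.card - (isolated g x.1 x.2).card : ℕ) : ℝ≥0∞)) ≤
      T₁ * ((31 : ℝ≥0∞)⁻¹ + 32⁻¹) := by
  refine le_trans (Rand.expect_mono (ψ := fun x => ∑ e ∈ g.support, ∑ e' ∈ g.support.erase e,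
    if kronExp x.2 e % x.1 = kronExp x.2 e' % x.1 then 1 else 0) _ fun t _ => ?_) ?_
  · exact card_sub_card_isolated_le g t.val.1 t.val.2
  simp only [Rand.expect_sum]
  -- A term of `g` has at most `T₁ - 1` rivals. The numbers 31 and 32 in the algorithm are made to
  -- absorb this factor.
  have hbound : ((T₁ - 1 : ℕ) : ℝ≥0∞) *
      ((Nat.log 2 D : ℝ≥0∞) * (N : ℝ≥0∞)⁻¹ + (lo : ℝ≥0∞)⁻¹) ≤ (31 : ℝ≥0∞)⁻¹ + 32⁻¹ := by
    rw [mul_add, ← mul_assoc, ← Nat.cast_mul]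
    refine add_le_add ?_ ?_
    · simpa only [Nat.cast_ofNat] using natCast_mul_inv_le (by norm_num) hNT
    · simpa only [Nat.cast_ofNat] using natCast_mul_inv_le (by norm_num) hlo
  refine (Finset.sum_le_sum fun e he => Finset.sum_le_sum fun e' he' =>
    expect_collision_le hN hlen hL hp (Finset.ne_of_mem_erase he').symm
      (sum_le_of_mem_support hD he)
      (sum_le_of_mem_support hD (Finset.mem_of_mem_erase he'))).trans ?_
  calc _ = ∑ e ∈ g.support, ((g.support.card - 1 : ℕ) : ℝ≥0∞) *
          ((Nat.log 2 D : ℝ≥0∞) * (N : ℝ≥0∞)⁻¹ + (lo : ℝ≥0∞)⁻¹) := by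
        refine Finset.sum_congr rfl fun e he => ?_
        rw [Finset.sum_const, Finset.card_erase_of_mem he, nsmul_eq_mul]
    _ = g.support.card * (((g.support.card - 1 : ℕ) : ℝ≥0∞) *
          ((Nat.log 2 D : ℝ≥0∞) * (N : ℝ≥0∞)⁻¹ + (lo : ℝ≥0∞)⁻¹)) := by
        rw [Finset.sum_const, nsmul_eq_mul]
    _ ≤ T₁ * (((T₁ - 1 : ℕ) : ℝ≥0∞) *
          ((Nat.log 2 D : ℝ≥0∞) * (N : ℝ≥0∞)⁻¹ + (lo : ℝ≥0∞)⁻¹)) := by gcongr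
    _ ≤ _ := by gcongr

open Classical in
/-- One random pair `(p, s)` is bad with probability at most `1 / 2`. -/
theorem expect_bad_le {g : MvPolynomial (Fin n) R} {T₁ D N lo : ℕ} {primes : List ℕ}
    (hN : 1 ≤ N) (hlen : primes.length = N) (hL : primes.Nodup)
    (hp : ∀ p ∈ primes, p.Prime ∧ lo ≤ p) (hNT : 31 * ((T₁ - 1) * Nat.log 2 D) ≤ N)
    (hlo : 32 * (T₁ - 1) ≤ lo) (hT : 1 ≤ T₁) (hg : g.support.card ≤ T₁)
    (hD : g.totalDegree ≤ D) :
    ((randSubst n N primes).expect fun x =>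
      if T₁ < 6 * (g.support.card - (isolated g x.1 x.2).card) then 1 else 0) ≤
      (2 : ℝ≥0∞)⁻¹ := by
  have hT0 : (T₁ : ℝ≥0∞) ≠ 0 := by exact_mod_cast (by omega : T₁ ≠ 0)
  refine (ENNReal.mul_le_mul_iff_right hT0 (by simp)).1 ?_
  rw [← Rand.expect_mul_left]
  -- Markov's inequality: `T₁` times the indicator of the bad event is at most six times the number
  -- of terms that are not isolated.
  calc _ ≤ (randSubst n N primes).expect fun x =>
        6 * ((g.support.card - (isolated g x.1 x.2).card : ℕ) : ℝ≥0∞) := by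
        refine Rand.expect_mono _ fun t _ => ?_
        split_ifs with h
        · rw [mul_one]
          exact_mod_cast h.le
        · simp
    _ ≤ 6 * (T₁ * ((31 : ℝ≥0∞)⁻¹ + 32⁻¹)) := by
        rw [Rand.expect_mul_left]
        gcongr
        exact expect_not_isolated_le hN hlen hL hp hNT hlo hg hD
    _ = T₁ * (6 * ((31 : ℝ≥0∞)⁻¹ + 32⁻¹)) := by ring
    -- Here `6 * (1/31 + 1/32) = 378/992`, which is less than `1/2`.
    _ ≤ T₁ * 2⁻¹ := by
        gcongr
        rw [← ENNReal.toReal_le_toReal (by finiteness) (by finiteness)]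
        simp only [ENNReal.toReal_mul, ENNReal.toReal_inv, ENNReal.toReal_ofNat]
        rw [ENNReal.toReal_add (by finiteness) (by finiteness)]
        simp only [ENNReal.toReal_inv, ENNReal.toReal_ofNat]
        norm_num

/-- Since `2 log 2 > 1`, already `2 log (1 / ν)` repetitions would suffice; the number used is
larger because `T₁ ≥ 1`. -/
theorem half_pow_numSubsts_le {T₁ : ℕ} {ν : ℝ} (hT : 1 ≤ T₁) (h0 : 0 < ν) (h1 : ν < 1) :
    (2 : ℝ≥0∞)⁻¹ ^ numSubsts T₁ ν ≤ ENNReal.ofReal ν := by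
  have hT' : (1 : ℝ) ≤ T₁ := by exact_mod_cast hT
  have hl : 2 * Real.log (1 / ν) ≤ numSubsts T₁ ν := by
    have hlog : 0 ≤ Real.log (1 / ν) := Real.log_nonneg (by rw [le_div_iff₀ h0]; linarith)
    have : Real.log (1 / ν) ≤ Real.log (T₁ / ν) :=
      Real.log_le_log (by positivity) (by gcongr)
    have := Nat.le_ceil (32 * Real.log (T₁ / ν))
    unfold numSubsts
    linarith
  rw [show (2 : ℝ≥0∞)⁻¹ = ENNReal.ofReal (1 / 2) by
    rw [one_div, ENNReal.ofReal_inv_of_pos two_pos, ENNReal.ofReal_ofNat],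
    ← ENNReal.ofReal_pow (by norm_num)]
  refine ENNReal.ofReal_le_ofReal ((Real.log_le_log_iff (by positivity) h0).1 ?_)
  rw [Real.log_pow, one_div, Real.log_inv]
  rw [one_div, Real.log_inv] at hl
  have := Real.log_two_gt_d9
  nlinarith [Real.log_neg h0 h1]

end Success

/-! ### The probability that HalfPoly succeeds -/

section HalfPoly

variable {n : ℕ} {R : Type*} [CommRing R] [DecidableEq R] {S : ℕ → Type*} [∀ d, CommRing (S d)]
  [∀ d, Algebra R (S d)] {B : ∀ d, (Fin n → S d) → S d}
  {A : ∀ d, (S d → S d) → ℕ → List (ℕ × R)} {f fstar : MvPolynomial (Fin n) R}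
  {F : List (List ℕ × R)} {T T₁ D : ℕ}

/-- The list of primes computed by HalfPoly. -/
noncomputable def primesT (T₁ D : ℕ) : Timed (List ℕ) :=
  (subN T₁ 1).bind fun x => (mulN 32 x).bind fun lo => firstPrimesT lo (numPrimes T₁ D)

theorem primesT_spec (T₁ D : ℕ) :
    (primesT T₁ D).val.length = numPrimes T₁ D ∧ (primesT T₁ D).val.Nodup ∧
      ∀ p ∈ (primesT T₁ D).val, p.Prime ∧ 32 * (T₁ - 1) ≤ p ∧
        p ≤ 2 * primeBound (32 * (T₁ - 1) + numPrimes T₁ D) := by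
  rw [primesT, Timed.bind_val, Timed.bind_val, subN_val, mulN_val]
  exact firstPrimesT_spec (le_max_right _ _)

theorem within_substs {P : Query → Prop} (n : ℕ) {T₁ D K W : ℕ} (l : ℕ)
    (hN : (numPrimes T₁ D).size ≤ W)
    (hX : (2 * primeBound (32 * (T₁ - 1) + numPrimes T₁ D)).size ≤ W) :
    (Rand.replicate (randSubst n (numPrimes T₁ D) (primesT T₁ D).val) l).Within P
      (fun subs => subs.length = l ∧ ∀ x ∈ subs, x.1 ∈ (primesT T₁ D).val ∧ x.2.length = n ∧
        ∀ a ∈ x.2, a ≤ 2 * primeBound (32 * (T₁ - 1) + numPrimes T₁ D))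
      0 0 (l * ((n + 2) * (opCost K W + 1) + 1)) := by
  obtain ⟨hlen, -, hp⟩ := primesT_spec T₁ D
  exact within_replicate (within_randSubst n (le_max_right _ _) hlen
    (fun p hpm => ⟨(hp p hpm).1.one_lt.le, (hp p hpm).2.2⟩) hN hX) l

theorem ofReal_le_toOuterMeasure_halfPoly (h : IsInput B A f fstar F T T₁ D) {ν : ℝ}
    (h0 : 0 < ν) (h1 : ν < 1) :
    ENNReal.ofReal (1 - ν) ≤ (halfPoly B A F T T₁ D ν).toOuterMeasure
      {r | ∃ H, r.val = some H ∧ (f - fstar - toMvPoly n H).support.card ≤ T₁ / 2} := by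
  classical
  obtain ⟨hlen, hL, hp⟩ := primesT_spec T₁ D
  set bad : ℕ × List ℕ → Prop := fun x =>
    T₁ < 6 * ((f - fstar).support.card - (isolated (f - fstar) x.1 x.2).card) with hbad
  rw [toOuterMeasure_eq_expect (halfPoly B A F T T₁ D ν) fun v =>
    ∃ H, v = some H ∧ (f - fstar - toMvPoly n H).support.card ≤ T₁ / 2]
  rw [show halfPoly B A F T T₁ D ν = Rand.bind (Rand.lift (primesT T₁ D)) fun primes =>
    Rand.bind (Rand.replicate (randSubst n (numPrimes T₁ D) primes) (numSubsts T₁ ν)) fun subs =>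
    Rand.lift (recoverT B A F T T₁ D subs) from rfl]
  simp only [Rand.expect_bind, Rand.expect_lift]
  set x := Rand.replicate (randSubst n (numPrimes T₁ D) (primesT T₁ D).val) (numSubsts T₁ ν)
    with hx
  have hfail : (x.expect fun subs => if ∀ a ∈ subs, bad a then 1 else 0) ≤ ENNReal.ofReal ν := by
    rw [hx, expect_replicate_forall]
    refine le_trans ?_ (half_pow_numSubsts_le h.one_le_T₁ h0 h1)
    gcongr
    have hT := h.one_le_T₁
    convert expect_bad_le (N := numPrimes T₁ D) (le_max_right _ _) hlen hL
      (fun p hpm => ⟨(hp p hpm).1, (hp p hpm).2.1⟩) (mul_numPrimes_le (by omega)) le_rfl hT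
      h.card_sub h.degree_sub_le
  rw [ENNReal.ofReal_sub _ h0.le, ENNReal.ofReal_one, tsub_le_iff_right]
  refine le_trans ?_ (add_le_add le_rfl hfail)
  rw [← Rand.expect_add]
  -- For every sample that can occur, the indicators of success and of "all pairs are bad" add up to
  -- at least 1.
  refine (Rand.expect_const x 1).symm.le.trans (Rand.expect_mono _ fun t ht => ?_)
  -- Only the shape of the sampled pairs is used here, so the bit bound `W` may be any number that
  -- satisfies the two size hypotheses.
  obtain ⟨⟨-, hsubs⟩, -⟩ := within_substs (P := fun _ => True) (K := 0) n (numSubsts T₁ ν)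
    (le_max_left _ _) (le_max_right _ _) t ht
  by_cases hb : ∀ a ∈ t.val, bad a
  · rw [if_pos hb]
    exact le_add_self
  · push Not at hb
    obtain ⟨a, ha, hab⟩ := hb
    obtain ⟨H, hH⟩ := recoverT_spec h (subs := t.val)
      (fun y hy => ⟨(hp _ (hsubs y hy).1).1.pos, (hsubs y hy).2.1⟩) ⟨a, ha, not_lt.1 hab⟩
    rw [if_pos ⟨H, hH⟩]
    exact le_self_add

end HalfPoly

end SparseInterp

namespace SparseInterp

open Timed

/-! ### The cost of HalfPoly -/

/-- A bound on the primes used by HalfPoly. -/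
noncomputable def maxPrime (T₁ D : ℕ) : ℕ := 2 * primeBound (32 * (T₁ - 1) + numPrimes T₁ D)

theorem one_le_numPrimes (T₁ D : ℕ) : 1 ≤ numPrimes T₁ D := le_max_right _ _

theorem le_maxPrime (T₁ D : ℕ) :
    32 * (T₁ - 1) + numPrimes T₁ D ≤ maxPrime T₁ D ∧ 32 ≤ maxPrime T₁ D := by
  have hm : 1 ≤ 32 * (T₁ - 1) + numPrimes T₁ D := (one_le_numPrimes T₁ D).trans le_add_self
  unfold maxPrime primeBound
  generalize 32 * (T₁ - 1) + numPrimes T₁ D = m at *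
  have hs : 1 ≤ m.size := Nat.size_pos.2 hm
  constructor <;> nlinarith

theorem within_primesT {P : Query → Prop} {T₁ D K : ℕ} (hX : (2 * maxPrime T₁ D).size ≤ K) :
    (primesT T₁ D).Within P 0 0
      (2 * opCost K K + 18 * (maxPrime T₁ D + 1) * K ^ 2 * opCost K K) := by
  obtain ⟨h1, h2⟩ := le_maxPrime T₁ D
  have hN := one_le_numPrimes T₁ D
  have hW : ∀ {a}, a ≤ 2 * maxPrime T₁ D → a.size ≤ K := fun h => (Nat.size_le_size h).trans hX
  have hp := within_firstPrimesT (P := P) (lo := 32 * (T₁ - 1)) (W := K) hN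
    (hW (by unfold maxPrime at h2 ⊢; omega))
  rw [primesT]
  refine Timed.Within.monoBits (Timed.Within.bindBits
    (within_subN (K := K) (W := K) (hW (by omega)) (hW (by omega)))
    (Timed.Within.bindBits (within_mulN_left (K := K) (W := K) (hW (by omega)) ?_) hp)) ?_
  · rw [subN_val]
    exact hW (by omega)
  · unfold maxPrime
    omega

variable {n : ℕ} {R : Type*} [CommRing R] [DecidableEq R] {S : ℕ → Type*} [∀ d, CommRing (S d)]
  [∀ d, Algebra R (S d)] {B : ∀ d, (Fin n → S d) → S d}
  {A : ∀ d, (S d → S d) → ℕ → List (ℕ × R)} {f fstar : MvPolynomial (Fin n) R}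
  {F : List (List ℕ × R)} {T T₁ D : ℕ}

theorem within_halfPoly (h : IsInput B A f fstar F T T₁ D) (ν : ℝ) {K W : ℕ}
    (hb : SizeBounds n T D (maxPrime T₁ D) (numSubsts T₁ ν) K W) :
    (halfPoly B A F T T₁ D ν).Within (IsAdmissible f T (2 * maxPrime T₁ D * D)) (fun _ => True)
      (numSubsts T₁ ν + n) (6 * numSubsts T₁ ν * T + 4 * n * T)
      (2 * opCost K K + 18 * (maxPrime T₁ D + 1) * K ^ 2 * opCost K K +
        (numSubsts T₁ ν * ((n + 2) * (opCost K K + 1) + 1) +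
        130 * (numSubsts T₁ ν + 1) * n * T * K * opCost K W)) := by
  obtain ⟨h1, h2⟩ := le_maxPrime T₁ D
  obtain ⟨-, -, hp⟩ := primesT_spec T₁ D
  have hW : ∀ {a}, a ≤ 2 * maxPrime T₁ D → a.size ≤ K := fun h =>
    (Nat.size_le_size h).trans hb.size_X
  refine Rand.Within.mono (Rand.Within.bind (f := _) (Rand.Within.lift (x := primesT T₁ D)
    (Q := fun ps => ps = (primesT T₁ D).val) rfl (within_primesT hb.size_X)) ?_)
    (fun _ h => h) (m := 0 + (0 + (numSubsts T₁ ν + n)))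
    (r := 0 + (0 + (6 * numSubsts T₁ ν * T + 4 * n * T))) (by omega) (by omega) le_rfl
  rintro _ rfl
  refine Rand.Within.bind (f := _) (within_substs (K := K) (W := K) n (numSubsts T₁ ν)
    (hW (by omega)) (hW (by unfold maxPrime; omega))) fun subs hsubs => ?_
  refine Rand.Within.lift trivial (within_recoverT h hb hsubs.1.le fun x hx => ?_)
  exact ⟨(hp _ (hsubs.2 x hx).1).2.2, (hsubs.2 x hx).2⟩

end SparseInterp

namespace SparseInterp

/-! ### Asymptotic bounds -/

theorem one_le_logp (x : ℝ) : 1 ≤ logp x := le_max_left _ _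

theorem log_le_logp (x : ℝ) : Real.log x ≤ logp x := le_max_right _ _

theorem natSize_le_log {a : ℕ} {y : ℝ} (hy : 1 ≤ y) (h : (a : ℝ) ≤ y) :
    (a.size : ℝ) ≤ 1 + 2 * Real.log y := by
  have hlog := Real.log_nonneg hy
  rcases Nat.eq_zero_or_pos a.size with h0 | h0
  · rw [h0, Nat.cast_zero]
    linarith
  · obtain ⟨s, hs⟩ : ∃ s, a.size = s + 1 := ⟨a.size - 1, by omega⟩
    have h2 : 2 ^ s ≤ a := Nat.lt_size.1 (by omega)
    have h3 : (2 : ℝ) ^ s ≤ y := le_trans (by exact_mod_cast h2) h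
    have h4 := Real.log_le_log (by positivity) h3
    rw [Real.log_pow] at h4
    rw [hs, Nat.cast_succ]
    nlinarith [Real.log_two_gt_d9, Nat.cast_nonneg (α := ℝ) s]

/-- The square leaves room for bounds that are a product of `ψ` and a logarithmic factor, which is
itself at most `ψ`. -/
theorem natSize_le {a c : ℕ} {ψ : ℝ} (hψ : 1 ≤ ψ) (h : (a : ℝ) ≤ 2 ^ c * ψ ^ 2) :
    (a.size : ℝ) ≤ (2 * c + 5) * (1 + Real.log ψ) := by
  have hlog := Real.log_nonneg hψ
  have h1 : (1 : ℝ) ≤ 2 ^ c * ψ ^ 2 :=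
    one_le_mul_of_one_le_of_one_le (one_le_pow₀ one_le_two) (one_le_pow₀ hψ)
  have := natSize_le_log h1 h
  rw [Real.log_mul (by positivity) (by positivity), Real.log_pow, Real.log_pow] at this
  push_cast at this
  nlinarith [Real.log_two_lt_d9, Nat.cast_nonneg (α := ℝ) c,
    mul_nonneg (Nat.cast_nonneg (α := ℝ) c) hlog]

theorem natSize_mul_le (a b : ℕ) : (a * b).size ≤ a.size + b.size := by
  rw [Nat.size_le, pow_add]
  exact Nat.mul_lt_mul'' (Nat.lt_size_self a) (Nat.lt_size_self b)

theorem natSize_le_logp (D : ℕ) : (D.size : ℝ) ≤ 3 * logp D := by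
  rcases Nat.eq_zero_or_pos D with rfl | hD
  · have := one_le_logp ((0 : ℕ) : ℝ)
    simp only [Nat.size_zero, Nat.cast_zero] at *
    linarith
  · have := natSize_le_log (a := D) (y := D) (by exact_mod_cast hD) le_rfl
    linarith [one_le_logp D, log_le_logp D]

theorem logp_le_self {D : ℕ} (hD : 1 ≤ D) : logp D ≤ D := by
  have h1 : (1 : ℝ) ≤ D := by exact_mod_cast hD
  exact max_le h1 (by linarith [Real.log_le_sub_one_of_pos (zero_lt_one.trans_le h1)])

/-- From `1 / log 2 ≤ 3/2` and `31 * 3/2 ≤ 47`. -/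
theorem numPrimes_le {T T₁ D : ℕ} (hT : 1 ≤ T₁) (hTT : T₁ ≤ T) :
    (numPrimes T₁ D : ℝ) ≤ 47 * (T * logp D) + 1 := by
  have hT1 : (1 : ℝ) ≤ T₁ := by exact_mod_cast hT
  have hTT' : (T₁ : ℝ) ≤ T := by exact_mod_cast hTT
  have hΛ := one_le_logp D
  have hlogD : 0 ≤ Real.log D := Real.log_natCast_nonneg D
  have hlogb0 : 0 ≤ Real.logb 2 D := div_nonneg hlogD (Real.log_nonneg one_le_two)
  have hlogb : Real.logb 2 D ≤ 3 / 2 * logp D := by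
    rw [Real.logb, div_le_iff₀ (Real.log_pos one_lt_two)]
    nlinarith [Real.log_two_gt_d9, log_le_logp D]
  have hfloor : (⌊((T₁ : ℝ) - 1) * Real.logb 2 D⌋₊ : ℝ) ≤ T * (3 / 2 * logp D) :=
    (Nat.floor_le (mul_nonneg (by linarith) hlogb0)).trans
      (mul_le_mul (by linarith) hlogb hlogb0 (by linarith))
  unfold numPrimes
  rw [Nat.cast_max]
  push_cast
  have : 0 ≤ T * logp D := mul_nonneg (by linarith) (by linarith)
  exact max_le (by linarith) (by linarith)

/-- The argument of `primeBound` is at most `80 T logp D` and has at most `19 (1 + log ψ)` bits,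
which gives the factor `2 * 16 * 80 * 19 = 48640 ≤ 2^16`. -/
theorem maxPrime_le {T T₁ D : ℕ} (hT : 1 ≤ T₁) (hTT : T₁ ≤ T) {ψ : ℝ} (hψ : T * logp D ≤ ψ) :
    (maxPrime T₁ D : ℝ) ≤ 2 ^ 16 * (T * logp D) * (1 + Real.log ψ) := by
  have hT1 : (1 : ℝ) ≤ T := by exact_mod_cast hT.trans hTT
  have hΛ := one_le_logp D
  have hTΛ : (T : ℝ) ≤ T * logp D := le_mul_of_one_le_right (by linarith) hΛ
  have hψ1 : 1 ≤ ψ := by linarith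
  have hm : ((32 * (T₁ - 1) + numPrimes T₁ D : ℕ) : ℝ) ≤ 80 * (T * logp D) := by
    have h1 := numPrimes_le (D := D) hT hTT
    have h2 : ((T₁ - 1 : ℕ) : ℝ) ≤ T := by exact_mod_cast (by omega : T₁ - 1 ≤ T)
    push_cast
    linarith
  have hs := natSize_le (a := 32 * (T₁ - 1) + numPrimes T₁ D) (c := 7) hψ1
    (hm.trans (by nlinarith))
  unfold maxPrime primeBound
  generalize 32 * (T₁ - 1) + numPrimes T₁ D = m at *
  have hL : 0 ≤ Real.log ψ := Real.log_nonneg hψ1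
  push_cast at hs ⊢
  calc (2 : ℝ) * (16 * m * m.size) = 32 * (m * m.size) := by ring
    _ ≤ 32 * (80 * (T * logp D) * ((2 * 7 + 5) * (1 + Real.log ψ))) := by gcongr
    _ = 48640 * ((T * logp D) * (1 + Real.log ψ)) := by ring
    _ ≤ 65536 * ((T * logp D) * (1 + Real.log ψ)) := by
        gcongr
        norm_num
    _ = _ := by ring

theorem numSubsts_le_add {T T₁ : ℕ} (hT : 1 ≤ T₁) (hTT : T₁ ≤ T) {ν : ℝ} (h0 : 0 < ν)
    (h1 : ν < 1) : (numSubsts T₁ ν : ℝ) ≤ 32 * (Real.log T + Real.log (1 / ν)) + 1 := by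
  have hT1 : (1 : ℝ) ≤ T₁ := by exact_mod_cast hT
  have hlog : 0 ≤ Real.log (T₁ / ν) := Real.log_nonneg (by rw [le_div_iff₀ h0]; linarith)
  have h3 := (Nat.ceil_lt_add_one (a := 32 * Real.log (T₁ / ν)) (by linarith)).le
  have h4 : Real.log (T₁ / ν) ≤ Real.log T + Real.log (1 / ν) := by
    rw [← Real.log_mul (by norm_cast; omega) (by positivity), mul_one_div]
    exact Real.log_le_log (by positivity) (by gcongr)
  unfold numSubsts
  linarith

theorem numSubsts_le {T T₁ : ℕ} (hT : 1 ≤ T₁) (hTT : T₁ ≤ T) {ν : ℝ} (h0 : 0 < ν)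
    (h1 : ν < 1) {ψ : ℝ} (hψ : (T : ℝ) ≤ ψ) :
    (numSubsts T₁ ν : ℝ) ≤ 65 * ((1 + Real.log ψ) * logp (1 / ν)) := by
  have hT1 : (1 : ℝ) ≤ T := by exact_mod_cast hT.trans hTT
  have h2 := numSubsts_le_add hT hTT h0 h1
  have h3 := Real.log_le_log (by linarith) hψ
  have h4 : 0 ≤ Real.log ψ := Real.log_nonneg (by linarith)
  nlinarith [one_le_logp (1 / ν), log_le_logp (1 / ν)]

theorem opCost_cast (K W : ℕ) : (opCost K W : ℝ) = (2 + K) * (2 + W) := by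
  unfold opCost
  push_cast
  ring

/-- Here `Λ`, `V`, `L` stand for `logp D`, `logp (1 / ν)` and the logarithmic factor of the soft
bound, `O` for an operation on short numbers, `O'` for one with a long operand. The sieve dominates:
`X K² O` has order `T Λ L^5`, with constant `18 * 2^17 * 4900 * 5184 < 10^14`. Each summand contains
at most one factor with `Λ`, either `X` or `O'`. -/
theorem bitOps_bound {n T Λ V L l X K O O' : ℝ} (hn : 1 ≤ n) (hT : 1 ≤ T) (hΛ : 1 ≤ Λ)
    (hV : 1 ≤ V) (hL : 1 ≤ L) (hK0 : 0 ≤ K) (hO0 : 0 ≤ O)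
    (hO0' : 0 ≤ O') (hl : l ≤ 65 * (L * V)) (hX : X ≤ 2 ^ 16 * (T * Λ) * L) (hK : K ≤ 70 * L)
    (hO : O ≤ 5184 * L ^ 2) (hO' : O' ≤ 12000 * (L ^ 2 * Λ)) :
    2 * O + 18 * (X + 1) * K ^ 2 * O +
      (l * ((n + 2) * (O + 1) + 1) + 130 * (l + 1) * n * T * K * O') ≤
      10 ^ 14 * (n * T * Λ * V) * L ^ 5 := by
  have hLV : 1 ≤ L * V := one_le_mul_of_one_le_of_one_le hL hV
  have hTΛL : 1 ≤ T * Λ * L :=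
    one_le_mul_of_one_le_of_one_le (one_le_mul_of_one_le_of_one_le hT hΛ) hL
  have hnL : 1 ≤ n * L ^ 2 := one_le_mul_of_one_le_of_one_le hn (one_le_pow₀ hL)
  have hL2 : 1 ≤ L ^ 2 := one_le_pow₀ hL
  have hX1 : X + 1 ≤ 2 ^ 17 * (T * Λ * L) := by linarith
  have hl1 : l + 1 ≤ 66 * (L * V) := by linarith
  have hO1 : O + 1 ≤ 5185 * L ^ 2 := by linarith
  have hn2 : n + 2 ≤ 3 * n := by linarith
  have h1 : 2 * O ≤ 10368 * (n * T * Λ * V * L ^ 5) := by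
    calc 2 * O ≤ 2 * (5184 * L ^ 2) := by gcongr
      _ = 10368 * (1 * 1 * 1 * 1 * L ^ 2) := by ring
      _ ≤ _ := by
        gcongr
        norm_num
  have h2 : 18 * (X + 1) * K ^ 2 * O ≤
      (18 * 2 ^ 17 * 4900 * 5184) * (n * T * Λ * V * L ^ 5) := by
    calc 18 * (X + 1) * K ^ 2 * O
        ≤ 18 * (2 ^ 17 * (T * Λ * L)) * (70 * L) ^ 2 * (5184 * L ^ 2) := by gcongr
      _ = (18 * 2 ^ 17 * 4900 * 5184) * (1 * T * Λ * 1 * L ^ 5) := by ring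
      _ ≤ _ := by gcongr
  have h3 : l * ((n + 2) * (O + 1) + 1) ≤ (65 * 15556) * (n * T * Λ * V * L ^ 5) := by
    calc l * ((n + 2) * (O + 1) + 1)
        ≤ (65 * (L * V)) * ((3 * n) * (5185 * L ^ 2) + n * L ^ 2) := by gcongr
      _ = (65 * 15556) * (n * 1 * 1 * V * L ^ 3) := by ring
      _ ≤ _ := by
        gcongr
        norm_num
  have h4 : 130 * (l + 1) * n * T * K * O' ≤
      (130 * 66 * 70 * 12000) * (n * T * Λ * V * L ^ 5) := by
    calc 130 * (l + 1) * n * T * K * O'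
        ≤ 130 * (66 * (L * V)) * n * T * (70 * L) * (12000 * (L ^ 2 * Λ)) := by gcongr
      _ = (130 * 66 * 70 * 12000) * (n * T * Λ * V * L ^ 4) := by ring
      _ ≤ _ := by
        gcongr
        norm_num
  have h5 : 0 ≤ n * T * Λ * V * L ^ 5 := by positivity
  linarith

end SparseInterp

/-! ### Sizes of the numbers and the final asymptotic estimates -/

namespace SparseInterp

theorem sizeBounds_sum (n T D X l : ℕ) (hX : 1 ≤ X) :
    SizeBounds n T D X l ((2 * X).size + (2 * T).size + n.size + l.size)
      ((2 * X).size + (2 * T).size + n.size + l.size + (n * (2 * X * D) * (2 * X)).size) where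
  one_le_X := hX
  size_X := by omega
  size_T := by omega
  size_n := by omega
  size_l := by omega
  K_le := by omega
  size_D := by omega

/-- The summands of `K` contribute `39 + 7 + 5 + 19 = 70` multiples of `1 + log φ`. In `W` the size
of the product adds `5 + 39 + 39` multiples and `3 logp D` for `D`; only this last part depends on
`D` beyond `log φ`. -/
theorem exists_sizeBounds {n T T₁ D : ℕ} {ν φ : ℝ} (hn : 1 ≤ n) (hT : 1 ≤ T₁) (hTT : T₁ ≤ T)
    (h0 : 0 < ν) (h1 : ν < 1) (hφ : n * T * logp D * logp (1 / ν) = φ) :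
    ∃ K W, SizeBounds n T D (maxPrime T₁ D) (numSubsts T₁ ν) K W ∧
      (K : ℝ) ≤ 70 * (1 + Real.log φ) ∧ (W : ℝ) ≤ 156 * ((1 + Real.log φ) * logp D) := by
  refine ⟨_, _, sizeBounds_sum n T D _ _ (by have := (le_maxPrime T₁ D).2; omega), ?_⟩
  have hn' : (1 : ℝ) ≤ n := by exact_mod_cast hn
  have hT' : (1 : ℝ) ≤ T := by exact_mod_cast hT.trans hTT
  have hΛ := one_le_logp D
  have hV := one_le_logp (1 / ν)
  have hφΛ : T * logp D ≤ φ := by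
    calc T * logp D = 1 * T * logp D * 1 := by ring
      _ ≤ n * T * logp D * logp (1 / ν) := by gcongr
      _ = φ := hφ
  have hφV : logp (1 / ν) ≤ φ := by
    calc logp (1 / ν) = 1 * 1 * 1 * logp (1 / ν) := by ring
      _ ≤ n * T * logp D * logp (1 / ν) := by gcongr
      _ = φ := hφ
  have hφn : (n : ℝ) ≤ φ := by
    calc (n : ℝ) = n * 1 * 1 * 1 := by ring
      _ ≤ n * T * logp D * logp (1 / ν) := by gcongr
      _ = φ := hφ
  have hφT : (T : ℝ) ≤ φ := (le_mul_of_one_le_right (by linarith) hΛ).trans hφΛ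
  have hφ1 : 1 ≤ φ := hn'.trans hφn
  have hlog := Real.log_nonneg hφ1
  have hLφ : 1 + Real.log φ ≤ φ := by linarith [Real.log_le_sub_one_of_pos (zero_lt_one.trans_le hφ1)]
  have hφ2 : φ ≤ φ ^ 2 := by nlinarith
  have hX : ((2 * maxPrime T₁ D).size : ℝ) ≤ 39 * (1 + Real.log φ) := by
    have := natSize_le (a := 2 * maxPrime T₁ D) (c := 17) hφ1 (by
      have := maxPrime_le (D := D) hT hTT hφΛ
      push_cast
      calc (2 : ℝ) * maxPrime T₁ D ≤ 2 * (2 ^ 16 * (T * logp D) * (1 + Real.log φ)) := by gcongr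
        _ ≤ 2 * (2 ^ 16 * φ * φ) := by gcongr
        _ = _ := by ring)
    norm_num at this ⊢
    exact this
  have hTs : ((2 * T).size : ℝ) ≤ 7 * (1 + Real.log φ) := by
    have := natSize_le (a := 2 * T) (c := 1) hφ1 (by push_cast; linarith)
    norm_num at this ⊢
    exact this
  have hns : (n.size : ℝ) ≤ 5 * (1 + Real.log φ) := by
    have := natSize_le (a := n) (c := 0) hφ1 (by linarith)
    norm_num at this ⊢
    exact this
  have hls : ((numSubsts T₁ ν).size : ℝ) ≤ 19 * (1 + Real.log φ) := by
    have := natSize_le (a := numSubsts T₁ ν) (c := 7) hφ1 (by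
      refine (numSubsts_le hT hTT h0 h1 hφT).trans ?_
      calc 65 * ((1 + Real.log φ) * logp (1 / ν)) ≤ 128 * (φ * φ) := by gcongr; norm_num
        _ = _ := by ring)
    norm_num at this ⊢
    exact this
  have hDs := natSize_le_logp D
  have hprod : ((n * (2 * maxPrime T₁ D * D) * (2 * maxPrime T₁ D)).size : ℝ) ≤
      n.size + ((2 * maxPrime T₁ D).size + D.size) + (2 * maxPrime T₁ D).size := by
    exact_mod_cast (natSize_mul_le _ _).trans (add_le_add_left ((natSize_mul_le _ _).trans
      (add_le_add_right (natSize_mul_le _ _) _)) _)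
  push_cast
  constructor
  · linarith
  · nlinarith

theorem softO_mono {C φ : ℝ} {j k : ℕ} (hC : 0 ≤ C) (hφ : 1 ≤ φ) (hjk : j ≤ k) :
    C * φ * (1 + Real.log φ) ^ j ≤ softO C k φ := by
  have := Real.log_nonneg hφ
  unfold softO
  gcongr
  linarith

theorem degBound_le_softO {T T₁ D : ℕ} (hT : 1 ≤ T₁) (hTT : T₁ ≤ T) :
    ((2 * maxPrime T₁ D * D : ℕ) : ℝ) ≤ softO (10 ^ 14) 5 (T * D) := by
  rcases Nat.eq_zero_or_pos D with rfl | hD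
  -- For `D = 0` both sides vanish.
  · simp [softO]
  have hT' : (1 : ℝ) ≤ T := by exact_mod_cast hT.trans hTT
  have hD' : (1 : ℝ) ≤ D := by exact_mod_cast hD
  have hTD : (1 : ℝ) ≤ T * D := one_le_mul_of_one_le_of_one_le hT' hD'
  have hlog := Real.log_nonneg hTD
  have hΛ : logp D ≤ 1 + Real.log (T * D) := by
    have := Real.log_le_log (by linarith) (le_mul_of_one_le_left (by linarith) hT' : (D : ℝ) ≤ T * D)
    exact max_le (by linarith) (by linarith)
  have hX := maxPrime_le (D := D) hT hTT (ψ := T * D) (by gcongr; exact logp_le_self hD)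
  refine le_trans ?_ (softO_mono (j := 2) (by norm_num) hTD (by norm_num))
  push_cast
  calc (2 : ℝ) * maxPrime T₁ D * D
      ≤ 2 * (2 ^ 16 * (T * (1 + Real.log (T * D))) * (1 + Real.log (T * D))) * D := by
        gcongr
        exact hX.trans (by gcongr)
    _ = 131072 * (T * D * (1 + Real.log (T * D)) ^ 2) := by ring
    _ ≤ 10 ^ 14 * (T * D * (1 + Real.log (T * D)) ^ 2) := by
        gcongr
        norm_num
    _ = _ := by ring

/-- The number of substitutions contributes `logp (1 / ν)` and a factor `log T`, which is absorbed
by the logarithm of the soft bound because `T ≤ n T logp (1 / ν)`. -/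
theorem ringOps_le_softO {n T T₁ : ℕ} {ν : ℝ} (hn : 1 ≤ n) (hT : 1 ≤ T₁) (hTT : T₁ ≤ T)
    (h0 : 0 < ν) (h1 : ν < 1) :
    ((6 * numSubsts T₁ ν * T + 4 * n * T : ℕ) : ℝ) ≤
      softO (10 ^ 14) 5 (n * T * logp (1 / ν)) := by
  have hn' : (1 : ℝ) ≤ n := by exact_mod_cast hn
  have hT' : (1 : ℝ) ≤ T := by exact_mod_cast hT.trans hTT
  have hV := one_le_logp (1 / ν)
  set V := logp (1 / ν) with hVdef
  have hTφ : (T : ℝ) ≤ n * T * V := by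
    calc (T : ℝ) = 1 * T * 1 := by ring
      _ ≤ n * T * V := by gcongr
  have hlog := Real.log_nonneg (hT'.trans hTφ)
  have hl := numSubsts_le hT hTT h0 h1 hTφ
  refine le_trans ?_ (softO_mono (j := 1) (by norm_num) (hT'.trans hTφ) (by norm_num))
  rw [← hVdef] at hl
  set L := 1 + Real.log (n * T * V) with hL
  have hL1 : 1 ≤ L := by linarith
  push_cast
  calc 6 * (numSubsts T₁ ν : ℝ) * T + 4 * n * T
      ≤ 6 * (65 * (L * V)) * T + 4 * n * T := by gcongr
    _ = 390 * (1 * T * V * L) + 4 * (n * T * 1 * 1) := by ring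
    _ ≤ 390 * (n * T * V * L) + 4 * (n * T * V * L) := by gcongr
    _ = 394 * (n * T * V * L) := by ring
    _ ≤ 10 ^ 14 * (n * T * V * L) := by
        gcongr
        norm_num
    _ = _ := by ring

theorem bitOps_le_softO {n T T₁ D K W : ℕ} {ν : ℝ} (hn : 1 ≤ n) (hT : 1 ≤ T₁) (hTT : T₁ ≤ T)
    (h0 : 0 < ν) (h1 : ν < 1)
    (hK : (K : ℝ) ≤ 70 * (1 + Real.log (n * T * logp D * logp (1 / ν))))
    (hW : (W : ℝ) ≤ 156 * ((1 + Real.log (n * T * logp D * logp (1 / ν))) * logp D)) :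
    ((2 * opCost K K + 18 * (maxPrime T₁ D + 1) * K ^ 2 * opCost K K +
        (numSubsts T₁ ν * ((n + 2) * (opCost K K + 1) + 1) +
        130 * (numSubsts T₁ ν + 1) * n * T * K * opCost K W) : ℕ) : ℝ) ≤
      softO (10 ^ 14) 5 (n * T * logp D * logp (1 / ν)) := by
  have hn' : (1 : ℝ) ≤ n := by exact_mod_cast hn
  have hT' : (1 : ℝ) ≤ T := by exact_mod_cast hT.trans hTT
  have hΛ := one_le_logp D
  have hV := one_le_logp (1 / ν)
  have hφΛ : T * logp D ≤ n * T * logp D * logp (1 / ν) := by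
    calc T * logp D = 1 * T * logp D * 1 := by ring
      _ ≤ n * T * logp D * logp (1 / ν) := by gcongr
  have hφT := (le_mul_of_one_le_right (by linarith : (0 : ℝ) ≤ T) hΛ).trans hφΛ
  have hlog := Real.log_nonneg (hT'.trans hφT)
  have hl := numSubsts_le hT hTT h0 h1 hφT
  have hX := maxPrime_le (D := D) hT hTT hφΛ
  unfold softO
  set L := 1 + Real.log (n * T * logp D * logp (1 / ν)) with hL
  have hL1 : 1 ≤ L := by linarith
  push_cast
  refine bitOps_bound hn' hT' hΛ hV hL1 (Nat.cast_nonneg K) (Nat.cast_nonneg _)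
    (Nat.cast_nonneg _) hl hX hK ?_ ?_
  · rw [opCost_cast]
    calc ((2 : ℝ) + K) * (2 + K) ≤ (72 * L) * (72 * L) := by gcongr <;> linarith
      _ = _ := by ring
  · have hLΛ : 1 ≤ L * logp D := one_le_mul_of_one_le_of_one_le hL1 hΛ
    rw [opCost_cast]
    calc ((2 : ℝ) + K) * (2 + W) ≤ (72 * L) * (158 * (L * logp D)) := by gcongr <;> linarith
      _ = 11376 * (L ^ 2 * logp D) := by ring
      _ ≤ _ := by
        gcongr
        norm_num

/-- The rounding up in the number of substitutions is absorbed by `n ≥ 1`. -/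
theorem length_queries_le {n T T₁ : ℕ} {ν : ℝ} (hn : 1 ≤ n) (hT : 1 ≤ T₁) (hTT : T₁ ≤ T)
    (h0 : 0 < ν) (h1 : ν < 1) :
    ((numSubsts T₁ ν + n : ℕ) : ℝ) ≤ 10 ^ 14 * (n + Real.log T + Real.log (1 / ν)) := by
  have hn' : (1 : ℝ) ≤ n := by exact_mod_cast hn
  have h2 : 0 ≤ Real.log T := Real.log_natCast_nonneg T
  have h3 : 0 ≤ Real.log (1 / ν) := Real.log_nonneg (by rw [le_div_iff₀ h0]; linarith)
  have := numSubsts_le_add hT hTT h0 h1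
  push_cast
  linarith

end SparseInterp

theorem mainTheorem6 :
    ∃ (C : ℝ) (k : ℕ), ∀ (n : ℕ) (R : Type*) [CommRing R] [DecidableEq R]
      (S : ℕ → Type*) [∀ d, CommRing (S d)] [∀ d, Algebra R (S d)]
      (B : ∀ d, (Fin n → S d) → S d) (A : ∀ d, (S d → S d) → ℕ → List (ℕ × R))
      (f fstar : MvPolynomial (Fin n) R) (F : List (List ℕ × R)) (T T₁ D : ℕ) (ν : ℝ),
      1 ≤ n →
      SparseInterp.IsBlackBox B f →
      SparseInterp.IsInterpolator A →
      SparseInterp.IsMvSparseRep n F fstar →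
      f.support.card ≤ T → fstar.support.card ≤ T →
      (f - fstar).support.card ≤ T₁ → 1 ≤ T₁ → T₁ ≤ T →
      f.totalDegree ≤ D → fstar.totalDegree ≤ D →
      0 < ν → ν < 1 →
      -- with probability at least `1 - ν` the output is as required
      ENNReal.ofReal (1 - ν) ≤
        (SparseInterp.halfPoly B A F T T₁ D ν).toOuterMeasure
          {r | ∃ h, r.val = some h ∧
            (f - fstar - SparseInterp.toMvPoly n h).support.card ≤ T₁ / 2} ∧
      -- for all random choices:
      ∀ r ∈ (SparseInterp.halfPoly B A F T T₁ D ν).support,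
        -- the number of interpolations
        (r.cost.queries.length : ℝ) ≤ C * (n + Real.log T + Real.log (1 / ν)) ∧
        -- the interpolated polynomials respect the bounds given to the interpolation algorithm,
        -- and these are as claimed
        (∀ q ∈ r.cost.queries,
          (SparseInterp.kron f q.exps).natDegree ≤ q.degBound ∧
          (SparseInterp.kron f q.exps).support.card ≤ q.termBound ∧
          (q.degBound : ℝ) ≤ SparseInterp.softO C k (T * D) ∧
          q.termBound ≤ T) ∧
        -- the number of ring operations and of bit operations
        (r.cost.ringOps : ℝ) ≤
          SparseInterp.softO C k (n * T * SparseInterp.logp (1 / ν)) ∧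
        (r.cost.bitOps : ℝ) ≤
          SparseInterp.softO C k
            (n * T * SparseInterp.logp D * SparseInterp.logp (1 / ν)) := by
  -- Both constants are dictated by the bit cost of the sieve in `bitOps_bound`; the other three
  -- bounds hold with room to spare.
  refine ⟨10 ^ 14, 5, ?_⟩
  intro n R _ _ S _ _ B A f fstar F T T₁ D ν hn hB hA hF hfT hfsT hsub hT₁ hTT hfD hfsD h0 h1
  have h : SparseInterp.IsInput B A f fstar F T T₁ D :=
    ⟨hn, hB, hA, hF, hfT, hfsT, hsub, hT₁, hTT, hfD, hfsD⟩
  refine ⟨SparseInterp.ofReal_le_toOuterMeasure_halfPoly h h0 h1, fun r hr => ?_⟩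
  obtain ⟨K, W, hb, hK, hW⟩ := SparseInterp.exists_sizeBounds (D := D) hn hT₁ hTT h0 h1 rfl
  obtain ⟨-, hr⟩ := SparseInterp.within_halfPoly h ν hb r hr
  refine ⟨?_, fun q hq => ?_, ?_, ?_⟩
  · exact (Nat.cast_le.2 hr.length_le).trans
      (SparseInterp.length_queries_le hn hT₁ hTT h0 h1)
  · obtain ⟨h2, h3, h4, h5⟩ := hr.forall_queries q hq
    exact ⟨h2, h3, (Nat.cast_le.2 h4).trans (SparseInterp.degBound_le_softO hT₁ hTT), h5⟩
  · exact (Nat.cast_le.2 hr.ringOps_le).trans (SparseInterp.ringOps_le_softO hn hT₁ hTT h0 h1)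
  · exact (Nat.cast_le.2 hr.bitOps_le).trans
      (SparseInterp.bitOps_le_softO hn hT₁ hTT h0 h1 hK hW)
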